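/- Let $H$ be a real separable infinite-dimensional Hilbert space with norm $|\cdot|$ and orthonormal basis $(e_k)_{k\ge1}$, let $B$ be the self-adjoint operator with $Be_k=-\beta_ke_k$, where $\beta_k>0$ and $\beta_k\uparrow\infty$, let $\alpha\in(1,2)$, and let $\gamma_k>0$ satisfy $\sum_k\gamma_k^\alpha/\beta_k<\infty$. Let $G:\mathbb R\times H\times H\to H$ be measurable, and suppose that there are constants $C_G>0$ and $L_G<\beta_1$ such that, for all $t\in\mathbb R$ and $x,x_i,y,y_i\in H$, $$|G(t,x_1,y_1)-G(t,x_2,y_2)|\le C_G|x_1-x_2|+L_G|y_1-y_2|,\qquad |G(t,x,y)|\le C_G(1+|x|)+L_G|y|.$$ On a probability space $(\Omega,\mathscr F,\mathbb P)$ let $Z^k,\tilde Z^k$ $(k\ge1)$ be independent one-dimensional symmetric $\alpha$-stable (Lévy) processes with $\mathbb E e^{ihZ^k_t}=\mathbb E e^{ih\tilde Z^k_t}=e^{-t|h|^\alpha}$ for $t\ge0$, $h\in\mathbb R$; put $Z^k_t:=\tilde Z^k_{-t}$ for $t<0$, and $Z_t=\sum_k\gamma_kZ^k_te_k$ for $t\in\mathbb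 R$. For $s\in\mathbb R$ and $x,y\in H$, a mild solution $(Y^{s,x,y}_t)_{t\ge s}$ of the frozen equation $dY_t=[BY_t+G(t,x,Y_t)]\,dt+dZ_t$, $Y_s=y$, is a jointly measurable $H$-valued process such that for each $t\ge s$, $\mathbb P$-a.s., $r\mapsto G(r,x,Y^{s,x,y}_r)$ is integrable on $[s,t]$ and $$Y^{s,x,y}_t=e^{(t-s)B}y+\int_s^te^{(t-r)B}G(r,x,Y^{s,x,y}_r)\,dr+\int_s^te^{(t-r)B}\,dZ_r,$$ where the last term is $\sum_k\gamma_k\big(\int_s^te^{-\beta_k(t-r)}\,dZ^k_r\big)e_k$, the series converging in $H$. Such a solution exists for all $s,x,y$ and is unique up to modification. Put $P^x_{s,t}\varphi(y)=\mathbb E\,\varphi(Y^{s,x,y}_t)$ for $s\le t$. For all $t\in\mathbb R$ and $x\in H$ there is a random variable $\eta^x_t$ (the pullback limit) that lies in $L^p(\Omega;H)$ and satisfies $\lim_{s\to-\infty}\mathbb E|Y^{s,x,y}_t-\eta^x_t|^p=0$, for all $p\in[1,\alpha)$ and all $y\in H$. Let $\mu^x_t$ be the law of $\eta^x_t$. A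 family $\{\nu_t\}_{t\in\mathbb R}$ of Borel probability measures on $H$ is called an evolution system of measures for $\{P^x_{s,t}\}_{t\ge s}$ if $\int_HP^x_{s,t}\varphi\,d\nu_s=\int_H\varphi\,d\nu_t$ for all $s\le t$ and $\varphi\in C_b(H)$. Then: 1. For every $x\in H$, $\{\mu^x_t\}_{t\in\mathbb R}$ is an evolution system of measures for $\{P^x_{s,t}\}_{t\ge s}$, and $\sup_{t\in\mathbb R}\int_H|z|\,\mu^x_t(dz)<\infty$. 2. There is a constant $C>0$, independent of $x,y,s,t,\phi$, such that for all $x,y\in H$, all $s\le t$ and every Lipschitz continuous $\phi:H\to\mathbb R$, both $\phi(Y^{s,x,y}_t)$ and $\phi$ are integrable (with respect to $\mathbb P$ and $\mu^x_t$ respectively) and $$\Big|P^x_{s,t}\phi(y)-\int_H\phi(z)\,\mu^x_t(dz)\Big|\le C\,\mathrm{Lip}(\phi)\,(1+|x|+|y|)\,e^{-(t-s)(\beta_1-L_G)/2},\qquad \mathrm{Lip}(\phi):=\sup_{u\ne v}\frac{|\phi(u)-\phi(v)|}{|u-v|}.$$ 3. For every $x\in H$, if $\{\nu_t\}_{t\in\mathbb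 R}$ is an evolution system of measures for $\{P^x_{s,t}\}_{t\ge s}$ with $\sup_{t\in\mathbb R}\int_H|y|\,\nu_t(dy)<\infty$, then $\nu_t=\mu^x_t$ for all $t\in\mathbb R$. -/

import Mathlib

open MeasureTheory ProbabilityTheory Filter Topology Set
open scoped NNReal ENNReal BoundedContinuousFunction

namespace FrozenSPDE

/-- A standard one-dimensional symmetric `α`-stable process on `[0, ∞)`: the Lévy process with
`𝔼 exp (i h X_t) = exp (-t |h| ^ α)`. -/
structure IsSymmStableProcess {Ω : Type*} [MeasurableSpace Ω] (P : Measure Ω) (α : ℝ)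
    (X : ℝ≥0 → Ω → ℝ) : Prop where
  measurable : ∀ t, Measurable (X t)
  start_zero : ∀ᵐ ω ∂P, X 0 ω = 0
  indep_increments : HasIndepIncrements X P
  stationary_increments : ∀ s t, IdentDistrib (fun ω => X (s + t) ω - X s ω) (X t) P P
  charFun_eq : ∀ (t : ℝ≥0) (h : ℝ),
    ∫ ω, Complex.exp (Complex.I * ((X t ω * h : ℝ) : ℂ)) ∂P
      = ((Real.exp (-(t : ℝ) * |h| ^ α) : ℝ) : ℂ)
  cadlag : ∀ᵐ ω ∂P, ∀ t : ℝ≥0, ContinuousWithinAt (fun r => X r ω) (Ici t) t ∧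
    ∃ l : ℝ, Tendsto (fun r => X r ω) (𝓝[<] t) (𝓝 l)

/-- The two-sided extension of the coordinate processes of the noise: `Z_t` for `t ≥ 0` and
`Z̃_{-t}` for `t < 0`. -/
noncomputable def twoSided {Ω : Type*} (Z Ztilde : ℕ → ℝ≥0 → Ω → ℝ) (k : ℕ) (t : ℝ) (ω : Ω) : ℝ :=
  if 0 ≤ t then Z k t.toNNReal ω else Ztilde k (-t).toNNReal ω

/-- The integral `∫_s^t f(r) dX_r` of a deterministic `C¹` integrand `f` against a path `X` with
one-sided limits: the pathwise Riemann-Stieltjes integral, defined through integration by parts. -/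
noncomputable def stieltjesInt (f X : ℝ → ℝ) (s t : ℝ) : ℝ :=
  f t * X t - f s * X s - ∫ r in s..t, deriv f r * X r

section

variable {H : Type*} [NormedAddCommGroup H] [InnerProductSpace ℝ H]

/-- The semigroup `e^{tB}`, `t ≥ 0`, generated by the self-adjoint operator `B` with
`B e_k = -β_k e_k`, where `(e_k)` is an orthonormal basis. -/
noncomputable def expB (e : HilbertBasis ℕ ℝ H) (β : ℕ → ℝ) (t : ℝ) (y : H) : H :=
  ∑' k, (Real.exp (-β k * t) * inner ℝ (e k) y) • e k

variable [MeasurableSpace H] {Ω : Type*} [MeasurableSpace Ω]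

/-- `Y = (Y_t)_{t ≥ s}` is a mild solution of
`dY_t = [B Y_t + G(t, x, Y_t)] dt + dZ_t`, `Y_s = y`, where `Z_t = ∑ γ_k Z^k_t e_k`. The process `Y`
is jointly measurable, and for each `t ≥ s`, almost surely,
`Y_t = e^{(t-s)B} y + ∫_s^t e^{(t-r)B} G(r, x, Y_r) dr + ∫_s^t e^{(t-r)B} dZ_r`,
where the drift is integrable on `[s, t]` and the last term is the sum, convergent in `H`, of the
vectors `γ_k (∫_s^t e^{-β_k (t-r)} dZ^k_r) e_k`. Values of `Y` before time `s` play no role. -/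
structure IsMildSolution (P : Measure Ω) (e : HilbertBasis ℕ ℝ H) (β γ : ℕ → ℝ)
    (G : ℝ → H → H → H) (Z : ℕ → ℝ → Ω → ℝ) (s : ℝ) (x y : H) (Y : ℝ → Ω → H) : Prop where
  measurable : Measurable (fun p : Ici s × Ω => Y p.1 p.2)
  integrable : ∀ t, s ≤ t →
    ∀ᵐ ω ∂P, IntervalIntegrable (fun r => G r x (Y r ω)) volume s t
  mild : ∀ t, s ≤ t → ∀ᵐ ω ∂P, ∃ z : H,
    HasSum (fun k => (γ k * stieltjesInt (fun r => Real.exp (-β k * (t - r)))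
      (fun r => Z k r ω) s t) • e k) z ∧
    Y t ω = expB e β (t - s) y + (∫ r in s..t, expB e β (t - r) (G r x (Y r ω))) + z

/-- `η` is the pullback limit at time `t` with frozen variable `x`: it lies in `L^p` and is the
`L^p`-limit of `Y_t^{s,x,y}` as `s → -∞`, for every `p ∈ [1, α)` and every initial value `y`. Here
`Y s x y t` is the solution at time `t` started from `y` at time `s`. -/
def IsPullbackLimit (P : Measure Ω) (α : ℝ) (Y : ℝ → H → H → ℝ → Ω → H) (x : H) (t : ℝ)
    (η : Ω → H) : Prop :=
  ∀ p : ℝ, 1 ≤ p → p < α → MemLp η (ENNReal.ofReal p) P ∧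
    ∀ y : H, Tendsto (fun s => eLpNorm (fun ω => Y s x y t ω - η ω) (ENNReal.ofReal p) P)
      atBot (𝓝 0)

/-- The transition semigroup `P^x_{s,t} φ (y) = 𝔼 φ(Y_t^{s,x,y})`. -/
noncomputable def transition (P : Measure Ω) (Y : ℝ → H → H → ℝ → Ω → H) (x : H) (s t : ℝ)
    (φ : H → ℝ) (y : H) : ℝ :=
  ∫ ω, φ (Y s x y t ω) ∂P

/-- A family of probability measures indexed by `ℝ` is an evolution system of measures for the
operators `T s t`, `s ≤ t`, if `∫ T_{s,t} φ dν_s = ∫ φ dν_t` for all `s ≤ t` and `φ ∈ C_b(H)`. -/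
structure IsEvolutionSystem (T : ℝ → ℝ → (H → ℝ) → H → ℝ) (ν : ℝ → Measure H) : Prop where
  isProbabilityMeasure : ∀ t, IsProbabilityMeasure (ν t)
  integral_eq : ∀ s t, s ≤ t → ∀ φ : H →ᵇ ℝ, ∫ y, T s t φ y ∂(ν s) = ∫ y, φ y ∂(ν t)

/-- Uniformly bounded first moments: `sup_t ∫ |y| ν_t(dy) < ∞`. -/
def HasBoundedFirstMoments (ν : ℝ → Measure H) : Prop :=
  ⨆ t, ∫⁻ y, ‖y‖ₑ ∂(ν t) < ∞

/-- `Lip(φ) = sup_{x ≠ y} |φ(x) - φ(y)| / |x - y|`. -/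
noncomputable def lipConst (φ : H → ℝ) : ℝ :=
  sSup {q : ℝ | ∃ x y : H, x ≠ y ∧ q = |φ x - φ y| / ‖x - y‖}

end

end FrozenSPDE

open FrozenSPDE

/-! Two solutions driven by the same noise have a noise-free difference, so it satisfies `|D_t| ≤
e^{-β_0(t-s)}|D_s| + L_G ∫_s^t e^{-β_0(t-r)}|D_r| dr`, with the smallest eigenvalue written `β_0`.
Since `L_G < β_0`, weighting by `e^{(β_0-L_G)(t-s)/2}` makes this a strict contraction. Hence
`|D_t|` is at most `(β_0+L_G)/(β_0-L_G) · e^{-(β_0-L_G)(t-s)/2} |D_s|`, almost surely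
(`volterraBound_le`, `IsMildFrom.enorm_sub_le`).

The second ingredient is a moment bound uniform in `s ≤ t`. Stable variables have no second moment,
so the coordinates of the stochastic convolution cannot be summed in `L²`. Instead, `E min(1,
(cX)²)` is controlled by the characteristic function of `X`; for the `k`-th coordinate this gives a
multiple of `c^α γ_k^α/β_k`. Summing over `k` yields tails of order `l^{-α}`, hence all moments of
order `p < α` (`measure_le_tsum_sq_le`, `exists_lintegral_stochConv_le`). A sharp Gronwall
inequality carries them over to the solutions, linearly in `1+|x|+|y|` (`exists_lintegral_mild_le`).

The third ingredient is the Markov property. A solution up to time `s` is a function of the noise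
increments before `s`, and one started from a point at time `s` a function of those after `s`, up to
null sets. This is seen by building a solution by Picard iteration inside the relevant σ-algebra and
invoking uniqueness. The two σ-algebras are independent (`indep_noisePast_noiseFuture`).

The rest is soft and uses only `IsContractiveFlow`. Contraction and bounded moments make the
solutions started at `0` Cauchy as the starting time tends to `-∞`. Passing to the limit in the
Markov property gives the evolution system, and the contraction survives the limit as the
exponential estimate. Finally, integrating that estimate against `ν_s` and letting `s → -∞`
identifies any competitor whose first moments stay bounded. -/

section Semigroup

/-! ### The diagonal semigroup `e^{tB}` -/

variable {H : Type*} [NormedAddCommGroup H] [InnerProductSpace ℝ H] (e : HilbertBasis ℕ ℝ H)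

theorem HilbertBasis.summable_smul_of_summable_sq [CompleteSpace H] {c : ℕ → ℝ}
    (hc : Summable fun k => c k ^ 2) :
    Summable fun k => c k • e k := by
  have hV := e.orthonormal.orthogonalFamily
  have h := hV.summable_iff_norm_sq_summable (fun k => c k)
  simp only [LinearIsometry.toSpanSingleton_apply] at h
  rw [h]
  simpa using hc

theorem HilbertBasis.hasSum_norm_sq_of_hasSum {c : ℕ → ℝ} {z : H}
    (hz : HasSum (fun k => c k • e k) z) : HasSum (fun k => c k ^ 2) (‖z‖ ^ 2) := by
  have hco : ∀ j, inner ℝ (e j) z = c j := by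
    intro j
    have h1 : HasSum (fun k => inner ℝ (e j) (c k • e k)) (inner ℝ (e j) z) :=
      hz.mapL (innerSL ℝ (e j))
    refine h1.unique ?_
    convert hasSum_ite_eq j (c j) using 2 with k
    rw [inner_smul_right, orthonormal_iff_ite.1 e.orthonormal]
    by_cases h : k = j
    · simp [h]
    · simp [h, Ne.symm h]
  have h := e.hasSum_inner_mul_inner z z
  rw [real_inner_self_eq_norm_sq] at h
  have h2 : (fun k => c k ^ 2) = fun k => inner ℝ z (e k) * inner ℝ (e k) z := by
    funext k
    rw [real_inner_comm, hco, sq]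
  rw [h2]
  exact h

theorem HilbertBasis.hasSum_inner_smul (y : H) : HasSum (fun k => inner ℝ (e k) y • e k) y := by
  have h := e.hasSum_repr y
  simpa [e.repr_apply_apply] using h

include e in
theorem HilbertBasis.secondCountableTopology : SecondCountableTopology H := by
  have : TopologicalSpace.SeparableSpace H := by
    rw [← TopologicalSpace.isSeparable_univ_iff]
    have h1 : TopologicalSpace.IsSeparable (range e) := (countable_range e).isSeparable
    have h2 := (h1.span (R := ℝ)).closure
    have h3 : closure ((Submodule.span ℝ (range e) : Submodule ℝ H) : Set H) = univ := by
      rw [← Submodule.topologicalClosure_coe, e.dense_span, Submodule.top_coe]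
    rwa [h3] at h2
  exact UniformSpace.secondCountable_of_separable H

variable {β : ℕ → ℝ} (hβ_pos : ∀ k, 0 < β k) (hβ_mono : Monotone β)

include hβ_pos in
theorem summable_expB [CompleteSpace H] {t : ℝ} (ht : 0 ≤ t) (y : H) :
    Summable fun k => (Real.exp (-β k * t) * inner ℝ (e k) y) • e k := by
  apply e.summable_smul_of_summable_sq
  have h := (e.hasSum_norm_sq_of_hasSum (e.hasSum_inner_smul y)).summable
  refine Summable.of_nonneg_of_le (fun k => sq_nonneg _) (fun k => ?_) h
  rw [mul_pow]
  have h1 : Real.exp (-β k * t) ≤ 1 := Real.exp_le_one_iff.2 (by nlinarith [hβ_pos k])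
  have h2 : Real.exp (-β k * t) ^ 2 ≤ 1 := pow_le_one₀ (Real.exp_pos _).le h1
  nlinarith [sq_nonneg (inner ℝ (e k) y)]

include hβ_pos in
theorem hasSum_expB [CompleteSpace H] {t : ℝ} (ht : 0 ≤ t) (y : H) :
    HasSum (fun k => (Real.exp (-β k * t) * inner ℝ (e k) y) • e k) (expB e β t y) :=
  (summable_expB e hβ_pos ht y).hasSum

include hβ_pos in
theorem inner_expB [CompleteSpace H] {t : ℝ} (ht : 0 ≤ t) (y : H) (j : ℕ) :
    inner ℝ (e j) (expB e β t y) = Real.exp (-β j * t) * inner ℝ (e j) y := by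
  have h1 := (hasSum_expB e hβ_pos ht y).mapL (innerSL ℝ (e j))
  refine h1.unique ?_
  have h2 : (fun k => innerSL ℝ (e j) ((Real.exp (-β k * t) * inner ℝ (e k) y) • e k)) =
      fun k => if k = j then Real.exp (-β j * t) * inner ℝ (e j) y else 0 := by
    funext k
    rw [innerSL_apply_apply, inner_smul_right, orthonormal_iff_ite.1 e.orthonormal]
    by_cases h : k = j
    · simp [h]
    · simp [h, Ne.symm h]
  rw [h2]
  exact hasSum_ite_eq j _

theorem HilbertBasis.ext_inner {x y : H} (h : ∀ k, inner ℝ (e k) x = inner ℝ (e k) y) : x = y := by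
  have h1 := e.hasSum_inner_smul x
  simp only [h] at h1
  exact h1.unique (e.hasSum_inner_smul y)

-- By Parseval, the slowest mode `β 0` governs the decay of the whole semigroup; this rate later
-- competes with the Lipschitz constant of the drift.
include hβ_pos hβ_mono in
theorem norm_expB_le [CompleteSpace H] {t : ℝ} (ht : 0 ≤ t) (y : H) :
    ‖expB e β t y‖ ≤ Real.exp (-β 0 * t) * ‖y‖ := by
  have h1 := e.hasSum_norm_sq_of_hasSum (hasSum_expB e hβ_pos ht y)
  have h2 := (e.hasSum_norm_sq_of_hasSum (e.hasSum_inner_smul y)).mul_left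
    (Real.exp (-β 0 * t) ^ 2)
  have h3 : ‖expB e β t y‖ ^ 2 ≤ (Real.exp (-β 0 * t) * ‖y‖) ^ 2 := by
    rw [mul_pow]
    refine hasSum_le (fun k => ?_) h1 h2
    rw [mul_pow]
    have : Real.exp (-β k * t) ≤ Real.exp (-β 0 * t) :=
      Real.exp_le_exp.2 (by nlinarith [hβ_mono (Nat.zero_le k)])
    gcongr
  exact le_of_sq_le_sq h3 (by positivity)

include hβ_pos in
theorem expB_add_apply [CompleteSpace H] {t : ℝ} (ht : 0 ≤ t) (x y : H) :
    expB e β t (x + y) = expB e β t x + expB e β t y := by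
  apply e.ext_inner
  intro k
  rw [inner_add_right, inner_expB e hβ_pos ht, inner_expB e hβ_pos ht, inner_expB e hβ_pos ht,
    inner_add_right, mul_add]

include hβ_pos in
theorem expB_smul_apply [CompleteSpace H] {t : ℝ} (ht : 0 ≤ t) (c : ℝ) (y : H) :
    expB e β t (c • y) = c • expB e β t y := by
  apply e.ext_inner
  intro k
  rw [inner_smul_right, inner_expB e hβ_pos ht, inner_expB e hβ_pos ht, inner_smul_right]
  ring

include hβ_pos in
theorem expB_comp [CompleteSpace H] {s t : ℝ} (hs : 0 ≤ s) (ht : 0 ≤ t) (y : H) :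
    expB e β t (expB e β s y) = expB e β (t + s) y := by
  apply e.ext_inner
  intro k
  rw [inner_expB e hβ_pos ht, inner_expB e hβ_pos hs, inner_expB e hβ_pos (by positivity),
    ← mul_assoc, ← Real.exp_add]
  ring_nf

include hβ_pos in
theorem expB_basis [CompleteSpace H] {t : ℝ} (ht : 0 ≤ t) (k : ℕ) :
    expB e β t (e k) = Real.exp (-β k * t) • e k := by
  apply e.ext_inner
  intro j
  rw [inner_expB e hβ_pos ht, inner_smul_right, orthonormal_iff_ite.1 e.orthonormal]
  by_cases h : j = k <;> simp [h]

theorem expB_zero_apply (y : H) : expB e β 0 y = y := by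
  simpa [expB] using (e.hasSum_inner_smul y).tsum_eq

/-- No sign condition on time is needed: where the series diverges, `tsum` takes its default value
and measurability persists. -/
theorem measurable_expB [CompleteSpace H] [MeasurableSpace H] [BorelSpace H] (β : ℕ → ℝ) :
    Measurable fun p : ℝ × H => expB e β p.1 p.2 := by
  have := e.secondCountableTopology
  unfold expB
  refine StronglyMeasurable.measurable (StronglyMeasurable.tsum fun k => ?_)
  apply Measurable.stronglyMeasurable
  fun_prop

/-- The operator `e^{tB}`, `t ≥ 0`, as a continuous linear map. -/
noncomputable def expBCLM [CompleteSpace H] (hβ_pos : ∀ k, 0 < β k) (hβ_mono : Monotone β)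
    {t : ℝ} (ht : 0 ≤ t) : H →L[ℝ] H :=
  LinearMap.mkContinuous
    { toFun := expB e β t
      map_add' := expB_add_apply e hβ_pos ht
      map_smul' := expB_smul_apply e hβ_pos ht }
    (Real.exp (-β 0 * t)) (norm_expB_le e hβ_pos hβ_mono ht)

theorem expBCLM_apply [CompleteSpace H] {t : ℝ} (ht : 0 ≤ t) (y : H) :
    expBCLM e hβ_pos hβ_mono ht y = expB e β t y := rfl

include hβ_pos hβ_mono in
theorem expB_sub_apply [CompleteSpace H] {t : ℝ} (ht : 0 ≤ t) (x y : H) :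
    expB e β t (x - y) = expB e β t x - expB e β t y :=
  (expBCLM e hβ_pos hβ_mono ht).map_sub x y

include hβ_pos hβ_mono in
theorem intervalIntegrable_expB [CompleteSpace H] [MeasurableSpace H] [BorelSpace H] {s t T : ℝ}
    (hst : s ≤ t) (htT : t ≤ T) {g : ℝ → H} (hg : IntervalIntegrable g volume s t) :
    IntervalIntegrable (fun r => expB e β (T - r) (g r)) volume s t := by
  have := e.secondCountableTopology
  rw [intervalIntegrable_iff_integrableOn_Ioc_of_le hst] at hg ⊢
  have hm : AEStronglyMeasurable (fun r => expB e β (T - r) (g r)) (volume.restrict (Ioc s t)) := by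
    apply AEMeasurable.aestronglyMeasurable
    have h1 : AEMeasurable g (volume.restrict (Ioc s t)) := hg.aestronglyMeasurable.aemeasurable
    exact (measurable_expB e β).comp_aemeasurable
      (AEMeasurable.prodMk (by fun_prop) h1)
  refine Integrable.mono hg hm ?_
  filter_upwards [ae_restrict_mem measurableSet_Ioc] with r hr
  refine (norm_expB_le e hβ_pos hβ_mono (by linarith [hr.2]) _).trans ?_
  have : Real.exp (-β 0 * (T - r)) ≤ 1 :=
    Real.exp_le_one_iff.2 (by nlinarith [hβ_pos 0, hr.2])
  nlinarith [norm_nonneg (g r)]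

include hβ_pos hβ_mono in
theorem expB_integral [CompleteSpace H] [MeasurableSpace H] [BorelSpace H] {s t T : ℝ}
    (hst : s ≤ t) (htT : t ≤ T) {g : ℝ → H} (hg : IntervalIntegrable g volume s t) :
    expB e β (T - t) (∫ r in s..t, expB e β (t - r) (g r)) =
      ∫ r in s..t, expB e β (T - r) (g r) := by
  rw [← expBCLM_apply e hβ_pos hβ_mono (by linarith : 0 ≤ T - t),
    ← ContinuousLinearMap.intervalIntegral_comp_comm _
      (intervalIntegrable_expB e hβ_pos hβ_mono hst le_rfl hg)]
  refine intervalIntegral.integral_congr fun r hr => ?_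
  rw [uIcc_of_le hst] at hr
  simp only [expBCLM_apply]
  rw [expB_comp e hβ_pos (by linarith [hr.2]) (by linarith)]
  congr 1
  ring

end Semigroup

/-! ### A linear Volterra inequality with exponential kernel -/

section Gronwall

/-- Absorption of `q M` into the left-hand side. Finiteness of `M` is essential, since `M = ∞`
satisfies the inequality trivially. -/
theorem ENNReal.le_of_le_add_mul_self {M A : ℝ≥0∞} {q : ℝ} (hq0 : 0 ≤ q) (hq1 : q < 1)
    (hM : M ≠ ∞) (h : M ≤ A + ENNReal.ofReal q * M) : M ≤ ENNReal.ofReal (1 / (1 - q)) * A := by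
  by_cases hA : A = ∞
  · have : 0 < ENNReal.ofReal (1 / (1 - q)) := by
      rw [ENNReal.ofReal_pos]
      exact one_div_pos.2 (by linarith)
    rw [hA, ENNReal.mul_top this.ne']
    exact le_top
  lift M to ℝ≥0 using hM
  lift A to ℝ≥0 using hA
  rw [← ENNReal.ofReal_coe_nnreal (p := M), ← ENNReal.ofReal_coe_nnreal (p := A),
    ← ENNReal.ofReal_mul hq0, ← ENNReal.ofReal_add (by positivity) (by positivity),
    ENNReal.ofReal_le_ofReal_iff (by positivity)] at h
  rw [← ENNReal.ofReal_coe_nnreal (p := M), ← ENNReal.ofReal_coe_nnreal (p := A),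
    ← ENNReal.ofReal_mul (one_div_nonneg.2 (by linarith))]
  apply ENNReal.ofReal_le_ofReal
  rw [one_div, inv_mul_eq_div, le_div_iff₀ (by linarith)]
  linarith

theorem integral_exp_kernel {κ : ℝ} (hκ : 0 < κ) (s t : ℝ) :
    ∫ r in s..t, Real.exp (-κ * (t - r)) = (1 - Real.exp (-κ * (t - s))) / κ := by
  rw [intervalIntegral.integral_eq_sub_of_hasDerivAt
    (f := fun r => Real.exp (-κ * (t - r)) / κ)]
  · simp [sub_div]
  · intro r _
    have h1 : HasDerivAt (fun r => -κ * (t - r)) κ r := by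
      simpa using ((hasDerivAt_id r).const_sub t).const_mul (-κ)
    have h2 := h1.exp.div_const κ
    rwa [mul_div_cancel_right₀ _ hκ.ne'] at h2
  · exact Continuous.intervalIntegrable (by fun_prop) _ _

theorem integral_exp_kernel_le {κ : ℝ} (hκ : 0 < κ) (s t : ℝ) :
    ∫ r in s..t, Real.exp (-κ * (t - r)) ≤ 1 / κ := by
  rw [integral_exp_kernel hκ]
  gcongr
  linarith [Real.exp_pos (-κ * (t - s))]

theorem lintegral_exp_kernel_le {κ : ℝ} (hκ : 0 < κ) (s t : ℝ) :
    ∫⁻ r in Ioc s t, ENNReal.ofReal (Real.exp (-κ * (t - r))) ≤ ENNReal.ofReal (1 / κ) := by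
  rcases le_total s t with h | h
  · rw [← ofReal_integral_eq_lintegral_ofReal, ← intervalIntegral.integral_of_le h]
    · exact ENNReal.ofReal_le_ofReal (integral_exp_kernel_le hκ s t)
    · exact (Continuous.integrableOn_Icc (by fun_prop)).mono_set Ioc_subset_Icc_self
    · exact ae_of_all _ fun r => (Real.exp_pos _).le
  · simp [Ioc_eq_empty_of_le h]

/-- The right-hand side of the linear Volterra inequality with kernel `L e^{-b(t-r)}`. -/
noncomputable def volterraBound (b L s : ℝ) (d : ℝ≥0∞) (δ : ℝ → ℝ≥0∞) (t : ℝ) : ℝ≥0∞ :=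
  ENNReal.ofReal (Real.exp (-b * (t - s))) * d +
    ∫⁻ r in Ioc s t, ENNReal.ofReal (L * Real.exp (-b * (t - r))) * δ r

/-- In the supremum norm weighted by `e^{l(t-s)}` with `l = (b-L)/2`, the integral operator has norm
at most `q = L/(b-l) = 2L/(b+L) < 1`, and `1/(1-q)` is the prefactor `(b+L)/(b-L)`. -/
theorem volterraBound_le {b L s T : ℝ} (hL : 0 ≤ L) (hLb : L < b) {d : ℝ≥0∞} (hd : d ≠ ∞)
    {δ : ℝ → ℝ≥0∞} (hδ : ∫⁻ r in Ioc s T, δ r ≠ ∞)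
    (h : ∀ᵐ t ∂volume.restrict (Ioc s T), δ t ≤ volterraBound b L s d δ t)
    {t : ℝ} (ht : t ∈ Icc s T) :
    volterraBound b L s d δ t ≤
      ENNReal.ofReal ((b + L) / (b - L) * Real.exp (-(b - L) / 2 * (t - s))) * d := by
  have hb : 0 < b := hL.trans_lt hLb
  set l : ℝ := (b - L) / 2 with hl
  set q : ℝ := L / (b - l) with hq
  have hbl : 0 < b - l := by rw [hl]; linarith
  have hq0 : 0 ≤ q := div_nonneg hL hbl.le
  have hq1 : q < 1 := by rw [hq, div_lt_one hbl, hl]; linarith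
  set R := volterraBound b L s d δ with hR
  -- The weighted supremum is taken of the right-hand side `R`, which bounds `δ` only almost
  -- everywhere; that is enough under the integral defining `R`, and the conclusion then holds at
  -- every `t`.
  set M : ℝ≥0∞ := ⨆ t ∈ Icc s T, ENNReal.ofReal (Real.exp (l * (t - s))) * R t with hM
  have hle : ∀ t ∈ Icc s T, R t ≤ ENNReal.ofReal (Real.exp (-l * (t - s))) * M := by
    intro t ht
    have h1 : ENNReal.ofReal (Real.exp (l * (t - s))) * R t ≤ M :=
      le_iSup₂ (f := fun t (_ : t ∈ Icc s T) => ENNReal.ofReal (Real.exp (l * (t - s))) * R t) t ht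
    calc R t = ENNReal.ofReal (Real.exp (-l * (t - s))) *
        (ENNReal.ofReal (Real.exp (l * (t - s))) * R t) := by
          rw [← mul_assoc, ← ENNReal.ofReal_mul (Real.exp_pos _).le, ← Real.exp_add]
          ring_nf
          simp
      _ ≤ _ := by gcongr
  -- Integrability of `δ` enters only here, to license the absorption.
  have hMfin : M ≠ ∞ := by
    have : M ≤ ENNReal.ofReal (Real.exp (l * (T - s))) *
        (d + ENNReal.ofReal L * ∫⁻ r in Ioc s T, δ r) := by
      refine iSup₂_le fun t ht => ?_
      have hl0 : 0 ≤ l := by rw [hl]; linarith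
      gcongr
      · linarith [ht.2]
      · rw [hR, volterraBound]
        gcongr
        · calc _ ≤ 1 * d := by
                gcongr
                rw [ENNReal.ofReal_le_one]
                exact Real.exp_le_one_iff.2 (by nlinarith [ht.1])
            _ = d := one_mul d
        · calc _ ≤ ∫⁻ r in Ioc s t, ENNReal.ofReal L * δ r := by
                refine setLIntegral_mono' measurableSet_Ioc fun r hr => ?_
                gcongr
                have : Real.exp (-b * (t - r)) ≤ 1 :=
                  Real.exp_le_one_iff.2 (by nlinarith [hr.2])
                nlinarith
            _ ≤ ∫⁻ r in Ioc s T, ENNReal.ofReal L * δ r :=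
                lintegral_mono_set (Ioc_subset_Ioc_right ht.2)
            _ = _ := lintegral_const_mul' _ _ ENNReal.ofReal_ne_top
    refine ne_top_of_le_ne_top ?_ this
    exact ENNReal.mul_ne_top ENNReal.ofReal_ne_top
      (ENNReal.add_ne_top.2 ⟨hd, ENNReal.mul_ne_top ENNReal.ofReal_ne_top hδ⟩)
  have hMle : M ≤ d + ENNReal.ofReal q * M := by
    refine iSup₂_le fun t ht => ?_
    rw [hR, volterraBound, mul_add]
    refine add_le_add ?_ ?_
    · rw [← mul_assoc, ← ENNReal.ofReal_mul (Real.exp_pos _).le, ← Real.exp_add]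
      calc _ ≤ 1 * d := by
            gcongr
            rw [ENNReal.ofReal_le_one]
            exact Real.exp_le_one_iff.2 (by nlinarith [ht.1])
        _ = d := one_mul d
    · have hsub : ∀ᵐ r ∂volume.restrict (Ioc s t), δ r ≤ R r :=
        ae_mono (Measure.restrict_mono (Ioc_subset_Ioc_right ht.2) le_rfl) h
      calc ENNReal.ofReal (Real.exp (l * (t - s))) *
            ∫⁻ r in Ioc s t, ENNReal.ofReal (L * Real.exp (-b * (t - r))) * δ r
          ≤ ENNReal.ofReal (Real.exp (l * (t - s))) * ∫⁻ r in Ioc s t,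
            ENNReal.ofReal (L * Real.exp (-b * (t - r))) *
              (ENNReal.ofReal (Real.exp (-l * (r - s))) * M) := by
            refine mul_le_mul_right (lintegral_mono_ae ?_) _
            filter_upwards [hsub, ae_restrict_mem measurableSet_Ioc] with r hr hr2
            gcongr
            exact hr.trans (hle r ⟨hr2.1.le, hr2.2.trans ht.2⟩)
        _ = ∫⁻ r in Ioc s t, ENNReal.ofReal (Real.exp (-(b - l) * (t - r))) *
              (ENNReal.ofReal L * M) := by
            rw [← lintegral_const_mul' _ _ ENNReal.ofReal_ne_top]
            congr 1
            funext r
            rw [← mul_assoc, ← mul_assoc, ← mul_assoc, ← ENNReal.ofReal_mul (by positivity),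
              ← ENNReal.ofReal_mul (by positivity), ← ENNReal.ofReal_mul (by positivity)]
            congr 2
            rw [mul_left_comm, mul_assoc, ← Real.exp_add, ← Real.exp_add, mul_comm]
            ring_nf
        _ ≤ ENNReal.ofReal (1 / (b - l)) * (ENNReal.ofReal L * M) := by
            rw [lintegral_mul_const _ (by fun_prop)]
            gcongr
            exact lintegral_exp_kernel_le hbl s t
        _ = ENNReal.ofReal q * M := by
            rw [← mul_assoc, ← ENNReal.ofReal_mul (by positivity), hq]
            congr 2
            ring
  have hfin := ENNReal.le_of_le_add_mul_self hq0 hq1 hMfin hMle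
  calc R t ≤ ENNReal.ofReal (Real.exp (-l * (t - s))) * M := hle t ht
    _ ≤ ENNReal.ofReal (Real.exp (-l * (t - s))) * (ENNReal.ofReal (1 / (1 - q)) * d) := by gcongr
    _ = _ := by
        rw [← mul_assoc, ← ENNReal.ofReal_mul (Real.exp_pos _).le, mul_comm (Real.exp _)]
        have h1 : 1 / (1 - q) = (b + L) / (b - L) := by
          have : b - L ≠ 0 := by linarith
          have h2 : b + L ≠ 0 := by linarith
          have h3 : b - l = (b + L) / 2 := by rw [hl]; ring
          have h4 : 1 - 2 * L / (b + L) = (b - L) / (b + L) := by field_simp; ring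
          rw [hq, h3, div_div_eq_mul_div, mul_comm L, h4, one_div_div]
        rw [h1, hl, neg_div]

end Gronwall

/-! ### Picard iteration along a fixed path of the noise -/

section Existence

variable {H : Type*} [NormedAddCommGroup H] [InnerProductSpace ℝ H] [CompleteSpace H]
  [MeasurableSpace H] [BorelSpace H] (e : HilbertBasis ℕ ℝ H)
  {β : ℕ → ℝ} (hβ_pos : ∀ k, 0 < β k) (hβ_mono : Monotone β)
  {F : ℝ → H → H} (hF : Measurable (Function.uncurry F)) {A L : ℝ}
  (hF_lip : ∀ t y₁ y₂, ‖F t y₁ - F t y₂‖ ≤ L * ‖y₁ - y₂‖)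
  (hF_growth : ∀ t y, ‖F t y‖ ≤ A + L * ‖y‖)

include e hF hF_growth in
omit [CompleteSpace H] in
theorem intervalIntegrable_of_growth (hL : 0 ≤ L) {s t : ℝ} (hst : s ≤ t) {v w : ℝ → H} {C : ℝ}
    (hv : Measurable v) (hvC : ∀ r ∈ Icc s t, ‖v r‖ ≤ C) (hwm : Measurable w)
    (hw : IntervalIntegrable w volume s t) :
    IntervalIntegrable (fun r => F r (v r + w r)) volume s t := by
  have := e.secondCountableTopology
  rw [intervalIntegrable_iff_integrableOn_Ioc_of_le hst] at hw ⊢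
  have hm : Measurable fun r => F r (v r + w r) :=
    hF.comp (measurable_id.prodMk (hv.add hwm))
  have hg : Integrable (fun r => A + L * C + L * ‖w r‖) (volume.restrict (Ioc s t)) :=
    (integrable_const _).add (hw.norm.const_mul L)
  refine Integrable.mono' hg hm.aestronglyMeasurable ?_
  filter_upwards [ae_restrict_mem measurableSet_Ioc] with r hr
  refine (hF_growth _ _).trans ?_
  have h1 := hvC r ⟨hr.1.le, hr.2⟩
  have h2 := norm_add_le (v r) (w r)
  nlinarith

-- The kernel has mass at most `1 / β 0` on any interval, so the Picard map contracts by `L / β 0`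
-- in the supremum norm whatever the length of the interval.
include hβ_pos hβ_mono hF_lip in
theorem norm_integral_expB_sub_le (hL : 0 ≤ L) {s t : ℝ} (hst : s ≤ t) {u v : ℝ → H} {C : ℝ}
    (hu : IntervalIntegrable (fun r => F r (u r)) volume s t)
    (hv : IntervalIntegrable (fun r => F r (v r)) volume s t)
    (hC0 : 0 ≤ C) (hC : ∀ r ∈ Ioc s t, ‖u r - v r‖ ≤ C) :
    ‖(∫ r in s..t, expB e β (t - r) (F r (u r))) - ∫ r in s..t, expB e β (t - r) (F r (v r))‖ ≤
      L / β 0 * C := by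
  rw [← intervalIntegral.integral_sub (intervalIntegrable_expB e hβ_pos hβ_mono hst le_rfl hu)
    (intervalIntegrable_expB e hβ_pos hβ_mono hst le_rfl hv)]
  have h1 : ‖∫ r in s..t, (expB e β (t - r) (F r (u r)) - expB e β (t - r) (F r (v r)))‖ ≤
      ∫ r in s..t, Real.exp (-β 0 * (t - r)) * (L * C) := by
    refine intervalIntegral.norm_integral_le_of_norm_le hst ?_
      (Continuous.intervalIntegrable (by fun_prop) _ _)
    filter_upwards with r hr
    have htr : 0 ≤ t - r := by linarith [hr.2]
    rw [← expB_sub_apply e hβ_pos hβ_mono htr]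
    refine (norm_expB_le e hβ_pos hβ_mono htr _).trans ?_
    gcongr
    exact (hF_lip _ _ _).trans (by gcongr; exact hC r hr)
  refine h1.trans ?_
  rw [intervalIntegral.integral_mul_const]
  calc _ ≤ 1 / β 0 * (L * C) := by
        gcongr
        exact integral_exp_kernel_le (hβ_pos 0) s t
    _ = _ := by ring

variable {Ω : Type*}

/-- The Picard iterates for the difference of a mild solution and its noise term `W`. -/
noncomputable def picardIter (β : ℕ → ℝ) (F : ℝ → H → H) (s : ℝ) (y : H) (W : ℝ → Ω → H) :
    ℕ → ℝ → Ω → H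
  | 0 => fun _ _ => 0
  | n + 1 => fun t ω => expB e β (t - s) y +
      ∫ r, (Ioc s t).indicator
        (fun r => expB e β (t - r) (F r (picardIter β F s y W n r ω + W r ω))) r

omit [CompleteSpace H] [MeasurableSpace H] [BorelSpace H] in
theorem picardIter_succ {s t : ℝ} (hst : s ≤ t) (y : H) (W : ℝ → Ω → H) (n : ℕ) (ω : Ω) :
    picardIter e β F s y W (n + 1) t ω = expB e β (t - s) y +
      ∫ r in s..t, expB e β (t - r) (F r (picardIter e β F s y W n r ω + W r ω)) := by
  rw [intervalIntegral.integral_of_le hst, ← integral_indicator measurableSet_Ioc]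
  rfl

include hF in
theorem measurable_picardIter [MeasurableSpace Ω] (s : ℝ) (y : H) {W : ℝ → Ω → H}
    (hW : Measurable (Function.uncurry W)) (n : ℕ) :
    Measurable (Function.uncurry (picardIter e β F s y W n)) := by
  have := e.secondCountableTopology
  induction n with
  | zero => exact measurable_const
  | succ n ih =>
    have h1 : Measurable fun p : ℝ × Ω => expB e β (p.1 - s) y :=
      (measurable_expB e β).comp (by fun_prop : Measurable fun p : ℝ × Ω => (p.1 - s, y))
    have h2 : Measurable fun q : (ℝ × Ω) × ℝ =>
        picardIter e β F s y W n q.2 q.1.2 + W q.2 q.1.2 := by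
      have hq : Measurable fun q : (ℝ × Ω) × ℝ => (q.2, q.1.2) := by fun_prop
      exact (ih.comp hq).add (hW.comp hq)
    have h3 : Measurable fun q : (ℝ × Ω) × ℝ =>
        expB e β (q.1.1 - q.2) (F q.2 (picardIter e β F s y W n q.2 q.1.2 + W q.2 q.1.2)) :=
      (measurable_expB e β).comp (Measurable.prodMk (by fun_prop)
        (hF.comp (Measurable.prodMk (by fun_prop) h2)))
    -- Integrating an indicator over the whole line puts the variable endpoint into the integrand,
    -- so the parameter integral is jointly measurable.
    have h4 : Measurable fun q : (ℝ × Ω) × ℝ => (Ioc s q.1.1).indicator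
        (fun r => expB e β (q.1.1 - r) (F r (picardIter e β F s y W n r q.1.2 + W r q.1.2)))
          q.2 := by
      have hs : MeasurableSet {q : (ℝ × Ω) × ℝ | q.2 ∈ Ioc s q.1.1} :=
        MeasurableSet.inter (s₁ := {q : (ℝ × Ω) × ℝ | s < q.2})
          (s₂ := {q : (ℝ × Ω) × ℝ | q.2 ≤ q.1.1})
          (measurableSet_lt (by fun_prop) (by fun_prop))
          (measurableSet_le (by fun_prop) (by fun_prop))
      exact h3.indicator hs
    exact h1.add (h4.stronglyMeasurable.integral_prod_right').measurable

include hβ_pos hβ_mono hF hF_lip hF_growth in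
/-- Pathwise Picard iteration for the mild equation with noise term `W`. -/
theorem exists_pathwise_mild [MeasurableSpace Ω] (hL : 0 ≤ L) (hLb : L < β 0) (s : ℝ) (y : H)
    {W : ℝ → Ω → H} (hW : Measurable (Function.uncurry W)) :
    ∃ Y : ℝ → Ω → H, Measurable (Function.uncurry Y) ∧
      ∀ ω t, s ≤ t → IntervalIntegrable (fun r => W r ω) volume s t →
        IntervalIntegrable (fun r => F r (Y r ω)) volume s t ∧
        Y t ω = expB e β (t - s) y + (∫ r in s..t, expB e β (t - r) (F r (Y r ω))) + W t ω := by
  have hsc := e.secondCountableTopology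
  set V := picardIter e β F s y W with hV
  have hVm := measurable_picardIter e (β := β) hF s y hW
  -- The limit is defined for every `t` and `ω`, hence independent of the horizon and measurable for
  -- whichever σ-algebra makes `W` measurable. Convergence is proved only along paths where `W` is
  -- integrable.
  refine ⟨fun t ω => limUnder atTop (fun n => V n t ω) + W t ω, ?_, ?_⟩
  · refine Measurable.add ?_ hW
    have := StronglyMeasurable.limUnder (l := (atTop : Filter ℕ))
      (f := fun n => Function.uncurry (V n)) (fun n => (hVm n).stronglyMeasurable)
    exact this.measurable
  intro ω T hsT hWT
  set q : ℝ := L / β 0 with hq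
  have hq0 : 0 ≤ q := div_nonneg hL (hβ_pos 0).le
  have hq1 : q < 1 := (div_lt_one (hβ_pos 0)).2 hLb
  have hVr : ∀ n, Measurable fun r => V n r ω := fun n =>
    (hVm n).comp (by fun_prop : Measurable fun r : ℝ => (r, ω))
  have hWr : Measurable fun r => W r ω := hW.comp (by fun_prop : Measurable fun r : ℝ => (r, ω))
  have hWt : ∀ t ∈ Icc s T, IntervalIntegrable (fun r => W r ω) volume s t := fun t ht =>
    hWT.mono_set (by rw [uIcc_of_le ht.1, uIcc_of_le hsT]; exact Icc_subset_Icc_right ht.2)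
  -- The iteration runs on `v = Y - W`, which stays bounded although `W` is merely integrable in
  -- time.
  have key : ∀ v : ℝ → H, Measurable v → (∃ C, ∀ t ∈ Icc s T, ‖v t‖ ≤ C) → ∀ t ∈ Icc s T,
      IntervalIntegrable (fun r => F r (v r + W r ω)) volume s t := by
    rintro v hv ⟨C, hC⟩ t ht
    exact intervalIntegrable_of_growth e hF hF_growth hL ht.1 hv
      (fun r hr => hC r ⟨hr.1, hr.2.trans ht.2⟩) hWr (hWt t ht)
  have hbdd : ∀ v : ℝ → H, IntervalIntegrable (fun r => F r (v r)) volume s T →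
      ∃ C, ∀ t ∈ Icc s T, ‖expB e β (t - s) y + ∫ r in s..t, expB e β (t - r) (F r (v r))‖ ≤ C := by
    intro v hv
    refine ⟨‖y‖ + ∫ r in s..T, ‖F r (v r)‖, fun t ht => (norm_add_le _ _).trans ?_⟩
    have hexp : ∀ r z, 0 ≤ r → ‖expB e β r z‖ ≤ ‖z‖ := fun r z hr =>
      (norm_expB_le e hβ_pos hβ_mono hr z).trans <| mul_le_of_le_one_left (norm_nonneg _) <|
        Real.exp_le_one_iff.2 (by nlinarith [hβ_pos 0])
    gcongr
    · exact hexp _ _ (by linarith [ht.1])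
    · have hvt : IntervalIntegrable (fun r => F r (v r)) volume s t :=
        hv.mono_set (by rw [uIcc_of_le ht.1, uIcc_of_le hsT]; exact Icc_subset_Icc_right ht.2)
      refine (intervalIntegral.norm_integral_le_of_norm_le ht.1
        (g := fun r => ‖F r (v r)‖) ?_ hvt.norm).trans ?_
      · filter_upwards with r hr
        exact hexp _ _ (by linarith [hr.2])
      · exact intervalIntegral.integral_mono_interval le_rfl ht.1 ht.2
          (ae_of_all _ fun r => norm_nonneg _) hv.norm
  have hsucc : ∀ n, ∀ t ∈ Icc s T, V (n + 1) t ω = expB e β (t - s) y +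
      ∫ r in s..t, expB e β (t - r) (F r (V n r ω + W r ω)) := fun n t ht =>
    picardIter_succ e ht.1 y W n ω
  have hVb : ∀ n, ∃ C, ∀ t ∈ Icc s T, ‖V n t ω‖ ≤ C := by
    intro n
    induction n with
    | zero => exact ⟨0, fun t _ => by simp [hV, picardIter]⟩
    | succ n ih =>
      obtain ⟨C, hC⟩ := hbdd (fun r => V n r ω + W r ω) (key _ (hVr n) ih T (right_mem_Icc.2 hsT))
      exact ⟨C, fun t ht => by rw [hsucc n t ht]; exact hC t ht⟩
  obtain ⟨C, hC⟩ := hVb 1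
  have hC0 : 0 ≤ C := (norm_nonneg _).trans (hC s (left_mem_Icc.2 hsT))
  have hdist : ∀ n, ∀ t ∈ Icc s T, dist (V n t ω) (V (n + 1) t ω) ≤ C * q ^ n := by
    intro n
    induction n with
    | zero =>
      intro t ht
      have h0 : V 0 t ω = 0 := rfl
      rw [h0, dist_zero_left]
      simpa using hC t ht
    | succ n ih =>
      intro t ht
      rw [hsucc n t ht, hsucc (n + 1) t ht, dist_add_left, dist_eq_norm]
      refine (norm_integral_expB_sub_le e hβ_pos hβ_mono hF_lip hL ht.1
        (key _ (hVr n) (hVb n) t ht) (key _ (hVr (n + 1)) (hVb (n + 1)) t ht)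
        (C := C * q ^ n) (by positivity) fun r hr => ?_).trans (le_of_eq ?_)
      · rw [add_sub_add_right_eq_sub, ← dist_eq_norm]
        exact ih r ⟨hr.1.le, hr.2.trans ht.2⟩
      · rw [← hq]; ring
  set v : ℝ → H := fun t => limUnder atTop (fun n => V n t ω) with hv
  have hlim : ∀ t ∈ Icc s T, Tendsto (fun n => V n t ω) atTop (𝓝 (v t)) := fun t ht =>
    (cauchySeq_of_le_geometric q C hq1 fun n => hdist n t ht).tendsto_limUnder
  have hvd : ∀ n, ∀ t ∈ Icc s T, dist (V n t ω) (v t) ≤ C * q ^ n / (1 - q) := fun n t ht =>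
    dist_le_of_le_geometric_of_tendsto q C hq1 (fun n => hdist n t ht) (hlim t ht) n
  have hvm : Measurable v :=
    (StronglyMeasurable.limUnder (l := (atTop : Filter ℕ))
      fun n => (hVr n).stronglyMeasurable).measurable
  have hvb : ∃ C, ∀ t ∈ Icc s T, ‖v t‖ ≤ C := by
    refine ⟨C * q ^ 0 / (1 - q), fun t ht => ?_⟩
    have h0 : V 0 t ω = 0 := rfl
    have := hvd 0 t ht
    rwa [h0, dist_zero_left] at this
  have hint := key v hvm hvb T (right_mem_Icc.2 hsT)
  refine ⟨hint, ?_⟩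
  have hTT := right_mem_Icc.2 hsT
  have h1 : v T = expB e β (T - s) y + ∫ r in s..T, expB e β (T - r) (F r (v r + W r ω)) := by
    refine tendsto_nhds_unique ((tendsto_add_atTop_iff_nat 1).2 (hlim T hTT)) ?_
    have hz : Tendsto (fun n : ℕ => q * (C * q ^ n / (1 - q))) atTop (𝓝 0) := by
      have := (tendsto_pow_atTop_nhds_zero_of_lt_one hq0 hq1).const_mul (q * C / (1 - q))
      rw [mul_zero] at this
      refine this.congr fun n => by ring
    rw [tendsto_iff_dist_tendsto_zero]
    refine squeeze_zero (fun _ => dist_nonneg) (fun n => ?_) hz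
    rw [hsucc n T hTT, dist_add_left, dist_eq_norm]
    have hq1' : 0 < 1 - q := by linarith
    refine norm_integral_expB_sub_le e hβ_pos hβ_mono hF_lip hL hsT
      (key _ (hVr n) (hVb n) T hTT) hint (by positivity) fun r hr => ?_
    rw [add_sub_add_right_eq_sub, ← dist_eq_norm]
    exact hvd n r ⟨hr.1.le, hr.2⟩
  change v T + W T ω = _
  rw [h1]

end Existence

/-! ### Truncated second moments from characteristic functions -/

section TruncatedMoment

/-- The average of `1 - cos (h u)` detects `u`, and becomes one minus the real part of a
characteristic function after taking expectations. For `|u| ≤ π` use `1 - cos v ≥ 2v²/π²` and `π² ≤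
10`, which gives the constant `15`; for larger `|u|` the integral is `1 - sin u / u ≥ 2/3`. -/
theorem min_one_sq_le_integral_one_sub_cos (u : ℝ) :
    min 1 (u ^ 2) ≤ 15 * ∫ h in (0 : ℝ)..1, (1 - Real.cos (h * u)) := by
  have hπ3 := Real.pi_gt_three
  have hπ4 := Real.pi_le_four
  have hint : ∀ v : ℝ, IntervalIntegrable (fun h : ℝ => 1 - Real.cos (h * v)) volume 0 1 :=
    fun v => Continuous.intervalIntegrable (by fun_prop) _ _
  rcases le_total |u| Real.pi with hu | hu
  · have hpi : Real.pi ^ 2 ≤ 10 := by nlinarith [Real.pi_lt_d2]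
    have h1 : ∫ h in (0 : ℝ)..1, 2 / Real.pi ^ 2 * u ^ 2 * h ^ 2 ≤
        ∫ h in (0 : ℝ)..1, (1 - Real.cos (h * u)) := by
      refine intervalIntegral.integral_mono_on zero_le_one
        (Continuous.intervalIntegrable (by fun_prop) _ _) (hint u) fun h hh => ?_
      have h2 : |h * u| ≤ Real.pi := by
        rw [abs_mul, abs_of_nonneg hh.1]
        nlinarith [hh.2, abs_nonneg u]
      have := Real.cos_le_one_sub_mul_cos_sq h2
      nlinarith
    rw [intervalIntegral.integral_const_mul, integral_pow] at h1
    have h3 : (1 : ℝ) / 15 ≤ 2 / Real.pi ^ 2 * (1 / 3) := by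
      rw [div_mul_div_comm, div_le_div_iff₀ (by norm_num) (by positivity)]
      linarith
    norm_num at h1
    have := min_le_right 1 (u ^ 2)
    nlinarith [sq_nonneg u]
  · have hu0 : u ≠ 0 := by
      rintro rfl
      simp at hu
      linarith
    have h1 : ∫ h in (0 : ℝ)..1, (1 - Real.cos (h * u)) = 1 - Real.sin u / u := by
      rw [intervalIntegral.integral_sub (by simp) (Continuous.intervalIntegrable (by fun_prop) _ _),
        intervalIntegral.integral_comp_mul_right _ hu0, integral_cos]
      simp [div_eq_inv_mul]
    have h2 : Real.sin u / u ≤ 1 / 3 := by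
      refine (le_abs_self _).trans ?_
      rw [abs_div, div_le_iff₀ (by positivity)]
      have := Real.abs_sin_le_one u
      linarith
    rw [h1]
    have := min_le_left 1 (u ^ 2)
    linarith

variable {Ω : Type*} [MeasurableSpace Ω] {P : Measure Ω} [IsProbabilityMeasure P]

/-- Fubini in the previous inequality and `1 - e^{-v} ≤ v` give the stable scaling `c^α`, which
replaces the missing second moment. -/
theorem lintegral_min_one_sq_le_of_charFun {X : Ω → ℝ} (hX : Measurable X) {α σ : ℝ}
    (hα : 0 ≤ α) (hσ : 0 ≤ σ)
    (hchar : ∀ h : ℝ, ∫ ω, Complex.exp (Complex.I * ((X ω * h : ℝ) : ℂ)) ∂P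
      = ((Real.exp (-σ * |h| ^ α) : ℝ) : ℂ)) {c : ℝ} (hc : 0 ≤ c) :
    ∫⁻ ω, ENNReal.ofReal (min 1 ((c * X ω) ^ 2)) ∂P ≤ ENNReal.ofReal (15 * (c ^ α * σ)) := by
  have hcos : ∀ h : ℝ, ∫ ω, Real.cos (h * X ω) ∂P = Real.exp (-σ * |h| ^ α) := by
    intro h
    have h1 := congrArg Complex.re (hchar h)
    rw [Complex.ofReal_re] at h1
    rw [← h1, ← RCLike.re_eq_complex_re, ← integral_re]
    · congr 1
      funext ω
      rw [RCLike.re_eq_complex_re, mul_comm Complex.I, Complex.exp_ofReal_mul_I_re, mul_comm]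
    · refine Integrable.mono' (integrable_const (1 : ℝ)) ?_ (ae_of_all _ fun ω => ?_)
      · exact (by fun_prop : Measurable _).aestronglyMeasurable
      · rw [mul_comm, Complex.norm_exp_ofReal_mul_I]
  have hcosint : ∀ h : ℝ, Integrable (fun ω => 1 - Real.cos (h * X ω)) P := by
    intro h
    refine (integrable_const (1 : ℝ)).sub (Integrable.mono' (integrable_const (1 : ℝ))
      (by fun_prop : Measurable _).aestronglyMeasurable (ae_of_all _ fun ω => ?_))
    exact Real.abs_cos_le_one _
  have hnn : ∀ v : ℝ, 0 ≤ 1 - Real.cos v := fun v => by linarith [Real.cos_le_one v]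
  calc ∫⁻ ω, ENNReal.ofReal (min 1 ((c * X ω) ^ 2)) ∂P
      ≤ ∫⁻ ω, ENNReal.ofReal 15 *
          (∫⁻ h in Ioc (0 : ℝ) 1, ENNReal.ofReal (1 - Real.cos (h * (c * X ω)))) ∂P := by
        refine lintegral_mono fun ω => ?_
        rw [← ofReal_integral_eq_lintegral_ofReal, ← ENNReal.ofReal_mul (by norm_num),
          ← intervalIntegral.integral_of_le zero_le_one]
        · exact ENNReal.ofReal_le_ofReal (min_one_sq_le_integral_one_sub_cos _)
        · exact (Continuous.integrableOn_Icc (by fun_prop)).mono_set Ioc_subset_Icc_self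
        · exact ae_of_all _ fun h => hnn _
    _ = ENNReal.ofReal 15 * ∫⁻ h in Ioc (0 : ℝ) 1,
          ∫⁻ ω, ENNReal.ofReal (1 - Real.cos (h * (c * X ω))) ∂P := by
        rw [lintegral_const_mul' _ _ ENNReal.ofReal_ne_top, lintegral_lintegral_swap]
        refine Measurable.aemeasurable ?_
        unfold Function.uncurry
        fun_prop
    _ ≤ ENNReal.ofReal 15 * ∫⁻ h in Ioc (0 : ℝ) 1, ENNReal.ofReal (c ^ α * σ) := by
        refine mul_le_mul_right (setLIntegral_mono' measurableSet_Ioc fun h hh => ?_) _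
        have h1 : ∀ ω, h * (c * X ω) = (h * c) * X ω := fun ω => by ring
        simp_rw [h1]
        rw [← ofReal_integral_eq_lintegral_ofReal (hcosint _) (ae_of_all _ fun ω => hnn _)]
        refine ENNReal.ofReal_le_ofReal ?_
        rw [integral_sub (integrable_const _), hcos]
        · simp only [integral_const, probReal_univ, smul_eq_mul, one_mul]
          have h2 : |h * c| ^ α ≤ c ^ α := by
            rw [abs_of_nonneg (mul_nonneg hh.1.le hc)]
            exact Real.rpow_le_rpow (mul_nonneg hh.1.le hc) (by nlinarith [hh.2]) hα
          have h3 := Real.add_one_le_exp (-σ * |h * c| ^ α)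
          nlinarith
        · have := (integrable_const (1 : ℝ)).sub (hcosint (h * c))
          exact this.congr (ae_of_all _ fun ω => by simp)
    _ = _ := by
        rw [setLIntegral_const, Real.volume_Ioc, sub_zero, ENNReal.ofReal_one, mul_one,
          ← ENNReal.ofReal_mul (by norm_num)]

-- A weighted sum of independent stable increments is again stable, and its scale `∑ Δr_i |f_i|^α`
-- is a Riemann sum of `∫ |f|^α`.
omit [IsProbabilityMeasure P] in
theorem FrozenSPDE.IsSymmStableProcess.charFun_sum {α : ℝ} {X : ℝ≥0 → Ω → ℝ}
    (hX : IsSymmStableProcess P α X) {r : ℕ → ℝ≥0} (hr : Monotone r) (f : ℕ → ℝ) (n : ℕ) (h : ℝ) :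
    ∫ ω, Complex.exp (Complex.I *
      (((∑ i ∈ Finset.range n, f i * (X (r (i + 1)) ω - X (r i) ω)) * h : ℝ) : ℂ)) ∂P =
    ((Real.exp (-(∑ i ∈ Finset.range n, ((r (i + 1) : ℝ) - r i) * |f i| ^ α) * |h| ^ α) : ℝ) :
      ℂ) := by
  have hm : ∀ i, Measurable fun ω => f i * (X (r (i + 1)) ω - X (r i) ω) := fun i =>
    ((hX.measurable _).sub (hX.measurable _)).const_mul _
  have hind : iIndepFun (fun i ω => f i * (X (r (i + 1)) ω - X (r i) ω)) P :=
    (hX.indep_increments.nat hr).comp (fun i x => f i * x) fun i => by fun_prop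
  have hcf : ∀ (Y : Ω → ℝ), Measurable Y → charFun (P.map Y) h =
      ∫ ω, Complex.exp (Complex.I * ((Y ω * h : ℝ) : ℂ)) ∂P := by
    intro Y hY
    rw [charFun_apply_real, integral_map hY.aemeasurable
      (by fun_prop : Measurable _).aestronglyMeasurable]
    congr 1
    funext ω
    push_cast
    ring_nf
  have hprod := congrFun (iIndepFun.charFun_map_finsetSum_eq_prod (s := Finset.range n)
    (fun i _ => (hm i).aemeasurable) (hind.restrict _)) h
  rw [Finset.sum_fn, hcf _ (by fun_prop), Finset.prod_apply] at hprod
  rw [hprod, ← Finset.sum_neg_distrib, Finset.sum_mul, Real.exp_sum, Complex.ofReal_prod]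
  refine Finset.prod_congr rfl fun i _ => ?_
  rw [hcf _ (hm i)]
  have hid : IdentDistrib (fun ω => X (r (i + 1)) ω - X (r i) ω) (X (r (i + 1) - r i)) P P := by
    have := hX.stationary_increments (r i) (r (i + 1) - r i)
    rwa [add_tsub_cancel_of_le (hr (Nat.le_succ i))] at this
  have h1 := (hid.comp (u := fun x : ℝ =>
    Complex.exp (Complex.I * ((x * (f i * h) : ℝ) : ℂ))) (by fun_prop)).integral_eq
  simp only [Function.comp_def] at h1
  rw [hX.charFun_eq] at h1
  calc _ = _ := by
        congr 1
        funext ω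
        congr 3
        ring
    _ = _ := h1
    _ = _ := by
        rw [NNReal.coe_sub (hr (Nat.le_succ i)), abs_mul,
          Real.mul_rpow (abs_nonneg _) (abs_nonneg _)]
        congr 2
        ring

end TruncatedMoment

/-! ### Stochastic integrals of smooth functions as limits of Riemann sums -/

section RiemannSums

/-- The points of the partition of `[a, b]` into `n + 1` intervals of equal length. -/
noncomputable def partPoint (a b : ℝ) (n : ℕ) (i : ℕ) : ℝ := a + (b - a) / (n + 1) * i

/-- The right endpoint of the interval of the partition that contains `r`. -/
noncomputable def partRight (a b : ℝ) (n : ℕ) (r : ℝ) : ℝ :=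
  partPoint a b n ⌈(r - a) / ((b - a) / (n + 1))⌉₊

variable {a b : ℝ}

theorem partPoint_zero (n : ℕ) : partPoint a b n 0 = a := by simp [partPoint]

theorem partPoint_last (n : ℕ) : partPoint a b n (n + 1) = b := by
  have : (n + 1 : ℝ) ≠ 0 := by positivity
  simp only [partPoint]
  push_cast
  field_simp
  ring

theorem partPoint_mono (hab : a ≤ b) (n : ℕ) : Monotone (partPoint a b n) := by
  intro i j hij
  have : 0 ≤ (b - a) / (n + 1) := div_nonneg (by linarith) (by positivity)
  have h2 : (i : ℝ) ≤ j := by exact_mod_cast hij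
  simp only [partPoint]
  gcongr

theorem partPoint_succ_sub (n i : ℕ) :
    partPoint a b n (i + 1) - partPoint a b n i = (b - a) / (n + 1) := by
  simp only [partPoint]
  push_cast
  ring

theorem partRight_eq (hab : a < b) (n i : ℕ) {r : ℝ}
    (hr : r ∈ Ioc (partPoint a b n i) (partPoint a b n (i + 1))) :
    partRight a b n r = partPoint a b n (i + 1) := by
  have hd : 0 < (b - a) / (n + 1 : ℝ) := div_pos (by linarith) (by positivity)
  rw [partRight]
  congr 1
  simp only [partPoint] at hr
  rw [Nat.ceil_eq_iff (by omega)]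
  simp only [Nat.add_sub_cancel]
  rw [lt_div_iff₀ hd, div_le_iff₀ hd]
  constructor
  · linarith [hr.1]
  · linarith [hr.2]

theorem le_partRight (hab : a < b) (n : ℕ) (r : ℝ) : r ≤ partRight a b n r := by
  have hd : 0 < (b - a) / (n + 1 : ℝ) := div_pos (by linarith) (by positivity)
  have h := Nat.le_ceil ((r - a) / ((b - a) / (n + 1)))
  rw [div_le_iff₀ hd] at h
  simp only [partRight, partPoint]
  linarith

theorem partRight_le_add (hab : a < b) (n : ℕ) {r : ℝ} (hr : a ≤ r) :
    partRight a b n r ≤ r + (b - a) / (n + 1) := by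
  have hd : 0 < (b - a) / (n + 1 : ℝ) := div_pos (by linarith) (by positivity)
  have h := (Nat.ceil_lt_add_one (div_nonneg (sub_nonneg.2 hr) hd.le)).le
  simp only [partRight, partPoint]
  have h2 := mul_le_mul_of_nonneg_left h hd.le
  rw [mul_add, mul_div_cancel₀ _ hd.ne'] at h2
  linarith

theorem partRight_le (hab : a < b) (n : ℕ) {r : ℝ} (hr : r ≤ b) : partRight a b n r ≤ b := by
  have hd : 0 < (b - a) / (n + 1 : ℝ) := div_pos (by linarith) (by positivity)
  refine le_of_le_of_eq ?_ (partPoint_last (a := a) (b := b) n)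
  refine partPoint_mono hab.le n ?_
  rw [Nat.ceil_le, div_le_iff₀ hd]
  push_cast
  rw [mul_div_cancel₀ _ (by positivity)]
  linarith

theorem tendsto_mesh (a b : ℝ) : Tendsto (fun n : ℕ => (b - a) / (n + 1)) atTop (𝓝 0) := by
  have := tendsto_one_div_add_atTop_nhds_zero_nat (𝕜 := ℝ)
  simpa [div_eq_mul_inv] using this.const_mul (b - a)

theorem tendsto_partRight (hab : a < b) {r : ℝ} (hr : a ≤ r) :
    Tendsto (fun n => partRight a b n r) atTop (𝓝[≥] r) := by
  refine tendsto_nhdsWithin_iff.2 ⟨?_, Eventually.of_forall fun n => le_partRight hab n r⟩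
  refine tendsto_of_tendsto_of_tendsto_of_le_of_le tendsto_const_nhds ?_
    (fun n => le_partRight hab n r) (fun n => partRight_le_add hab n hr)
  simpa using (tendsto_mesh a b).const_add r

/-- The sum is a single integral with the tag `partRight`, to which dominated convergence applies.
Tags approach each `r` from the right, so right-continuity will suffice. -/
theorem tendsto_sum_integral_partPoint (hab : a < b) {Φ : ℕ → ℝ → ℝ → ℝ} {Φ₀ : ℝ → ℝ} {M : ℝ}
    (hc : ∀ n ρ, Continuous (Φ n ρ))
    (hM : ∀ n, ∀ r ∈ Ioc a b, |Φ n (partRight a b n r) r| ≤ M)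
    (hlim : ∀ r ∈ Ioc a b, Tendsto (fun n => Φ n (partRight a b n r) r) atTop (𝓝 (Φ₀ r))) :
    Tendsto (fun n => ∑ i ∈ Finset.range (n + 1),
      ∫ r in partPoint a b n i..partPoint a b n (i + 1), Φ n (partPoint a b n (i + 1)) r) atTop
      (𝓝 (∫ r in a..b, Φ₀ r)) := by
  have hm : ∀ n, Measurable fun r => Φ n (partRight a b n r) r := by
    intro n
    have h1 : Measurable fun p : ℕ × ℝ => Φ n (partPoint a b n p.1) p.2 :=
      measurable_from_prod_countable_right fun j => (hc n (partPoint a b n j)).measurable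
    exact h1.comp (Measurable.prodMk (Nat.measurable_ceil.comp (by fun_prop)) measurable_id)
  have hsum : ∀ n, ∑ i ∈ Finset.range (n + 1),
      ∫ r in partPoint a b n i..partPoint a b n (i + 1), Φ n (partPoint a b n (i + 1)) r =
      ∫ r in a..b, Φ n (partRight a b n r) r := by
    intro n
    have hcongr : ∀ i, EqOn (fun r => Φ n (partRight a b n r) r)
        (fun r => Φ n (partPoint a b n (i + 1)) r)
        (Ioc (partPoint a b n i) (partPoint a b n (i + 1))) := fun i r hr => by
      simp only [partRight_eq hab n i hr]
    have hle := fun i => partPoint_mono hab.le n (Nat.le_succ i)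
    calc _ = ∑ i ∈ Finset.range (n + 1),
          ∫ r in partPoint a b n i..partPoint a b n (i + 1), Φ n (partRight a b n r) r := by
          refine Finset.sum_congr rfl fun i _ => ?_
          refine intervalIntegral.integral_congr_ae (ae_of_all _ fun r hr => ?_)
          rw [uIoc_of_le (hle i)] at hr
          exact (hcongr i hr).symm
      _ = _ := by
          rw [intervalIntegral.sum_integral_adjacent_intervals, partPoint_zero, partPoint_last]
          intro i _
          have h0 : IntervalIntegrable (fun r => Φ n (partPoint a b n (i + 1)) r) volume
            (partPoint a b n i) (partPoint a b n (i + 1)) := (hc n _).intervalIntegrable _ _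
          refine h0.congr ?_
          intro r hr
          rw [uIoc_of_le (hle i)] at hr
          exact (hcongr i hr).symm
  simp_rw [hsum]
  refine intervalIntegral.tendsto_integral_filter_of_dominated_convergence (fun _ => M)
    (Eventually.of_forall fun n => (hm n).aestronglyMeasurable)
    (Eventually.of_forall fun n => ae_of_all _ fun r hr => ?_)
    intervalIntegrable_const (ae_of_all _ fun r hr => ?_)
  · rw [uIoc_of_le hab.le] at hr
    exact hM n r hr
  · rw [uIoc_of_le hab.le] at hr
    exact hlim r hr

/-- Riemann-Stieltjes sums with left tags converge to the integral by parts. -/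
theorem tendsto_riemannSum_stieltjesInt (hab : a < b) {f x : ℝ → ℝ} (hf : ContDiff ℝ 1 f)
    (hx : ∀ r ∈ Icc a b, ContinuousWithinAt x (Ici r) r) {M : ℝ} (hM : ∀ r ∈ Icc a b, |x r| ≤ M) :
    Tendsto (fun n => ∑ i ∈ Finset.range (n + 1),
      f (partPoint a b n i) * (x (partPoint a b n (i + 1)) - x (partPoint a b n i))) atTop
      (𝓝 (stieltjesInt f x a b)) := by
  have hf' : Continuous (deriv f) := hf.continuous_deriv le_rfl
  obtain ⟨D, hD⟩ := isCompact_Icc.exists_bound_of_continuousOn (s := Icc a b) hf'.continuousOn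
  have hmem : ∀ n, ∀ r ∈ Ioc a b, partRight a b n r ∈ Icc a b := fun n r hr =>
    ⟨hr.1.le.trans (le_partRight hab n r), partRight_le hab n hr.2⟩
  have h1 := tendsto_sum_integral_partPoint hab (Φ := fun _ ρ r => deriv f r * x ρ)
    (Φ₀ := fun r => deriv f r * x r) (M := D * M) (fun _ ρ => hf'.mul_const _)
    (fun n r hr => by
      rw [abs_mul]
      have hD' := hD r ⟨hr.1.le, hr.2⟩
      exact mul_le_mul hD' (hM _ (hmem n r hr)) (abs_nonneg _) ((norm_nonneg _).trans hD'))
    (fun r hr => ((hx r ⟨hr.1.le, hr.2⟩).tendsto.comp (tendsto_partRight hab hr.1.le)).const_mul _)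
  refine (h1.const_sub (f b * x b - f a * x a)).congr fun n => ?_
  have hint : ∀ i, ∫ r in partPoint a b n i..partPoint a b n (i + 1),
      deriv f r * x (partPoint a b n (i + 1)) =
      (f (partPoint a b n (i + 1)) - f (partPoint a b n i)) * x (partPoint a b n (i + 1)) := by
    intro i
    rw [intervalIntegral.integral_mul_const, intervalIntegral.integral_deriv_eq_sub]
    · exact fun r _ => (hf.differentiable one_ne_zero) r
    · exact hf'.intervalIntegrable _ _
  simp_rw [hint]
  -- Summation by parts: left tags on `f` become right tags on `x`, weighted by the increments of
  -- `f`, which are integrals of its derivative.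
  have htel := Finset.sum_range_sub (fun i => f (partPoint a b n i) * x (partPoint a b n i)) (n + 1)
  rw [partPoint_last, partPoint_zero] at htel
  rw [← htel, ← Finset.sum_sub_distrib]
  refine Finset.sum_congr rfl fun i _ => ?_
  ring

theorem tendsto_riemannSum_left (hab : a < b) {g : ℝ → ℝ} (hg : Continuous g) :
    Tendsto (fun n => ∑ i ∈ Finset.range (n + 1),
      (partPoint a b n (i + 1) - partPoint a b n i) * g (partPoint a b n i)) atTop
      (𝓝 (∫ r in a..b, g r)) := by
  obtain ⟨D, hD⟩ := isCompact_Icc.exists_bound_of_continuousOn (s := Icc (a - (b - a)) b)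
    hg.continuousOn
  -- A left endpoint is a right endpoint shifted by the mesh. The shifted tag may fall below `a`, by
  -- at most `b - a`, hence the larger interval for the bound `D`.
  have h1 := tendsto_sum_integral_partPoint hab (Φ := fun n ρ _ => g (ρ - (b - a) / (n + 1)))
    (Φ₀ := g) (M := D) (fun _ _ => continuous_const)
    (fun n r hr => by
      have hd : (b - a) / (n + 1 : ℝ) ≤ b - a :=
        div_le_self (by linarith) (by linarith [(Nat.cast_nonneg n : (0 : ℝ) ≤ n)])
      have hd0 : 0 ≤ (b - a) / (n + 1 : ℝ) := div_nonneg (by linarith) (by positivity)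
      refine hD _ ⟨?_, ?_⟩
      · linarith [le_partRight hab n r, hr.1]
      · linarith [partRight_le hab n hr.2])
    (fun r hr => by
      refine (hg.tendsto r).comp ?_
      have h2 := ((tendsto_partRight hab hr.1.le).mono_right nhdsWithin_le_nhds).sub
        (tendsto_mesh a b)
      rwa [sub_zero] at h2)
  refine h1.congr fun n => Finset.sum_congr rfl fun i _ => ?_
  rw [intervalIntegral.integral_const, smul_eq_mul, ← partPoint_succ_sub n i, sub_sub_cancel]

/-- One-sided limits bound the path near each point, and compactness of the interval makes finitely
many such bounds enough. -/
theorem exists_bound_of_cadlag {x : ℝ≥0 → ℝ}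
    (hx : ∀ t : ℝ≥0, ContinuousWithinAt x (Ici t) t ∧ ∃ l : ℝ, Tendsto x (𝓝[<] t) (𝓝 l))
    (T : ℝ≥0) : ∃ M, ∀ r ∈ Icc 0 T, |x r| ≤ M := by
  refine isCompact_Icc.induction_on (p := fun s => ∃ M, ∀ r ∈ s, |x r| ≤ M) ?_ ?_ ?_ ?_
  · exact ⟨0, by simp⟩
  · rintro s t hst ⟨M, hM⟩
    exact ⟨M, fun r hr => hM r (hst hr)⟩
  · rintro s t ⟨M, hM⟩ ⟨N, hN⟩
    refine ⟨max M N, fun r hr => ?_⟩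
    rcases hr with hr | hr
    · exact (hM r hr).trans (le_max_left _ _)
    · exact (hN r hr).trans (le_max_right _ _)
  · intro t _
    obtain ⟨h1, l, h2⟩ := hx t
    have e1 : ∀ᶠ r in 𝓝[≥] t, |x r| < |x t| + 1 :=
      h1.tendsto.abs.eventually_lt_const (by linarith)
    have e2 : ∀ᶠ r in 𝓝[<] t, |x r| < |l| + 1 := h2.abs.eventually_lt_const (by linarith)
    have e3 : ∀ᶠ r in 𝓝 t, |x r| ≤ max (|x t| + 1) (|l| + 1) := by
      rw [← nhdsLT_sup_nhdsGE, eventually_sup]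
      exact ⟨e2.mono fun r hr => hr.le.trans (le_max_right _ _),
        e1.mono fun r hr => hr.le.trans (le_max_left _ _)⟩
    exact ⟨_, mem_nhdsWithin_of_mem_nhds e3, _, fun r hr => hr⟩

variable {Ω : Type*} [MeasurableSpace Ω] {P : Measure Ω} [IsProbabilityMeasure P]

/-- The bound holds for each Riemann sum. Truncation keeps the integrands at most `1`, so dominated
convergence passes it to the stochastic integral. -/
theorem FrozenSPDE.IsSymmStableProcess.lintegral_stieltjesInt_le {α : ℝ} (hα : 0 ≤ α)
    {X : ℝ≥0 → Ω → ℝ} (hX : IsSymmStableProcess P α X) {f : ℝ → ℝ} (hf : ContDiff ℝ 1 f)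
    (ha : 0 ≤ a) (hab : a ≤ b) {c : ℝ} (hc : 0 ≤ c) :
    ∫⁻ ω, ENNReal.ofReal
      (min 1 ((c * stieltjesInt f (fun r => X r.toNNReal ω) a b) ^ 2)) ∂P ≤
      ENNReal.ofReal (15 * (c ^ α * ∫ r in a..b, |f r| ^ α)) := by
  rcases hab.eq_or_lt with rfl | hab
  · simp [stieltjesInt]
  set J : ℕ → Ω → ℝ := fun n ω => ∑ i ∈ Finset.range (n + 1),
    f (partPoint a b n i) * (X (partPoint a b n (i + 1)).toNNReal ω -
      X (partPoint a b n i).toNNReal ω) with hJ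
  have hJm : ∀ n, Measurable (J n) := fun n => Finset.measurable_sum _ fun i _ =>
    ((hX.measurable _).sub (hX.measurable _)).const_mul _
  have hJlim : ∀ᵐ ω ∂P, Tendsto (fun n => J n ω) atTop
      (𝓝 (stieltjesInt f (fun r => X r.toNNReal ω) a b)) := by
    filter_upwards [hX.cadlag] with ω hω
    obtain ⟨M, hM⟩ := exists_bound_of_cadlag hω b.toNNReal
    refine tendsto_riemannSum_stieltjesInt hab hf (x := fun r => X r.toNNReal ω) (M := M) ?_ ?_
    · intro r _
      refine ContinuousWithinAt.comp (t := Ici r.toNNReal) (hω r.toNNReal).1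
        (by fun_prop : Continuous Real.toNNReal).continuousWithinAt ?_
      intro q hq
      exact Real.toNNReal_le_toNNReal hq
    · intro r hr
      exact hM _ ⟨zero_le, Real.toNNReal_le_toNNReal hr.2⟩
  have hpos : ∀ n i, 0 ≤ partPoint a b n i := fun n i =>
    ha.trans (by simpa [partPoint_zero] using partPoint_mono hab.le n (Nat.zero_le i))
  have hJb : ∀ n, ∫⁻ ω, ENNReal.ofReal (min 1 ((c * J n ω) ^ 2)) ∂P ≤
      ENNReal.ofReal (15 * (c ^ α * ∑ i ∈ Finset.range (n + 1),
        (partPoint a b n (i + 1) - partPoint a b n i) * |f (partPoint a b n i)| ^ α)) := by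
    intro n
    refine lintegral_min_one_sq_le_of_charFun (hJm n) hα
      (Finset.sum_nonneg fun i _ => mul_nonneg (sub_nonneg.2 (partPoint_mono hab.le n
        (Nat.le_succ i))) (Real.rpow_nonneg (abs_nonneg _) _)) (fun h => ?_) hc
    have := hX.charFun_sum (r := fun i => (partPoint a b n i).toNNReal)
      (fun i j hij => Real.toNNReal_le_toNNReal (partPoint_mono hab.le n hij))
      (fun i => f (partPoint a b n i)) (n + 1) h
    simpa only [Real.coe_toNNReal _ (hpos n _)] using this
  refine le_of_tendsto_of_tendsto' (b := atTop)
    (f := fun n => ∫⁻ ω, ENNReal.ofReal (min 1 ((c * J n ω) ^ 2)) ∂P) ?_ ?_ hJb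
  · refine tendsto_lintegral_of_dominated_convergence (fun _ => 1) (fun n => ?_)
      (fun n => ae_of_all _ fun ω => ?_) (by simp) ?_
    · have := hJm n
      fun_prop
    · exact ENNReal.ofReal_le_one.2 (min_le_left _ _)
    · filter_upwards [hJlim] with ω hω
      exact (ENNReal.continuous_ofReal.tendsto _).comp
        (tendsto_const_nhds.min ((hω.const_mul c).pow 2))
  · refine (ENNReal.continuous_ofReal.tendsto _).comp (Tendsto.const_mul _ (Tendsto.const_mul _ ?_))
    refine tendsto_riemannSum_left hab (g := fun r => |f r| ^ α) ?_
    exact (continuous_abs.comp hf.continuous).rpow_const fun _ => Or.inr hα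

end RiemannSums

/-! ### Two-sided paths and their exponential integrals -/

section Paths

/-- Regularity of the paths of a two-sided process: right-continuous on `[0, ∞)`, left-continuous
on `(-∞, 0)` and locally bounded. -/
structure TwoSidedRegular (x : ℝ → ℝ) : Prop where
  right : ∀ t, 0 ≤ t → ContinuousWithinAt x (Ici t) t
  left : ∀ t, t < 0 → ContinuousWithinAt x (Iic t) t
  bdd : ∀ T, ∃ M, ∀ r ∈ Icc (-T) T, |x r| ≤ M

/-- The point `r` moved away from the origin to the grid `ℤ / (n + 1)`. -/
noncomputable def gridPoint (n : ℕ) (r : ℝ) : ℝ :=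
  if 0 ≤ r then (⌈r * (n + 1)⌉ : ℝ) / (n + 1) else (⌊r * (n + 1)⌋ : ℝ) / (n + 1)

theorem abs_gridPoint_sub_le (n : ℕ) (r : ℝ) : |gridPoint n r - r| ≤ 1 / (n + 1) := by
  have hn : (0 : ℝ) < n + 1 := by positivity
  unfold gridPoint
  split_ifs with h
  · rw [abs_of_nonneg, sub_le_iff_le_add, div_le_iff₀ hn, add_mul, div_mul_cancel₀ _ hn.ne']
    · linarith [Int.ceil_lt_add_one (r * (n + 1))]
    · rw [sub_nonneg, le_div_iff₀ hn]
      exact Int.le_ceil _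
  · rw [abs_of_nonpos, neg_sub, sub_le_comm, le_div_iff₀ hn, sub_mul, div_mul_cancel₀ _ hn.ne']
    · linarith [Int.lt_floor_add_one (r * (n + 1))]
    · rw [sub_nonpos, div_le_iff₀ hn]
      exact Int.floor_le _

theorem le_gridPoint (n : ℕ) {r : ℝ} (hr : 0 ≤ r) : r ≤ gridPoint n r := by
  have hn : (0 : ℝ) < n + 1 := by positivity
  rw [gridPoint, if_pos hr, le_div_iff₀ hn]
  exact Int.le_ceil _

theorem gridPoint_le (n : ℕ) {r : ℝ} (hr : r < 0) : gridPoint n r ≤ r := by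
  have hn : (0 : ℝ) < n + 1 := by positivity
  rw [gridPoint, if_neg hr.not_ge, div_le_iff₀ hn]
  exact Int.floor_le _

theorem tendsto_gridPoint (r : ℝ) : Tendsto (fun n => gridPoint n r) atTop (𝓝 r) := by
  rw [tendsto_iff_dist_tendsto_zero]
  refine squeeze_zero (fun _ => dist_nonneg) (fun n => ?_)
    (tendsto_one_div_add_atTop_nhds_zero_nat (𝕜 := ℝ))
  rw [Real.dist_eq]
  exact abs_gridPoint_sub_le n r

/-- The projection of the real line to `[a, b]`. -/
def clamp (a b r : ℝ) : ℝ := max a (min b r)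

theorem clamp_of_mem {a b r : ℝ} (hr : r ∈ Icc a b) : clamp a b r = r := by
  rw [clamp, min_eq_right hr.2, max_eq_right hr.1]

theorem clamp_mem {a b : ℝ} (hab : a ≤ b) (r : ℝ) : clamp a b r ∈ Icc a b :=
  ⟨le_max_left _ _, max_le hab (min_le_left _ _)⟩

theorem continuous_clamp (a b : ℝ) : Continuous (clamp a b) := by
  unfold clamp
  fun_prop

theorem clamp_mono (a b : ℝ) : Monotone (clamp a b) := fun _ _ h =>
  max_le_max_left _ (min_le_min_left _ h)

/-- Rounding away from the origin approaches `r` from the side on which the path is continuous;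
clamping is monotone and keeps that side. -/
theorem TwoSidedRegular.tendsto_clamp_gridPoint {x : ℝ → ℝ} (hx : TwoSidedRegular x) {a b r : ℝ}
    (hr : r ∈ Icc a b) : Tendsto (fun n => x (clamp a b (gridPoint n r))) atTop (𝓝 (x r)) := by
  have h1 : Tendsto (fun n => clamp a b (gridPoint n r)) atTop (𝓝 r) := by
    have := ((continuous_clamp a b).tendsto r).comp (tendsto_gridPoint r)
    rwa [clamp_of_mem hr] at this
  rcases le_or_gt 0 r with h | h
  · refine (hx.right r h).tendsto.comp (tendsto_nhdsWithin_iff.2 ⟨h1, Eventually.of_forall ?_⟩)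
    intro n
    have := clamp_mono a b (le_gridPoint n h)
    rwa [clamp_of_mem hr] at this
  · refine (hx.left r h).tendsto.comp (tendsto_nhdsWithin_iff.2 ⟨h1, Eventually.of_forall ?_⟩)
    intro n
    have := clamp_mono a b (gridPoint_le n h)
    rwa [clamp_of_mem hr] at this

theorem measurable_comp_clamp_gridPoint {Ω : Type*} [MeasurableSpace Ω] {X : ℝ → Ω → ℝ} {a b : ℝ}
    (hab : a ≤ b) (hX : ∀ r ∈ Icc a b, Measurable (X r)) (n : ℕ) :
    Measurable fun p : ℝ × Ω => X (clamp a b (gridPoint n p.1)) p.2 := by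
  have h1 : Measurable fun p : ℤ × Ω => X (clamp a b ((p.1 : ℝ) / (n + 1))) p.2 :=
    measurable_from_prod_countable_right fun j =>
      hX (clamp a b ((j : ℝ) / (n + 1))) (clamp_mem hab _)
  have h2 : Measurable fun p : ℝ × Ω => if 0 ≤ p.1 then ⌈p.1 * (n + 1)⌉ else ⌊p.1 * (n + 1)⌋ :=
    Measurable.ite (measurableSet_le measurable_const measurable_fst)
      (Int.measurable_ceil.comp (by fun_prop)) (Int.measurable_floor.comp (by fun_prop))
  convert h1.comp (h2.prodMk measurable_snd) using 2 with p
  simp only [Function.comp, gridPoint]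
  split_ifs <;> rfl

theorem TwoSidedRegular.intervalIntegrable {x : ℝ → ℝ} (hx : TwoSidedRegular x) (a b : ℝ) :
    IntervalIntegrable x volume a b := by
  wlog hab : a ≤ b generalizing a b
  · exact (this b a (not_le.1 hab).le).symm
  have hm : Measurable fun r => x (clamp a b r) := by
    refine measurable_of_tendsto_metrizable
      (f := fun n r => x (clamp a b (gridPoint n (clamp a b r)))) (fun n => ?_)
      (tendsto_pi_nhds.2 fun r => hx.tendsto_clamp_gridPoint (clamp_mem hab r))
    have := measurable_comp_clamp_gridPoint (Ω := Unit) (X := fun r _ => x r) hab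
      (fun r _ => measurable_const) n
    exact this.comp ((continuous_clamp a b).measurable.prodMk (measurable_const (a := ())))
  obtain ⟨M, hM⟩ := hx.bdd (max |a| |b|)
  have hi : IntervalIntegrable (fun r => x (clamp a b r)) volume a b := by
    rw [intervalIntegrable_iff_integrableOn_Ioc_of_le hab]
    refine Integrable.mono' (integrable_const M) hm.aestronglyMeasurable (ae_of_all _ fun r => ?_)
    have h := clamp_mem hab r
    refine hM _ ⟨?_, ?_⟩
    · have := neg_abs_le a
      have := le_max_left |a| |b|
      linarith [h.1]
    · have := le_abs_self b
      have := le_max_right |a| |b|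
      linarith [h.2]
  refine hi.congr fun r hr => ?_
  rw [uIoc_of_le hab] at hr
  simp only [clamp_of_mem (Ioc_subset_Icc_self hr)]

/-- The integral `∫_s^t e^{-b(t-r)} dx_r`. -/
noncomputable def expInt (b : ℝ) (x : ℝ → ℝ) (s t : ℝ) : ℝ :=
  stieltjesInt (fun r => Real.exp (-b * (t - r))) x s t

theorem deriv_exp_kernel (b t : ℝ) :
    deriv (fun r => Real.exp (-b * (t - r))) = fun r => b * Real.exp (-b * (t - r)) := by
  funext r
  have h1 : HasDerivAt (fun r => -b * (t - r)) b r := by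
    simpa using ((hasDerivAt_id r).const_sub t).const_mul (-b)
  rw [h1.exp.deriv, mul_comm]

theorem expInt_eq (b : ℝ) (x : ℝ → ℝ) (s t : ℝ) :
    expInt b x s t = x t - Real.exp (-b * (t - s)) * x s -
      ∫ r in s..t, b * Real.exp (-b * (t - r)) * x r := by
  rw [expInt, stieltjesInt, deriv_exp_kernel]
  simp

/-- The kernel is multiplicative in time and the boundary terms at `s` cancel. This cocycle relation
is what lets a mild solution be restarted. -/
theorem expInt_add {b : ℝ} {x : ℝ → ℝ} {u s t : ℝ}
    (hx : IntervalIntegrable x volume u s) (hx' : IntervalIntegrable x volume s t) :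
    expInt b x u t = Real.exp (-b * (t - s)) * expInt b x u s + expInt b x s t := by
  have hc : Continuous fun r => b * Real.exp (-b * (t - r)) := by fun_prop
  have h1 : ∫ r in u..s, b * Real.exp (-b * (t - r)) * x r =
      Real.exp (-b * (t - s)) * ∫ r in u..s, b * Real.exp (-b * (s - r)) * x r := by
    rw [← intervalIntegral.integral_const_mul]
    congr 1
    funext r
    have : Real.exp (-b * (t - r)) = Real.exp (-b * (t - s)) * Real.exp (-b * (s - r)) := by
      rw [← Real.exp_add]
      ring_nf
    rw [this]
    ring
  have h2 : Real.exp (-b * (t - u)) = Real.exp (-b * (t - s)) * Real.exp (-b * (s - u)) := by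
    rw [← Real.exp_add]
    ring_nf
  rw [expInt_eq, expInt_eq, expInt_eq, ← intervalIntegral.integral_add_adjacent_intervals
    (hx.continuousOn_mul hc.continuousOn) (hx'.continuousOn_mul hc.continuousOn), h1, h2]
  ring

/-- The kernel `b e^{-b(t-r)}` has mass `1 - e^{-b(t-s)}`, so only increments from time `s` enter.
This makes the integral measurable for σ-algebras that see increments alone. -/
theorem expInt_sub_const {b : ℝ} {x : ℝ → ℝ} {s t : ℝ} (hx : IntervalIntegrable x volume s t) :
    expInt b x s t = (x t - x s) - ∫ r in s..t, b * Real.exp (-b * (t - r)) * (x r - x s) := by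
  have hc : Continuous fun r => b * Real.exp (-b * (t - r)) := by fun_prop
  have h1 : ∫ r in s..t, b * Real.exp (-b * (t - r)) * x s =
      (1 - Real.exp (-b * (t - s))) * x s := by
    have hd : ∀ r, HasDerivAt (fun r => Real.exp (-b * (t - r))) (b * Real.exp (-b * (t - r))) r := by
      intro r
      have h1 : HasDerivAt (fun r => -b * (t - r)) b r := by
        simpa using ((hasDerivAt_id r).const_sub t).const_mul (-b)
      simpa [mul_comm] using h1.exp
    rw [intervalIntegral.integral_mul_const,
      intervalIntegral.integral_eq_sub_of_hasDerivAt (fun r _ => hd r)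
        (hc.intervalIntegrable _ _)]
    simp
  have h2 : ∀ r, b * Real.exp (-b * (t - r)) * (x r - x s) =
      b * Real.exp (-b * (t - r)) * x r - b * Real.exp (-b * (t - r)) * x s :=
    fun r => mul_sub _ _ _
  simp_rw [h2]
  rw [intervalIntegral.integral_sub (hx.continuousOn_mul hc.continuousOn)
    ((hc.mul_const _).intervalIntegrable _ _), h1, expInt_eq]
  ring

theorem stieltjesInt_congr {f x y : ℝ → ℝ} {s t : ℝ} (hst : s ≤ t)
    (h : ∀ r ∈ Icc s t, x r = y r) : stieltjesInt f x s t = stieltjesInt f y s t := by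
  rw [stieltjesInt, stieltjesInt, h t (right_mem_Icc.2 hst), h s (left_mem_Icc.2 hst)]
  congr 1
  refine intervalIntegral.integral_congr fun r hr => ?_
  rw [uIcc_of_le hst] at hr
  simp only [h r hr]

/-- Time reversal turns the integral over negative times into an integral against the forward
process `Ztilde`, to which the estimates for stable processes apply. -/
theorem expInt_comp_neg (b : ℝ) (x : ℝ → ℝ) (s t : ℝ) :
    expInt b (fun r => x (-r)) s t =
      -stieltjesInt (fun v => Real.exp (-b * (t + v))) x (-t) (-s) := by
  have hd : deriv (fun v => Real.exp (-b * (t + v))) = fun v => -b * Real.exp (-b * (t + v)) := by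
    funext v
    have h1 : HasDerivAt (fun v => -b * (t + v)) (-b) v := by
      simpa using ((hasDerivAt_id v).const_add t).const_mul (-b)
    rw [h1.exp.deriv, mul_comm]
  have h2 := intervalIntegral.integral_comp_neg (a := s) (b := t)
    (fun v => -b * Real.exp (-b * (t + v)) * x v)
  rw [expInt_eq, stieltjesInt, hd, ← h2]
  have h3 : ∫ r in s..t, -b * Real.exp (-b * (t + -r)) * x (-r) =
      -∫ r in s..t, b * Real.exp (-b * (t - r)) * x (-r) := by
    rw [← intervalIntegral.integral_neg]
    congr 1
    funext r
    ring_nf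
  rw [h3]
  simp only [add_neg_cancel, mul_zero, Real.exp_zero, one_mul]
  rw [← sub_eq_add_neg]
  ring

theorem integral_abs_exp_kernel_rpow_le {b α : ℝ} (hb : 0 < b) (hα : 1 ≤ α) (s t : ℝ) :
    ∫ r in s..t, |Real.exp (-b * (t - r))| ^ α ≤ 1 / b := by
  have h1 : ∀ r, |Real.exp (-b * (t - r))| ^ α = Real.exp (-(α * b) * (t - r)) := by
    intro r
    rw [abs_of_pos (Real.exp_pos _), ← Real.exp_mul]
    ring_nf
  simp_rw [h1]
  refine (integral_exp_kernel_le (by positivity) s t).trans ?_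
  gcongr
  nlinarith

/-- A triangle inequality for truncated squares, up to a factor; it splits an integral across time
`0` into its two one-sided parts. -/
theorem min_one_add_sq_le (u v : ℝ) :
    min 1 ((u + v) ^ 2) ≤ 2 * min 1 (u ^ 2) + 2 * min 1 (v ^ 2) := by
  have h1 : min 1 ((u + v) ^ 2) ≤ 1 := min_le_left _ _
  have h2 : min 1 ((u + v) ^ 2) ≤ (u + v) ^ 2 := min_le_right _ _
  have h3 : 0 ≤ min 1 (u ^ 2) := le_min zero_le_one (sq_nonneg _)
  have h4 : 0 ≤ min 1 (v ^ 2) := le_min zero_le_one (sq_nonneg _)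
  rcases le_total 1 (u ^ 2) with hu | hu
  · rw [min_eq_left hu]; linarith
  rcases le_total 1 (v ^ 2) with hv | hv
  · rw [min_eq_left hv]; linarith
  rw [min_eq_right hu, min_eq_right hv]
  nlinarith [sq_nonneg (u - v)]

end Paths

/-! ### Truncated moments and joint measurability of the exponential integrals -/

section TwoSided

variable {Ω : Type*} [MeasurableSpace Ω] {P : Measure Ω} {α : ℝ} {Z Ztilde : ℕ → ℝ≥0 → Ω → ℝ}

theorem ae_twoSidedRegular (hZ : ∀ k, IsSymmStableProcess P α (Z k))
    (hZtilde : ∀ k, IsSymmStableProcess P α (Ztilde k)) :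
    ∀ᵐ ω ∂P, ∀ k, TwoSidedRegular fun r => twoSided Z Ztilde k r ω := by
  rw [ae_all_iff]
  intro k
  filter_upwards [(hZ k).cadlag, (hZtilde k).cadlag] with ω h1 h2
  have hpos : ∀ r, 0 ≤ r → twoSided Z Ztilde k r ω = Z k r.toNNReal ω := fun r hr => by
    rw [twoSided, if_pos hr]
  have hneg : ∀ r, r < 0 → twoSided Z Ztilde k r ω = Ztilde k (-r).toNNReal ω := fun r hr => by
    rw [twoSided, if_neg hr.not_ge]
  refine ⟨fun t ht => ?_, fun t ht => ?_, fun T => ?_⟩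
  · refine ContinuousWithinAt.congr (f := fun r : ℝ => Z k r.toNNReal ω) ?_
      (fun r hr => hpos r (ht.trans hr)) (hpos t ht)
    refine ContinuousWithinAt.comp (t := Ici t.toNNReal) (g := fun r => Z k r ω)
      (h1 t.toNNReal).1 (by fun_prop : Continuous Real.toNNReal).continuousWithinAt ?_
    exact fun q hq => Real.toNNReal_le_toNNReal hq
  · refine ContinuousWithinAt.congr (f := fun r : ℝ => Ztilde k (-r).toNNReal ω) ?_
      (fun r hr => hneg r (lt_of_le_of_lt hr ht)) (hneg t ht)
    refine ContinuousWithinAt.comp (t := Ici (-t).toNNReal) (g := fun r => Ztilde k r ω)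
      (f := fun r : ℝ => (-r).toNNReal) (h2 (-t).toNNReal).1
      (by fun_prop : Continuous fun r : ℝ => (-r).toNNReal).continuousWithinAt ?_
    exact fun q hq => Real.toNNReal_le_toNNReal (neg_le_neg hq)
  · obtain ⟨M, hM⟩ := exists_bound_of_cadlag h1 T.toNNReal
    obtain ⟨N, hN⟩ := exists_bound_of_cadlag h2 T.toNNReal
    refine ⟨max M N, fun r hr => ?_⟩
    rcases le_or_gt 0 r with h | h
    · rw [hpos r h]
      exact (hM _ ⟨zero_le, Real.toNNReal_le_toNNReal hr.2⟩).trans (le_max_left _ _)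
    · rw [hneg r h]
      exact (hN _ ⟨zero_le, Real.toNNReal_le_toNNReal (by linarith [hr.1])⟩).trans
        (le_max_right _ _)

theorem lintegral_expInt_of_nonneg [IsProbabilityMeasure P] (hα : 1 ≤ α)
    (hZ : ∀ k, IsSymmStableProcess P α (Z k)) (k : ℕ) {b : ℝ} (hb : 0 < b) {s t : ℝ} (hs : 0 ≤ s)
    (hst : s ≤ t) {c : ℝ} (hc : 0 ≤ c) :
    ∫⁻ ω, ENNReal.ofReal
      (min 1 ((c * expInt b (fun r => twoSided Z Ztilde k r ω) s t) ^ 2)) ∂P ≤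
      ENNReal.ofReal (15 * (c ^ α * (1 / b))) := by
  have h := (hZ k).lintegral_stieltjesInt_le (by linarith)
    (f := fun r => Real.exp (-b * (t - r))) (by fun_prop) hs hst hc
  calc _ = ∫⁻ ω, ENNReal.ofReal (min 1 ((c * stieltjesInt (fun r => Real.exp (-b * (t - r)))
        (fun r => Z k r.toNNReal ω) s t) ^ 2)) ∂P := by
        congr 1
        funext ω
        rw [expInt, stieltjesInt_congr hst fun r hr => ?_]
        rw [twoSided, if_pos (hs.trans hr.1)]
    _ ≤ _ := h
    _ ≤ _ := by
        gcongr
        exact integral_abs_exp_kernel_rpow_le hb hα s t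

theorem lintegral_expInt_of_nonpos [IsProbabilityMeasure P] (hα : 1 ≤ α)
    (hZ : ∀ k, IsSymmStableProcess P α (Z k))
    (hZtilde : ∀ k, IsSymmStableProcess P α (Ztilde k)) (k : ℕ) {b : ℝ} (hb : 0 < b) {s t : ℝ}
    (ht : t ≤ 0) (hst : s ≤ t) {c : ℝ} (hc : 0 ≤ c) :
    ∫⁻ ω, ENNReal.ofReal
      (min 1 ((c * expInt b (fun r => twoSided Z Ztilde k r ω) s t) ^ 2)) ∂P ≤
      ENNReal.ofReal (15 * (c ^ α * (1 / b))) := by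
  have h := (hZtilde k).lintegral_stieltjesInt_le (by linarith)
    (f := fun v => Real.exp (-b * (t + v))) (by fun_prop) (neg_nonneg.2 ht) (neg_le_neg hst) hc
  calc _ = ∫⁻ ω, ENNReal.ofReal (min 1 ((c * stieltjesInt (fun v => Real.exp (-b * (t + v)))
        (fun r => Ztilde k r.toNNReal ω) (-t) (-s)) ^ 2)) ∂P := by
        refine lintegral_congr_ae ?_
        filter_upwards [(hZ k).start_zero, (hZtilde k).start_zero] with ω h1 h2
        have h3 : expInt b (fun r => twoSided Z Ztilde k r ω) s t =
            expInt b (fun r => Ztilde k (-r).toNNReal ω) s t := by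
          refine stieltjesInt_congr hst fun r hr => ?_
          rw [twoSided]
          split_ifs with h0
          · have : r = 0 := le_antisymm (hr.2.trans ht) h0
            simp [this, h1, h2]
          · rfl
        rw [h3, expInt_comp_neg b (fun r => Ztilde k r.toNNReal ω), mul_neg, neg_sq]
    _ ≤ _ := h
    _ ≤ _ := by
        gcongr
        have h4 := intervalIntegral.integral_comp_neg (a := s) (b := t)
          (fun v => |Real.exp (-b * (t + v))| ^ α)
        rw [← h4]
        simpa only [← sub_eq_add_neg] using integral_abs_exp_kernel_rpow_le hb hα s t

/-- When `s < 0 < t`, the two sides of the origin each contribute `2 · 15`, hence `60`. The part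
before `0` is damped further by `e^{-bt} ≤ 1`. -/
theorem lintegral_expInt_le [IsProbabilityMeasure P] (hα : 1 ≤ α)
    (hZ : ∀ k, IsSymmStableProcess P α (Z k))
    (hZtilde : ∀ k, IsSymmStableProcess P α (Ztilde k)) (k : ℕ) {b : ℝ} (hb : 0 < b) {s t : ℝ}
    (hst : s ≤ t) {c : ℝ} (hc : 0 ≤ c)
    (hm : AEMeasurable (fun ω => expInt b (fun r => twoSided Z Ztilde k r ω) s 0) P) :
    ∫⁻ ω, ENNReal.ofReal
      (min 1 ((c * expInt b (fun r => twoSided Z Ztilde k r ω) s t) ^ 2)) ∂P ≤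
      ENNReal.ofReal (60 * (c ^ α * (1 / b))) := by
  have hmono : ENNReal.ofReal (15 * (c ^ α * (1 / b))) ≤
      ENNReal.ofReal (60 * (c ^ α * (1 / b))) := by
    gcongr
    norm_num
  rcases le_or_gt 0 s with hs | hs
  · exact (lintegral_expInt_of_nonneg hα hZ k hb hs hst hc).trans hmono
  rcases le_or_gt t 0 with ht | ht
  · exact (lintegral_expInt_of_nonpos hα hZ hZtilde k hb ht hst hc).trans hmono
  have h1 := lintegral_expInt_of_nonpos hα hZ hZtilde k hb le_rfl hs.le hc
  have h2 := lintegral_expInt_of_nonneg (Ztilde := Ztilde) hα hZ k hb le_rfl ht.le hc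
  calc _ ≤ ∫⁻ ω, (2 * ENNReal.ofReal
        (min 1 ((c * expInt b (fun r => twoSided Z Ztilde k r ω) s 0) ^ 2)) +
        2 * ENNReal.ofReal
        (min 1 ((c * expInt b (fun r => twoSided Z Ztilde k r ω) 0 t) ^ 2))) ∂P := by
        refine lintegral_mono_ae ?_
        filter_upwards [ae_twoSidedRegular hZ hZtilde] with ω hω
        rw [expInt_add ((hω k).intervalIntegrable s 0) ((hω k).intervalIntegrable 0 t)]
        set A := expInt b (fun r => twoSided Z Ztilde k r ω) s 0
        set B := expInt b (fun r => twoSided Z Ztilde k r ω) 0 t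
        have he : Real.exp (-b * (t - 0)) ≤ 1 := Real.exp_le_one_iff.2 (by nlinarith)
        have h3 := min_one_add_sq_le (c * (Real.exp (-b * (t - 0)) * A)) (c * B)
        have h4 : min 1 ((c * (Real.exp (-b * (t - 0)) * A)) ^ 2) ≤ min 1 ((c * A) ^ 2) := by
          refine min_le_min_left _ ?_
          rw [mul_left_comm, mul_pow]
          exact mul_le_of_le_one_left (sq_nonneg _) (pow_le_one₀ (Real.exp_pos _).le he)
        rw [← ENNReal.ofReal_ofNat 2, ← ENNReal.ofReal_mul (by norm_num),
          ← ENNReal.ofReal_mul (by norm_num), ← ENNReal.ofReal_add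
            (mul_nonneg (by norm_num) (le_min zero_le_one (sq_nonneg _)))
            (mul_nonneg (by norm_num) (le_min zero_le_one (sq_nonneg _)))]
        refine ENNReal.ofReal_le_ofReal ?_
        rw [mul_add]
        linarith
    _ ≤ 2 * ENNReal.ofReal (15 * (c ^ α * (1 / b))) +
          2 * ENNReal.ofReal (15 * (c ^ α * (1 / b))) := by
        rw [lintegral_add_left' (by fun_prop),
          lintegral_const_mul' _ _ (by simp), lintegral_const_mul' _ _ (by simp)]
        gcongr
    _ = _ := by
        rw [← two_mul, ← mul_assoc, ← ENNReal.ofReal_ofNat 2, ← ENNReal.ofReal_mul (by norm_num),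
          ← ENNReal.ofReal_mul (by norm_num)]
        congr 1
        ring

/-- A jointly measurable version of the integrals `∫_a^t e^{-b(t-r)} dX_r`, `t ∈ [a, T]`, where the
σ-algebra need only contain the increments of the process. -/
theorem exists_measurable_expInt {Ω : Type*} (m : MeasurableSpace Ω) {X : ℝ → Ω → ℝ} {a T : ℝ}
    (haT : a ≤ T) (hX : ∀ r ∈ Icc a T, Measurable fun ω => X r ω - X a ω) (b : ℝ) :
    ∃ I : ℝ → Ω → ℝ, Measurable (Function.uncurry I) ∧
      ∀ ω, TwoSidedRegular (fun r => X r ω) → ∀ t ∈ Icc a T,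
        I t ω = expInt b (fun r => X r ω) a t := by
  -- The increment process as a limit of step functions on the grid: each step function takes its
  -- time argument from a countable set, so joint measurability follows from measurability of the
  -- individual increments.
  set U : ℝ × Ω → ℝ := fun p => limUnder atTop fun n =>
    X (clamp a T (gridPoint n (clamp a T p.1))) p.2 - X a p.2 with hU
  have hUm : Measurable U := by
    refine (StronglyMeasurable.limUnder (l := (atTop : Filter ℕ)) fun n => ?_).measurable
    have h1 := measurable_comp_clamp_gridPoint (X := fun r ω => X r ω - X a ω) haT hX n
    have h2 : Measurable fun p : ℝ × Ω => (clamp a T p.1, p.2) :=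
      ((continuous_clamp a T).measurable.comp measurable_fst).prodMk measurable_snd
    exact (h1.comp h2).stronglyMeasurable
  have hUeq : ∀ ω, TwoSidedRegular (fun r => X r ω) → ∀ t ∈ Icc a T,
      U (t, ω) = X t ω - X a ω := by
    intro ω hω t ht
    refine Tendsto.limUnder_eq ?_
    simp only [clamp_of_mem ht]
    exact (hω.tendsto_clamp_gridPoint ht).sub_const _
  refine ⟨fun t ω => U (t, ω) -
    ∫ r, (Ioc a t).indicator (fun r => b * Real.exp (-b * (t - r)) * U (r, ω)) r, ?_, ?_⟩
  · have h1 : Measurable fun q : (ℝ × Ω) × ℝ => U (q.2, q.1.2) :=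
      hUm.comp (by fun_prop : Measurable fun q : (ℝ × Ω) × ℝ => (q.2, q.1.2))
    have h2 : Measurable fun q : (ℝ × Ω) × ℝ =>
        b * Real.exp (-b * (q.1.1 - q.2)) * U (q.2, q.1.2) := by fun_prop
    have hs : MeasurableSet {q : (ℝ × Ω) × ℝ | q.2 ∈ Ioc a q.1.1} :=
      MeasurableSet.inter (s₁ := {q : (ℝ × Ω) × ℝ | a < q.2})
        (s₂ := {q : (ℝ × Ω) × ℝ | q.2 ≤ q.1.1})
        (measurableSet_lt (by fun_prop) (by fun_prop))
        (measurableSet_le (by fun_prop) (by fun_prop))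
    have h3 : Measurable fun q : (ℝ × Ω) × ℝ => (Ioc a q.1.1).indicator
        (fun r => b * Real.exp (-b * (q.1.1 - r)) * U (r, q.1.2)) q.2 := h2.indicator hs
    exact hUm.sub h3.stronglyMeasurable.integral_prod_right'.measurable
  · intro ω hω t ht
    change U (t, ω) - _ = _
    rw [expInt_sub_const (hω.intervalIntegrable a t), hUeq ω hω t ht,
      integral_indicator measurableSet_Ioc, intervalIntegral.integral_of_le ht.1]
    congr 1
    refine setIntegral_congr_fun measurableSet_Ioc fun r hr => ?_
    simp only [hUeq ω hω r ⟨hr.1.le, hr.2.trans ht.2⟩]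

end TwoSided

/-! ### From truncated coordinates to tails and moments in `H` -/

section Tail

variable {Ω : Type*} [MeasurableSpace Ω] {P : Measure Ω} {α : ℝ}

/-- Either some term is already truncated and contributes `1`, or no truncation is active and the
sum is `l^{-2} ∑ a_k² ≥ 1`. Thus the coordinates may be truncated one at a time. -/
theorem one_le_tsum_min_one_sq {a : ℕ → ℝ} {l : ℝ} (hl : 0 < l)
    (h : ENNReal.ofReal (l ^ 2) ≤ ∑' k, ENNReal.ofReal (a k ^ 2)) :
    1 ≤ ∑' k, ENNReal.ofReal (min 1 ((l⁻¹ * a k) ^ 2)) := by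
  by_cases hk : ∃ k, 1 ≤ (l⁻¹ * a k) ^ 2
  · obtain ⟨k, hk⟩ := hk
    refine le_trans ?_ (ENNReal.le_tsum k)
    rw [min_eq_left hk, ENNReal.ofReal_one]
  · push Not at hk
    have h1 : ∀ k, ENNReal.ofReal (min 1 ((l⁻¹ * a k) ^ 2)) =
        ENNReal.ofReal ((l ^ 2)⁻¹) * ENNReal.ofReal (a k ^ 2) := fun k => by
      rw [min_eq_right (hk k).le, ← ENNReal.ofReal_mul (by positivity), mul_pow, inv_pow]
    simp_rw [h1]
    rw [ENNReal.tsum_mul_left]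
    calc (1 : ℝ≥0∞) = ENNReal.ofReal ((l ^ 2)⁻¹) * ENNReal.ofReal (l ^ 2) := by
          rw [← ENNReal.ofReal_mul (by positivity), inv_mul_cancel₀ (by positivity),
            ENNReal.ofReal_one]
      _ ≤ _ := by gcongr

/-- Markov's inequality for the sum of truncated squares, with `c = l⁻¹` in the coordinate bound.
Independence of the coordinates plays no role. -/
theorem measure_le_tsum_sq_le {a : ℕ → Ω → ℝ} (ha : ∀ k, AEMeasurable (a k) P) {σ : ℕ → ℝ}
    (hσ0 : ∀ k, 0 ≤ σ k) (hσ : Summable σ)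
    (hb : ∀ k c, 0 ≤ c →
      ∫⁻ ω, ENNReal.ofReal (min 1 ((c * a k ω) ^ 2)) ∂P ≤ ENNReal.ofReal (c ^ α * σ k))
    {l : ℝ} (hl : 0 < l) :
    P {ω | ENNReal.ofReal (l ^ 2) ≤ ∑' k, ENNReal.ofReal (a k ω ^ 2)} ≤
      ENNReal.ofReal (l ^ (-α) * ∑' k, σ k) := by
  have hm : ∀ k, AEMeasurable (fun ω => ENNReal.ofReal (min 1 ((l⁻¹ * a k ω) ^ 2))) P := fun k => by
    have := ha k
    fun_prop
  calc _ ≤ P {ω | 1 ≤ ∑' k, ENNReal.ofReal (min 1 ((l⁻¹ * a k ω) ^ 2))} :=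
        measure_mono fun ω hω => one_le_tsum_min_one_sq hl hω
    _ ≤ ∫⁻ ω, ∑' k, ENNReal.ofReal (min 1 ((l⁻¹ * a k ω) ^ 2)) ∂P := by
        have := mul_meas_ge_le_lintegral₀ (AEMeasurable.tsum (L := .unconditional ℕ) hm) 1
        rwa [one_mul] at this
    _ = ∑' k, ∫⁻ ω, ENNReal.ofReal (min 1 ((l⁻¹ * a k ω) ^ 2)) ∂P := lintegral_tsum hm
    _ ≤ ∑' k, ENNReal.ofReal (l ^ (-α) * σ k) := by
        refine ENNReal.tsum_le_tsum fun k => (hb k _ (inv_nonneg.2 hl.le)).trans (le_of_eq ?_)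
        rw [Real.inv_rpow hl.le, Real.rpow_neg hl.le]
    _ = _ := by
        have hl0 : 0 ≤ l ^ (-α) := Real.rpow_nonneg hl.le _
        rw [← ENNReal.ofReal_tsum_of_nonneg (fun k => mul_nonneg hl0 (hσ0 k)) (hσ.mul_left _),
          tsum_mul_left]

theorem ae_summable_sq (hα : 0 < α) {a : ℕ → Ω → ℝ} (ha : ∀ k, AEMeasurable (a k) P) {σ : ℕ → ℝ}
    (hσ0 : ∀ k, 0 ≤ σ k) (hσ : Summable σ)
    (hb : ∀ k c, 0 ≤ c →
      ∫⁻ ω, ENNReal.ofReal (min 1 ((c * a k ω) ^ 2)) ∂P ≤ ENNReal.ofReal (c ^ α * σ k)) :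
    ∀ᵐ ω ∂P, Summable fun k => a k ω ^ 2 := by
  have h1 : P {ω | ∑' k, ENNReal.ofReal (a k ω ^ 2) = ∞} = 0 := by
    have hlim : Tendsto (fun l : ℝ => ENNReal.ofReal (l ^ (-α) * ∑' k, σ k)) atTop (𝓝 0) := by
      rw [← ENNReal.ofReal_zero]
      refine (ENNReal.continuous_ofReal.tendsto 0).comp ?_
      simpa using (tendsto_rpow_neg_atTop hα).mul_const (∑' k, σ k)
    refine le_antisymm (ge_of_tendsto hlim ?_) bot_le
    filter_upwards [eventually_gt_atTop 0] with l hl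
    refine (measure_mono fun ω hω => ?_).trans (measure_le_tsum_sq_le ha hσ0 hσ hb hl)
    change ∑' k, ENNReal.ofReal (a k ω ^ 2) = ∞ at hω
    change ENNReal.ofReal (l ^ 2) ≤ ∑' k, ENNReal.ofReal (a k ω ^ 2)
    rw [hω]
    exact le_top
  have h2 : ∀ᵐ ω ∂P, ∑' k, ENNReal.ofReal (a k ω ^ 2) ≠ ∞ := by
    rw [ae_iff]
    simpa using h1
  filter_upwards [h2] with ω hω
  have := ENNReal.summable_toReal hω
  simpa only [ENNReal.toReal_ofReal (sq_nonneg _)] using this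

/-- A variable with tails of order `l ^ (-α)` has moments of order `p < α`. -/
theorem exists_lintegral_rpow_le [IsProbabilityMeasure P] {p : ℝ} (hp : 0 < p) (hpα : p < α)
    {K : ℝ} (hK : 0 ≤ K) :
    ∃ B : ℝ≥0∞, B ≠ ∞ ∧ ∀ f : Ω → ℝ, AEMeasurable f P → (∀ ω, 0 ≤ f ω) →
      (∀ l, 0 < l → P {ω | l ≤ f ω} ≤ ENNReal.ofReal (l ^ (-α) * K)) →
      ∫⁻ ω, ENNReal.ofReal (f ω ^ p) ∂P ≤ B := by
  refine ⟨ENNReal.ofReal p * ((∫⁻ t in Ioc (0 : ℝ) 1, ENNReal.ofReal (t ^ (p - 1))) +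
    ∫⁻ t in Ioi (1 : ℝ), ENNReal.ofReal (t ^ (-α + p - 1) * K)), ?_, ?_⟩
  · refine ENNReal.mul_ne_top ENNReal.ofReal_ne_top (ENNReal.add_ne_top.2 ⟨?_, ?_⟩)
    · have h1 : IntervalIntegrable (fun t : ℝ => t ^ (p - 1)) volume 0 1 :=
        intervalIntegral.intervalIntegrable_rpow' (by linarith)
      rw [intervalIntegrable_iff_integrableOn_Ioc_of_le zero_le_one] at h1
      exact h1.lintegral_lt_top.ne
    · have h1 : IntegrableOn (fun t : ℝ => t ^ (-α + p - 1) * K) (Ioi 1) :=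
        (integrableOn_Ioi_rpow_of_lt (by linarith) zero_lt_one).mul_const K
      exact h1.lintegral_lt_top.ne
  · intro f hf hf0 hft
    rw [lintegral_rpow_eq_lintegral_meas_le_mul P (ae_of_all _ hf0) hf hp]
    refine mul_le_mul_right ?_ _
    -- Layer-cake formula split at level `1`: the trivial bound on the probability below, and above
    -- it the tail, integrable against `t^{p-1}` because `p < α`.
    rw [← Ioc_union_Ioi_eq_Ioi zero_le_one]
    refine (lintegral_union_le _ _ _).trans (add_le_add ?_ ?_)
    · refine setLIntegral_mono' measurableSet_Ioc fun t _ => ?_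
      exact mul_le_of_le_one_left (by positivity) prob_le_one
    · refine setLIntegral_mono' measurableSet_Ioi fun t ht => ?_
      have ht0 : 0 < t := zero_lt_one.trans ht
      calc _ ≤ ENNReal.ofReal (t ^ (-α) * K) * ENNReal.ofReal (t ^ (p - 1)) := by
            gcongr
            exact hft t ht0
        _ = _ := by
            rw [← ENNReal.ofReal_mul (by positivity)]
            congr 1
            rw [add_sub_assoc, Real.rpow_add ht0]
            ring

end Tail

/-! ### The stochastic convolution in `H` -/

section Noise

variable {H : Type*} [NormedAddCommGroup H] [InnerProductSpace ℝ H] [CompleteSpace H]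
  [MeasurableSpace H] [BorelSpace H] (e : HilbertBasis ℕ ℝ H)
  {β γ : ℕ → ℝ} (hβ_pos : ∀ k, 0 < β k) {α : ℝ} (hα_one : 1 < α)
  (hγ_pos : ∀ k, 0 < γ k) (hγ_sum : Summable (fun k => γ k ^ α / β k))
  {Ω : Type*} [mΩ : MeasurableSpace Ω] {P : Measure Ω} [IsProbabilityMeasure P]
  {Z Ztilde : ℕ → ℝ≥0 → Ω → ℝ}
  (hZ : ∀ k, IsSymmStableProcess P α (Z k))
  (hZtilde : ∀ k, IsSymmStableProcess P α (Ztilde k))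

/-- `z` is the stochastic convolution `∫_s^t e^{(t-r)B} dZ_r` along the path `ω`. -/
def IsStochConv (e : HilbertBasis ℕ ℝ H) (β γ : ℕ → ℝ) (Z : ℕ → ℝ → Ω → ℝ) (s t : ℝ) (ω : Ω)
    (z : H) : Prop :=
  HasSum (fun k => (γ k * expInt (β k) (fun r => Z k r ω) s t) • e k) z

include hZ hZtilde in
omit [IsProbabilityMeasure P] in
theorem measurable_twoSided (k : ℕ) (r : ℝ) : Measurable (twoSided Z Ztilde k r) := by
  unfold twoSided
  split_ifs
  · exact (hZ k).measurable _
  · exact (hZtilde k).measurable _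

include hZ hZtilde in
omit [IsProbabilityMeasure P] in
theorem aemeasurable_expInt (k : ℕ) (b : ℝ) {s t : ℝ} (hst : s ≤ t) :
    AEMeasurable (fun ω => expInt b (fun r => twoSided Z Ztilde k r ω) s t) P := by
  obtain ⟨I, hI, hI2⟩ := exists_measurable_expInt mΩ (X := twoSided Z Ztilde k) hst
    (fun r _ => (measurable_twoSided hZ hZtilde k r).sub (measurable_twoSided hZ hZtilde k s)) b
  refine ⟨fun ω => I t ω, hI.comp (by fun_prop : Measurable fun ω : Ω => (t, ω)), ?_⟩
  filter_upwards [ae_twoSidedRegular hZ hZtilde] with ω hω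
  exact (hI2 ω (hω k) t (right_mem_Icc.2 hst)).symm

-- The scales `60 γ_k^α / β_k` are uniform in `s ≤ t` and summable by assumption; all time-uniform
-- estimates rest on this.
include hβ_pos hα_one hγ_pos hZ hZtilde in
theorem lintegral_noiseCoeff_le {s t : ℝ} (hst : s ≤ t) (k : ℕ) (c : ℝ) (hc : 0 ≤ c) :
    ∫⁻ ω, ENNReal.ofReal
      (min 1 ((c * (γ k * expInt (β k) (fun r => twoSided Z Ztilde k r ω) s t)) ^ 2)) ∂P ≤
      ENNReal.ofReal (c ^ α * (60 * (γ k ^ α / β k))) := by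
  -- For `s > 0` the integral from `s` to `0` runs backwards; the cocycle relation expresses it
  -- through the integral from `0` to `s`.
  have hm : AEMeasurable (fun ω => expInt (β k) (fun r => twoSided Z Ztilde k r ω) s 0) P := by
    rcases le_total s 0 with h | h
    · exact aemeasurable_expInt hZ hZtilde k _ h
    · have h1 := aemeasurable_expInt hZ hZtilde k (β k) (P := P) h
      have h2 : AEMeasurable (fun ω => -(Real.exp (-β k * (0 - s)) *
          expInt (β k) (fun r => twoSided Z Ztilde k r ω) 0 s)) P := (h1.const_mul _).neg
      refine h2.congr ?_
      filter_upwards [ae_twoSidedRegular hZ hZtilde] with ω hω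
      have h3 := expInt_add (b := β k) ((hω k).intervalIntegrable 0 s)
        ((hω k).intervalIntegrable s 0)
      have h4 : expInt (β k) (fun r => twoSided Z Ztilde k r ω) 0 0 = 0 := by simp [expInt_eq]
      rw [h4] at h3
      linarith
  have h := lintegral_expInt_le hα_one.le hZ hZtilde k (hβ_pos k) hst (c := c * γ k)
    (mul_nonneg hc (hγ_pos k).le) hm
  simp_rw [← mul_assoc c]
  refine h.trans (le_of_eq ?_)
  rw [Real.mul_rpow hc (hγ_pos k).le]
  congr 1
  ring

include hβ_pos hα_one hγ_pos hγ_sum hZ hZtilde in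
theorem ae_summable_noiseCoeff {s t : ℝ} (hst : s ≤ t) :
    ∀ᵐ ω ∂P, Summable fun k =>
      (γ k * expInt (β k) (fun r => twoSided Z Ztilde k r ω) s t) ^ 2 :=
  ae_summable_sq (α := α) (by linarith)
    (fun k => (aemeasurable_expInt hZ hZtilde k _ hst).const_mul _)
    (fun k => by have := hγ_pos k; have := hβ_pos k; positivity) (hγ_sum.mul_left 60)
    (lintegral_noiseCoeff_le hβ_pos hα_one hγ_pos hZ hZtilde hst)

include hβ_pos hα_one hγ_pos hγ_sum hZ hZtilde in
omit [CompleteSpace H] in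
/-- The stochastic convolution has moments of order `p < α`, uniformly in time. -/
theorem exists_lintegral_stochConv_le {p : ℝ} (hp : 0 < p) (hpα : p < α) :
    ∃ B : ℝ≥0∞, B ≠ ∞ ∧ ∀ s t, s ≤ t → ∀ z : Ω → H, AEMeasurable z P →
      (∀ᵐ ω ∂P, IsStochConv e β γ (twoSided Z Ztilde) s t ω (z ω)) →
      ∫⁻ ω, ‖z ω‖ₑ ^ p ∂P ≤ B := by
  have hσ0 : ∀ k, 0 ≤ 60 * (γ k ^ α / β k) := fun k => by
    have := hγ_pos k; have := hβ_pos k; positivity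
  obtain ⟨B, hB, h⟩ := exists_lintegral_rpow_le (P := P) hp hpα
    (K := ∑' k, 60 * (γ k ^ α / β k)) (tsum_nonneg hσ0)
  refine ⟨B, hB, fun s t hst z hz hsum => ?_⟩
  have h1 : ∀ ω, ‖z ω‖ₑ ^ p = ENNReal.ofReal (‖z ω‖ ^ p) := fun ω => by
    rw [← ofReal_norm, ENNReal.ofReal_rpow_of_nonneg (norm_nonneg _) hp.le]
  simp_rw [h1]
  refine h _ hz.norm (fun ω => norm_nonneg _) fun l hl => ?_
  refine (measure_mono_ae ?_).trans (measure_le_tsum_sq_le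
    (fun k => (aemeasurable_expInt hZ hZtilde k (β k) hst).const_mul (γ k)) hσ0
    (hγ_sum.mul_left 60) (lintegral_noiseCoeff_le hβ_pos hα_one hγ_pos hZ hZtilde hst) hl)
  filter_upwards [hsum] with ω hω hl2
  have h2 := e.hasSum_norm_sq_of_hasSum hω
  change ENNReal.ofReal (l ^ 2) ≤ ∑' k, _
  rw [← ENNReal.ofReal_tsum_of_nonneg (fun k => sq_nonneg _) h2.summable, h2.tsum_eq]
  refine ENNReal.ofReal_le_ofReal ?_
  have h3 : l ≤ ‖z ω‖ := hl2
  gcongr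

omit mΩ in
theorem measurable_tsum_smul_basis [MeasurableSpace Ω] {I : ℕ → ℝ → Ω → ℝ}
    (hI : ∀ k, Measurable (Function.uncurry (I k))) :
    Measurable (Function.uncurry fun t ω => ∑' k, (γ k * I k t ω) • e k) := by
  have hsc := e.secondCountableTopology
  refine StronglyMeasurable.measurable (StronglyMeasurable.tsum fun k => ?_)
  exact (((hI k).const_mul (γ k)).smul_const (e k)).stronglyMeasurable

include hβ_pos hα_one hγ_pos hγ_sum hZ hZtilde in
omit [MeasurableSpace H] [BorelSpace H] in
theorem ae_isStochConv_tsum {X : ℕ → ℝ → Ω → ℝ}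
    (hXZ : ∀ᵐ ω ∂P, ∀ k r, X k r ω = twoSided Z Ztilde k r ω) {a T : ℝ} {I : ℕ → ℝ → Ω → ℝ}
    (hI : ∀ k ω, TwoSidedRegular (fun r => X k r ω) → ∀ t ∈ Icc a T,
      I k t ω = expInt (β k) (fun r => X k r ω) a t) {t : ℝ} (ht : t ∈ Icc a T) :
    ∀ᵐ ω ∂P, IsStochConv e β γ (twoSided Z Ztilde) a t ω (∑' k, (γ k * I k t ω) • e k) := by
  filter_upwards [hXZ, ae_twoSidedRegular hZ hZtilde,
    ae_summable_noiseCoeff hβ_pos hα_one hγ_pos hγ_sum hZ hZtilde ht.1] with ω h1 h2 h3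
  have h4 : ∀ k, I k t ω = expInt (β k) (fun r => twoSided Z Ztilde k r ω) a t := by
    intro k
    have h5 : (fun r => X k r ω) = fun r => twoSided Z Ztilde k r ω := funext fun r => h1 k r
    rw [hI k ω (by rw [h5]; exact h2 k) t ht, h5]
  simp only [h4]
  exact (e.summable_smul_of_summable_sq h3).hasSum

include hβ_pos hα_one hγ_pos hγ_sum hZ hZtilde in
/-- The stochastic convolutions started at time `a` have a version which is jointly measurable with
respect to a σ-algebra `m` that contains the increments of a version `X` of the noise. -/
theorem exists_measurable_stochConv (m : MeasurableSpace Ω) {X : ℕ → ℝ → Ω → ℝ}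
    (hXZ : ∀ᵐ ω ∂P, ∀ k r, X k r ω = twoSided Z Ztilde k r ω) {a T : ℝ} (haT : a ≤ T)
    (hX : ∀ k, ∀ r ∈ Icc a T, Measurable[m] fun ω => X k r ω - X k a ω) :
    ∃ W : ℝ → Ω → H, @Measurable (ℝ × Ω) H (@Prod.instMeasurableSpace ℝ Ω _ m) _
        (Function.uncurry W) ∧
      ∀ t ∈ Icc a T, ∀ᵐ ω ∂P, IsStochConv e β γ (twoSided Z Ztilde) a t ω (W t ω) := by
  choose I hI hI2 using fun k => exists_measurable_expInt m haT (hX k) (β k)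
  exact ⟨fun t ω => ∑' k, (γ k * I k t ω) • e k, measurable_tsum_smul_basis e hI, fun t ht =>
    ae_isStochConv_tsum (mΩ := mΩ) e hβ_pos hα_one hγ_pos hγ_sum hZ hZtilde hXZ hI2 ht⟩

end Noise

/-! ### Independence of past and future noise -/

section PastFuture

variable {Ω : Type*} [mΩ : MeasurableSpace Ω] {P : Measure Ω}

/-- The increments of `X` before (`true`) or after (`false`) time `τ`. -/
def splitAt (X : ℝ≥0 → Ω → ℝ) (τ : ℝ≥0) : Bool → Ω → ℝ≥0 → ℝ
  | true => fun ω r => X (min r τ) ω - X 0 ω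
  | false => fun ω r => X (max r τ) ω - X τ ω

theorem measurable_splitAt {X : ℝ≥0 → Ω → ℝ} (hX : ∀ t, Measurable (X t)) (τ : ℝ≥0) (b : Bool) :
    Measurable (splitAt X τ b) := by
  cases b
  · exact measurable_pi_lambda _ fun r => (hX _).sub (hX _)
  · exact measurable_pi_lambda _ fun r => (hX _).sub (hX _)

/-- The ordered enumeration, continued by its last value, so that independence of increments along a
monotone sequence becomes applicable. -/
theorem Finset.exists_monotone_enum {ι : Type*} [LinearOrder ι] [OrderBot ι] (F : Finset ι) :
    ∃ (N : ℕ) (t : ℕ → ι), Monotone t ∧ ∀ r ∈ F, ∃ i < N, t i = r := by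
  rcases F.eq_empty_or_nonempty with rfl | hF
  · exact ⟨0, fun _ => ⊥, monotone_const, by simp⟩
  have hn : 0 < F.card := F.card_pos.2 hF
  refine ⟨F.card, fun i => F.orderEmbOfFin rfl ⟨min i (F.card - 1), by omega⟩, ?_, ?_⟩
  · intro i j hij
    exact (F.orderEmbOfFin rfl).monotone (by simp only [Fin.mk_le_mk]; omega)
  · intro r hr
    have h1 : r ∈ Set.range (F.orderEmbOfFin rfl) := by
      rw [Finset.range_orderEmbOfFin]
      exact hr
    obtain ⟨i, hi⟩ := h1
    refine ⟨i, i.2, ?_⟩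
    have h2 : (⟨min (i : ℕ) (F.card - 1), by omega⟩ : Fin F.card) = i :=
      Fin.ext (min_eq_left (Nat.le_sub_one_of_lt i.2))
    rw [← hi]
    exact congrArg (F.orderEmbOfFin rfl) h2

/-- Finitely many values of each half are sums of increments along one monotone sequence of times;
those with index below that of `τ` give the past, the others the future, and disjoint blocks of
increments are independent. -/
theorem indepFun_splitAt [IsProbabilityMeasure P] {X : ℝ≥0 → Ω → ℝ} (hX : ∀ t, Measurable (X t))
    (hind : HasIndepIncrements X P) (τ : ℝ≥0) :
    IndepFun (splitAt X τ true) (splitAt X τ false) P := by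
  classical
  refine IndepFun.process_indepFun_process (fun r => (hX _).sub (hX _))
    (fun r => (hX _).sub (hX _)) fun I J => ?_
  -- Including `0` and `τ` makes the past sums telescope from `0` and the future ones from `τ`.
  obtain ⟨N, t, ht, hF⟩ := Finset.exists_monotone_enum
    (insert 0 (insert τ (I.image (fun r => min r τ) ∪ J.image fun r => max r τ)))
  obtain ⟨i0, -, hi0⟩ := hF 0 (by simp)
  obtain ⟨m, hmN, hm⟩ := hF τ (by simp)
  have ht0 : t 0 = 0 := le_antisymm (hi0 ▸ ht (Nat.zero_le _)) zero_le
  -- An index found beyond `m` can only carry the value `τ`, so `m` itself serves.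
  have hI : ∀ r : I, ∃ i ≤ m, t i = min (r : ℝ≥0) τ := by
    intro r
    obtain ⟨i, -, hi⟩ := hF (min (r : ℝ≥0) τ) (by
      simp only [Finset.mem_insert, Finset.mem_union, Finset.mem_image]
      exact Or.inr (Or.inr (Or.inl ⟨r, r.2, rfl⟩)))
    rcases le_total i m with h | h
    · exact ⟨i, h, hi⟩
    · refine ⟨m, le_rfl, ?_⟩
      have h1 := ht h
      rw [hi, hm] at h1
      rw [hm]
      exact le_antisymm h1 (min_le_right _ _)
  have hJ : ∀ r : J, ∃ i, m ≤ i ∧ i < N ∧ t i = max (r : ℝ≥0) τ := by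
    intro r
    obtain ⟨i, hiN, hi⟩ := hF (max (r : ℝ≥0) τ) (by
      simp only [Finset.mem_insert, Finset.mem_union, Finset.mem_image]
      exact Or.inr (Or.inr (Or.inr ⟨r, r.2, rfl⟩)))
    rcases le_total m i with h | h
    · exact ⟨i, h, hiN, hi⟩
    · refine ⟨m, le_rfl, hmN, ?_⟩
      have h1 := ht h
      rw [hi, hm] at h1
      rw [hm]
      exact le_antisymm (le_max_right _ _) h1
  choose iI hIm hIt using hI
  choose iJ hJm hJN hJt using hJ
  set D : ℕ → Ω → ℝ := fun i ω => X (t (i + 1)) ω - X (t i) ω with hD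
  have hDi : iIndepFun D P := hind.nat ht
  have hdis : Disjoint (Finset.range m) (Finset.Ico m N) := by
    rw [Finset.disjoint_left]
    intro i hi hi'
    rw [Finset.mem_range] at hi
    rw [Finset.mem_Ico] at hi'
    omega
  have hfin := hDi.indepFun_finset _ _ hdis fun i => (hX _).sub (hX _)
  have hcomp := hfin.comp
    (φ := fun (v : Finset.range m → ℝ) (r : I) =>
      ∑ j ∈ (Finset.range m).attach, if (j : ℕ) < iI r then v j else 0)
    (ψ := fun (v : Finset.Ico m N → ℝ) (r : J) =>
      ∑ j ∈ (Finset.Ico m N).attach, if (j : ℕ) < iJ r then v j else 0)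
    (measurable_pi_lambda _ fun r => Finset.measurable_sum _ fun j _ => by
      split_ifs <;> fun_prop)
    (measurable_pi_lambda _ fun r => Finset.measurable_sum _ fun j _ => by
      split_ifs <;> fun_prop)
  refine hcomp.congr (ae_of_all _ fun ω => ?_) (ae_of_all _ fun ω => ?_)
  · funext r
    simp only [Function.comp, splitAt]
    rw [Finset.sum_attach (Finset.range m) (fun j => if j < iI r then D j ω else 0),
      ← Finset.sum_filter, ← hIt r, ← ht0, ← Finset.sum_range_sub (fun i => X (t i) ω)]
    refine Finset.sum_congr ?_ fun _ _ => rfl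
    ext j
    have := hIm r
    simp only [Finset.mem_filter, Finset.mem_range]
    omega
  · funext r
    simp only [Function.comp, splitAt]
    rw [Finset.sum_attach (Finset.Ico m N) (fun j => if j < iJ r then D j ω else 0),
      ← Finset.sum_filter, ← hJt r, ← hm, ← Finset.sum_Ico_sub (fun i => X (t i) ω) (hJm r)]
    refine Finset.sum_congr ?_ fun _ _ => rfl
    ext j
    have := hJN r
    simp only [Finset.mem_filter, Finset.mem_Ico]
    omega

theorem ProbabilityTheory.IndepFun.iIndepFun_bool [IsProbabilityMeasure P] {E : Type*}
    [MeasurableSpace E] {f : Bool → Ω → E} (h : IndepFun (f true) (f false) P) :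
    iIndepFun f P := by
  rw [iIndepFun_iff]
  intro s f' hf'
  have hs : s = ∅ ∨ s = {true} ∨ s = {false} ∨ s = {true, false} := by
    clear hf'
    revert s
    decide
  rcases hs with rfl | rfl | rfl | rfl
  · simp
  · simp
  · simp
  · have h1 := hf' true (by simp)
    have h2 := hf' false (by simp)
    obtain ⟨A, hA, hA'⟩ := h1
    obtain ⟨B, hB, hB'⟩ := h2
    rw [Finset.prod_insert (by simp), Finset.prod_singleton, ← hA', ← hB',
      ← h.measure_inter_preimage_eq_mul A B hA hB, hA', hB']
    congr 1
    ext ω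
    simp [and_comm]

variable (Z Ztilde : ℕ → ℝ≥0 → Ω → ℝ)

/-- The increments of the coordinate processes of the two-sided noise, before and after the time
that corresponds to `s`. -/
def noiseSplit (s : ℝ) (p : (ℕ ⊕ ℕ) × Bool) : Ω → ℝ≥0 → ℝ :=
  splitAt (Sum.elim Z Ztilde p.1) (Sum.elim (fun _ => s.toNNReal) (fun _ => (-s).toNNReal) p.1) p.2

/-- The σ-algebra of the increments of the two-sided noise before time `s`. -/
@[reducible] def noisePast (s : ℝ) : MeasurableSpace Ω :=
  ⨆ p ∈ {p : (ℕ ⊕ ℕ) × Bool | p.1.isLeft = p.2},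
    MeasurableSpace.comap (noiseSplit Z Ztilde s p) inferInstance

/-- The σ-algebra of the increments of the two-sided noise after time `s`. -/
@[reducible] def noiseFuture (s : ℝ) : MeasurableSpace Ω :=
  ⨆ p ∈ {p : (ℕ ⊕ ℕ) × Bool | p.1.isLeft = p.2}ᶜ,
    MeasurableSpace.comap (noiseSplit Z Ztilde s p) inferInstance

variable {Z Ztilde} {α : ℝ}

theorem measurable_noiseSplit (hZ : ∀ k, IsSymmStableProcess P α (Z k))
    (hZtilde : ∀ k, IsSymmStableProcess P α (Ztilde k)) (s : ℝ) (p : (ℕ ⊕ ℕ) × Bool) :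
    Measurable (noiseSplit Z Ztilde s p) := by
  rcases p with ⟨k | k, b⟩
  · exact measurable_splitAt (hZ k).measurable _ b
  · exact measurable_splitAt (hZtilde k).measurable _ b

theorem noisePast_le (hZ : ∀ k, IsSymmStableProcess P α (Z k))
    (hZtilde : ∀ k, IsSymmStableProcess P α (Ztilde k)) (s : ℝ) : noisePast Z Ztilde s ≤ mΩ :=
  iSup₂_le fun p _ => (measurable_noiseSplit hZ hZtilde s p).comap_le

theorem noiseFuture_le (hZ : ∀ k, IsSymmStableProcess P α (Z k))
    (hZtilde : ∀ k, IsSymmStableProcess P α (Ztilde k)) (s : ℝ) : noiseFuture Z Ztilde s ≤ mΩ :=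
  iSup₂_le fun p _ => (measurable_noiseSplit hZ hZtilde s p).comap_le

/-- All halves of all coordinate processes are jointly independent, and past and future use disjoint
sets of halves. Time runs backwards on `Ztilde`, so its early half belongs to the future and its
late half to the past, which is the condition `p.1.isLeft = p.2`. Truncation to nonnegative times
makes one split trivial on each side of the origin. -/
theorem indep_noisePast_noiseFuture [IsProbabilityMeasure P]
    (hZ : ∀ k, IsSymmStableProcess P α (Z k))
    (hZtilde : ∀ k, IsSymmStableProcess P α (Ztilde k))
    (hindep : iIndepFun (fun (i : ℕ ⊕ ℕ) (ω : Ω) (t : ℝ≥0) => Sum.elim Z Ztilde i t ω) P) (s : ℝ) :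
    Indep (noisePast Z Ztilde s) (noiseFuture Z Ztilde s) P := by
  refine indep_iSup_of_disjoint (fun p => (measurable_noiseSplit hZ hZtilde s p).comap_le) ?_
    disjoint_compl_right
  refine iIndepFun.iIndep ?_
  refine iIndepFun_uncurry' (X := fun i b => noiseSplit Z Ztilde s (i, b))
    (fun i b => measurable_noiseSplit hZ hZtilde s (i, b)) ?_ fun i => ?_
  · refine (hindep.comp (fun i (x : ℝ≥0 → ℝ) (b : Bool) =>
      splitAt (fun t (y : ℝ≥0 → ℝ) => y t)
        (Sum.elim (fun _ => s.toNNReal) (fun _ => (-s).toNNReal) i) b x) fun i =>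
      measurable_pi_lambda _ fun b => measurable_splitAt (fun t => measurable_pi_apply t) _ b).congr
      fun i => ae_of_all _ fun ω => ?_
    funext b r
    cases b <;> rfl
  · refine IndepFun.iIndepFun_bool ?_
    rcases i with k | k
    · exact indepFun_splitAt (hZ k).measurable (hZ k).indep_increments _
    · exact indepFun_splitAt (hZtilde k).measurable (hZtilde k).indep_increments _

omit mΩ in
theorem measurable_noisePast_apply (s : ℝ) {p : (ℕ ⊕ ℕ) × Bool} (hp : p.1.isLeft = p.2)
    (r : ℝ≥0) : Measurable[noisePast Z Ztilde s] fun ω => noiseSplit Z Ztilde s p ω r := by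
  have h1 : Measurable[noisePast Z Ztilde s] (noiseSplit Z Ztilde s p) := by
    rw [measurable_iff_comap_le]
    exact le_iSup₂_of_le (f := fun (p : (ℕ ⊕ ℕ) × Bool)
      (_ : p ∈ {p : (ℕ ⊕ ℕ) × Bool | p.1.isLeft = p.2}) =>
      MeasurableSpace.comap (noiseSplit Z Ztilde s p) inferInstance) p hp le_rfl
  exact (measurable_pi_apply r).comp h1

omit mΩ in
theorem measurable_noiseFuture_apply (s : ℝ) {p : (ℕ ⊕ ℕ) × Bool} (hp : p.1.isLeft ≠ p.2)
    (r : ℝ≥0) : Measurable[noiseFuture Z Ztilde s] fun ω => noiseSplit Z Ztilde s p ω r := by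
  have h1 : Measurable[noiseFuture Z Ztilde s] (noiseSplit Z Ztilde s p) := by
    rw [measurable_iff_comap_le]
    exact le_iSup₂_of_le (f := fun (p : (ℕ ⊕ ℕ) × Bool)
      (_ : p ∈ {p : (ℕ ⊕ ℕ) × Bool | p.1.isLeft = p.2}ᶜ) =>
      MeasurableSpace.comap (noiseSplit Z Ztilde s p) inferInstance) p hp le_rfl
  exact (measurable_pi_apply r).comp h1

/-- The two-sided noise, made to vanish at time `0` everywhere. -/
noncomputable def centeredNoise (Z Ztilde : ℕ → ℝ≥0 → Ω → ℝ) : ℕ → ℝ → Ω → ℝ :=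
  twoSided (fun k t ω => Z k t ω - Z k 0 ω) (fun k t ω => Ztilde k t ω - Ztilde k 0 ω)

theorem ae_centeredNoise_eq (hZ : ∀ k, IsSymmStableProcess P α (Z k))
    (hZtilde : ∀ k, IsSymmStableProcess P α (Ztilde k)) :
    ∀ᵐ ω ∂P, ∀ k r, centeredNoise Z Ztilde k r ω = twoSided Z Ztilde k r ω := by
  rw [ae_all_iff]
  intro k
  filter_upwards [(hZ k).start_zero, (hZtilde k).start_zero] with ω h1 h2 r
  simp [centeredNoise, twoSided, h1, h2]

-- An increment across the origin combines both processes. Centering makes it an exact combination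
-- of their increments; otherwise the values at `0`, which vanish only almost surely, would remain.
omit mΩ in
theorem measurable_centeredNoise_sub_of_le (k : ℕ) {r s : ℝ} (hrs : r ≤ s) :
    Measurable[noisePast Z Ztilde s] fun ω =>
      centeredNoise Z Ztilde k r ω - centeredNoise Z Ztilde k s ω := by
  have hA := fun q => measurable_noisePast_apply (Z := Z) (Ztilde := Ztilde) s
    (p := (Sum.inl k, true)) rfl q
  have hB := fun q => measurable_noisePast_apply (Z := Z) (Ztilde := Ztilde) s
    (p := (Sum.inr k, false)) rfl q
  rcases le_or_gt 0 s with hs | hs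
  · rcases le_or_gt 0 r with hr | hr
    · convert! (hA r.toNNReal).sub (hA s.toNNReal) using 2 with ω
      simp [noiseSplit, splitAt, centeredNoise, twoSided, hs, hr, Real.toNNReal_le_toNNReal hrs]
    · convert! (hB (-r).toNNReal).sub (hA s.toNNReal) using 2 with ω
      have : (-s).toNNReal = 0 := Real.toNNReal_of_nonpos (by linarith)
      simp [noiseSplit, splitAt, centeredNoise, twoSided, hs, hr.not_ge, this]
  · have hr : r < 0 := hrs.trans_lt hs
    convert! hB (-r).toNNReal using 2 with ω
    simp [noiseSplit, splitAt, centeredNoise, twoSided, hs.not_ge, hr.not_ge,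
      Real.toNNReal_le_toNNReal (neg_le_neg hrs)]

omit mΩ in
theorem measurable_centeredNoise_sub_of_ge (k : ℕ) {r s : ℝ} (hsr : s ≤ r) :
    Measurable[noiseFuture Z Ztilde s] fun ω =>
      centeredNoise Z Ztilde k r ω - centeredNoise Z Ztilde k s ω := by
  have hB := fun q => measurable_noiseFuture_apply (Z := Z) (Ztilde := Ztilde) s
    (p := (Sum.inl k, false)) (by simp) q
  have hA := fun q => measurable_noiseFuture_apply (Z := Z) (Ztilde := Ztilde) s
    (p := (Sum.inr k, true)) (by simp) q
  rcases le_or_gt 0 s with hs | hs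
  · have hr : 0 ≤ r := hs.trans hsr
    convert! hB r.toNNReal using 2 with ω
    simp [noiseSplit, splitAt, centeredNoise, twoSided, hs, hr, Real.toNNReal_le_toNNReal hsr]
  · rcases le_or_gt 0 r with hr | hr
    · convert! (hB r.toNNReal).sub (hA (-s).toNNReal) using 2 with ω
      have : s.toNNReal = 0 := Real.toNNReal_of_nonpos hs.le
      simp [noiseSplit, splitAt, centeredNoise, twoSided, hs.not_ge, hr, this]
    · convert! (hA (-r).toNNReal).sub (hA (-s).toNNReal) using 2 with ω
      simp [noiseSplit, splitAt, centeredNoise, twoSided, hs.not_ge, hr.not_ge,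
        Real.toNNReal_le_toNNReal (neg_le_neg hsr)]

end PastFuture

/-! ### Mild solutions: restart and exponential contraction -/

section Mild

variable {H : Type*} [NormedAddCommGroup H] [InnerProductSpace ℝ H]
  [MeasurableSpace H] {Ω : Type*} [mΩ : MeasurableSpace Ω]

/-- A mild solution on `[s, T]` with random initial value `ξ`, drift `F` and noise `Z`. -/
structure IsMildFrom (P : Measure Ω) (e : HilbertBasis ℕ ℝ H) (β γ : ℕ → ℝ) (F : ℝ → H → H)
    (Z : ℕ → ℝ → Ω → ℝ) (s T : ℝ) (ξ : Ω → H) (Y : ℝ → Ω → H) : Prop where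
  measurable : Measurable (Function.uncurry Y)
  integrable : ∀ t ∈ Icc s T, ∀ᵐ ω ∂P, IntervalIntegrable (fun r => F r (Y r ω)) volume s t
  mild : ∀ t ∈ Icc s T, ∀ᵐ ω ∂P, ∃ z : H, IsStochConv e β γ Z s t ω z ∧
    Y t ω = expB e β (t - s) (ξ ω) + (∫ r in s..t, expB e β (t - r) (F r (Y r ω))) + z

/-- Freezing the process before time `s` extends it to a jointly measurable process on the whole
line, without changing it on `[s, T]`. -/
theorem FrozenSPDE.IsMildSolution.isMildFrom {P : Measure Ω} {e : HilbertBasis ℕ ℝ H}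
    {β γ : ℕ → ℝ} {G : ℝ → H → H → H} {Z : ℕ → ℝ → Ω → ℝ} {s : ℝ} {x y : H} {Y : ℝ → Ω → H}
    (hY : IsMildSolution P e β γ G Z s x y Y) (T : ℝ) :
    IsMildFrom P e β γ (fun r => G r x) Z s T (fun _ => y) (fun r => Y (max s r)) := by
  have hcongr : ∀ t, s ≤ t → ∀ ω, ∀ r ∈ uIcc s t, Y (max s r) ω = Y r ω := by
    intro t ht ω r hr
    rw [uIcc_of_le ht] at hr
    rw [max_eq_right hr.1]
  refine ⟨?_, fun t ht => ?_, fun t ht => ?_⟩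
  · have h1 : Measurable fun p : ℝ × Ω => ((⟨max s p.1, mem_Ici.2 (le_max_left s p.1)⟩ : Ici s), p.2) :=
      Measurable.prodMk (Measurable.subtype_mk (by fun_prop)) measurable_snd
    exact hY.measurable.comp h1
  · filter_upwards [hY.integrable t ht.1] with ω hω
    refine hω.congr fun r hr => ?_
    simp only [hcongr t ht.1 ω r (uIoc_subset_uIcc hr)]
  · filter_upwards [hY.mild t ht.1] with ω hω
    obtain ⟨z, hz, hzY⟩ := hω
    refine ⟨z, hz, ?_⟩
    simp only [max_eq_right ht.1]
    rw [hzY]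
    congr 2
    refine intervalIntegral.integral_congr fun r hr => ?_
    simp only [hcongr t ht.1 ω r hr]

theorem IsMildFrom.measurable_apply {P : Measure Ω} {e : HilbertBasis ℕ ℝ H}
    {β γ : ℕ → ℝ} {F : ℝ → H → H} {Z : ℕ → ℝ → Ω → ℝ} {s T : ℝ} {ξ : Ω → H} {Y : ℝ → Ω → H}
    (hY : IsMildFrom P e β γ F Z s T ξ Y) (t : ℝ) : Measurable (Y t) :=
  hY.measurable.comp (by fun_prop : Measurable fun ω : Ω => (t, ω))

variable [CompleteSpace H] [BorelSpace H] {e : HilbertBasis ℕ ℝ H}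
  {β γ : ℕ → ℝ} (hβ_pos : ∀ k, 0 < β k) (hβ_mono : Monotone β)
  {F : ℝ → H → H} (hF : Measurable (Function.uncurry F)) {A L : ℝ}
  (hF_lip : ∀ t y₁ y₂, ‖F t y₁ - F t y₂‖ ≤ L * ‖y₁ - y₂‖)
  (hF_growth : ∀ t y, ‖F t y‖ ≤ A + L * ‖y‖)
  (hL : 0 ≤ L) (hLb : L < β 0)
  {P : Measure Ω} [IsProbabilityMeasure P] {Z : ℕ → ℝ → Ω → ℝ}
  (hZreg : ∀ᵐ ω ∂P, ∀ k, TwoSidedRegular fun r => Z k r ω)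

-- The cocycle relation for each coordinate, together with the diagonal action of `e^{(t-s)B}`;
-- subtracting two convergent series settles convergence of the restarted one.
omit [MeasurableSpace H] [BorelSpace H] mΩ in
include hβ_pos hβ_mono in
theorem IsStochConv.restart {u s t : ℝ} (hst : s ≤ t) {ω : Ω}
    (hreg : ∀ k, TwoSidedRegular fun r => Z k r ω) {z₁ z₂ : H}
    (h₁ : IsStochConv e β γ Z u t ω z₁) (h₂ : IsStochConv e β γ Z u s ω z₂) :
    IsStochConv e β γ Z s t ω (z₁ - expB e β (t - s) z₂) := by
  have h3 := h₂.mapL (expBCLM e hβ_pos hβ_mono (sub_nonneg.2 hst))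
  rw [expBCLM_apply] at h3
  have h4 := HasSum.sub h₁ h3
  have h5 : (fun k => (γ k * expInt (β k) (fun r => Z k r ω) s t) • e k) = fun k =>
      (γ k * expInt (β k) (fun r => Z k r ω) u t) • e k -
        expBCLM e hβ_pos hβ_mono (sub_nonneg.2 hst)
          ((γ k * expInt (β k) (fun r => Z k r ω) u s) • e k) := by
    funext k
    rw [map_smul, expBCLM_apply, expB_basis e hβ_pos (sub_nonneg.2 hst), smul_smul, ← sub_smul,
      expInt_add ((hreg k).intervalIntegrable u s) ((hreg k).intervalIntegrable s t)]
    congr 1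
    ring
  rw [IsStochConv, h5]
  exact h4

omit [IsProbabilityMeasure P] in
include hβ_pos hβ_mono hZreg in
/-- A mild solution restarted at a later time. -/
theorem IsMildFrom.restart {u s T : ℝ} (hus : u ≤ s) {ξ : Ω → H} {Y : ℝ → Ω → H}
    (hY : IsMildFrom P e β γ F Z u T ξ Y) : IsMildFrom P e β γ F Z s T (Y s) Y := by
  refine ⟨hY.measurable, fun t ht => ?_, fun t ht => ?_⟩
  · filter_upwards [hY.integrable t ⟨hus.trans ht.1, ht.2⟩] with ω hω
    exact hω.mono_set (by
      rw [uIcc_of_le ht.1, uIcc_of_le (hus.trans ht.1)]; exact Icc_subset_Icc_left hus)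
  · filter_upwards [hY.mild t ⟨hus.trans ht.1, ht.2⟩, hY.mild s ⟨hus, ht.1.trans ht.2⟩, hZreg,
      hY.integrable t ⟨hus.trans ht.1, ht.2⟩] with ω h1 h2 hreg hint
    obtain ⟨z₁, hz₁, hY₁⟩ := h1
    obtain ⟨z₂, hz₂, hY₂⟩ := h2
    refine ⟨_, hz₁.restart hβ_pos hβ_mono ht.1 hreg hz₂, ?_⟩
    have hint1 : IntervalIntegrable (fun r => F r (Y r ω)) volume u s := hint.mono_set (by
      rw [uIcc_of_le hus, uIcc_of_le (hus.trans ht.1)]; exact Icc_subset_Icc_right ht.1)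
    have hint2 : IntervalIntegrable (fun r => F r (Y r ω)) volume s t := hint.mono_set (by
      rw [uIcc_of_le ht.1, uIcc_of_le (hus.trans ht.1)]; exact Icc_subset_Icc_left hus)
    have hts : 0 ≤ t - s := sub_nonneg.2 ht.1
    rw [hY₁, hY₂, expB_add_apply e hβ_pos hts, expB_add_apply e hβ_pos hts,
      expB_comp e hβ_pos (sub_nonneg.2 hus) hts, expB_integral e hβ_pos hβ_mono hus ht.1 hint1,
      ← intervalIntegral.integral_add_adjacent_intervals
        (intervalIntegrable_expB e hβ_pos hβ_mono hus ht.1 hint1)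
        (intervalIntegrable_expB e hβ_pos hβ_mono ht.1 le_rfl hint2), sub_add_sub_cancel]
    abel

omit [CompleteSpace H] [BorelSpace H] [IsProbabilityMeasure P] in
theorem IsMildFrom.initial_eq {s T : ℝ} (hsT : s ≤ T) {ξ : Ω → H} {Y : ℝ → Ω → H}
    (hY : IsMildFrom P e β γ F Z s T ξ Y) : Y s =ᵐ[P] ξ := by
  filter_upwards [hY.mild s ⟨le_rfl, hsT⟩] with ω hω
  obtain ⟨z, hz, h⟩ := hω
  have hz0 : z = 0 := by
    refine hz.unique ?_
    have : (fun k => (γ k * expInt (β k) (fun r => Z k r ω) s s) • e k) = fun _ => 0 := by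
      funext k
      simp [expInt_eq]
    rw [this]
    exact hasSum_zero
  rw [h, hz0, sub_self, expB_zero_apply, intervalIntegral.integral_same, add_zero, add_zero]

include hβ_pos hβ_mono hF_lip hL in
theorem enorm_integral_expB_sub_le {s t : ℝ} (hst : s ≤ t) {u v : ℝ → H}
    (hu : IntervalIntegrable (fun r => F r (u r)) volume s t)
    (hv : IntervalIntegrable (fun r => F r (v r)) volume s t) :
    ‖(∫ r in s..t, expB e β (t - r) (F r (u r))) - ∫ r in s..t, expB e β (t - r) (F r (v r))‖ₑ ≤
      ∫⁻ r in Ioc s t, ENNReal.ofReal (L * Real.exp (-β 0 * (t - r))) * ‖u r - v r‖ₑ := by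
  rw [← intervalIntegral.integral_sub (intervalIntegrable_expB e hβ_pos hβ_mono hst le_rfl hu)
    (intervalIntegrable_expB e hβ_pos hβ_mono hst le_rfl hv),
    intervalIntegral.integral_of_le hst]
  refine (enorm_integral_le_lintegral_enorm _).trans
    (setLIntegral_mono' measurableSet_Ioc fun r hr => ?_)
  have htr : 0 ≤ t - r := sub_nonneg.2 hr.2
  rw [← expB_sub_apply e hβ_pos hβ_mono htr, ← ofReal_norm, ← ofReal_norm,
    ← ENNReal.ofReal_mul (by positivity)]
  refine ENNReal.ofReal_le_ofReal ((norm_expB_le e hβ_pos hβ_mono htr _).trans ?_)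
  rw [mul_comm L, mul_assoc]
  gcongr
  exact hF_lip _ _ _

include hβ_pos hβ_mono in
omit [MeasurableSpace H] [BorelSpace H] in
theorem enorm_integral_expB_le {s t : ℝ} (hst : s ≤ t) (g : ℝ → H) :
    ‖∫ r in s..t, expB e β (t - r) (g r)‖ₑ ≤
      ∫⁻ r in Ioc s t, ENNReal.ofReal (Real.exp (-β 0 * (t - r))) * ‖g r‖ₑ := by
  rw [intervalIntegral.integral_of_le hst]
  refine (enorm_integral_le_lintegral_enorm _).trans
    (setLIntegral_mono' measurableSet_Ioc fun r hr => ?_)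
  rw [← ofReal_norm, ← ofReal_norm, ← ENNReal.ofReal_mul (by positivity)]
  exact ENNReal.ofReal_le_ofReal (norm_expB_le e hβ_pos hβ_mono (sub_nonneg.2 hr.2) _)

theorem measurable_lintegral_Ioc_kernel {k : ℝ → ℝ → ℝ≥0∞} (hk : Measurable (Function.uncurry k))
    {δ : ℝ → Ω → ℝ≥0∞} (hδ : Measurable (Function.uncurry δ)) (s : ℝ) :
    Measurable fun p : ℝ × Ω => ∫⁻ r in Ioc s p.1, k p.1 r * δ r p.2 := by
  have h1 : Measurable fun q : (ℝ × Ω) × ℝ => k q.1.1 q.2 * δ q.2 q.1.2 :=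
    (hk.comp (by fun_prop : Measurable fun q : (ℝ × Ω) × ℝ => (q.1.1, q.2))).mul
      (hδ.comp (by fun_prop : Measurable fun q : (ℝ × Ω) × ℝ => (q.2, q.1.2)))
  have hs : MeasurableSet {q : (ℝ × Ω) × ℝ | q.2 ∈ Ioc s q.1.1} :=
    MeasurableSet.inter (s₁ := {q : (ℝ × Ω) × ℝ | s < q.2})
      (s₂ := {q : (ℝ × Ω) × ℝ | q.2 ≤ q.1.1})
      (measurableSet_lt (by fun_prop) (by fun_prop))
      (measurableSet_le (by fun_prop) (by fun_prop))
  have h2 : Measurable fun q : (ℝ × Ω) × ℝ => (Ioc s q.1.1).indicator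
      (fun r => k q.1.1 r * δ r q.1.2) q.2 := h1.indicator hs
  simp_rw [← lintegral_indicator measurableSet_Ioc]
  exact h2.lintegral_prod_right'

omit [MeasurableSpace H] [BorelSpace H] in
theorem enorm_expB_le_enorm {t : ℝ} (hβ_pos : ∀ k, 0 < β k) (hβ_mono : Monotone β) (ht : 0 ≤ t)
    (y : H) : ‖expB e β t y‖ₑ ≤ ENNReal.ofReal (Real.exp (-β 0 * t)) * ‖y‖ₑ := by
  rw [← ofReal_norm, ← ofReal_norm, ← ENNReal.ofReal_mul (by positivity)]
  exact ENNReal.ofReal_le_ofReal (norm_expB_le e hβ_pos hβ_mono ht _)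

include hβ_pos hβ_mono hF hF_lip hL hLb in
/-- Two mild solutions with the same noise approach each other exponentially fast. -/
theorem IsMildFrom.enorm_sub_le {s T : ℝ} {ξ ξ' : Ω → H} (hξ : Measurable ξ) (hξ' : Measurable ξ')
    {Y Y' : ℝ → Ω → H} (hY : IsMildFrom P e β γ F Z s T ξ Y) (hY' : IsMildFrom P e β γ F Z s T ξ' Y')
    (hT : s ≤ T) :
    ∀ᵐ ω ∂P, ‖Y T ω - Y' T ω‖ₑ ≤ ENNReal.ofReal ((β 0 + L) / (β 0 - L) *
      Real.exp (-(β 0 - L) / 2 * (T - s))) * ‖ξ ω - ξ' ω‖ₑ := by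
  have hsc := e.secondCountableTopology
  have hb := hβ_pos 0
  set δ : ℝ → Ω → ℝ≥0∞ := fun r ω => ‖Y r ω - Y' r ω‖ₑ with hδ
  have hδm : Measurable (Function.uncurry δ) := (hY.measurable.sub hY'.measurable).enorm
  have hdiff : ∀ t ∈ Icc s T, ∀ᵐ ω ∂P, Y t ω - Y' t ω = expB e β (t - s) (ξ ω - ξ' ω) +
      ((∫ r in s..t, expB e β (t - r) (F r (Y r ω))) -
        ∫ r in s..t, expB e β (t - r) (F r (Y' r ω))) := by
    intro t ht
    filter_upwards [hY.mild t ht, hY'.mild t ht] with ω h1 h2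
    obtain ⟨z, hz, h1⟩ := h1
    obtain ⟨z', hz', h2⟩ := h2
    rw [h1, h2, hz.unique hz', expB_sub_apply e hβ_pos hβ_mono (sub_nonneg.2 ht.1)]
    abel
  have hvol : ∀ t ∈ Icc s T, ∀ᵐ ω ∂P,
      δ t ω ≤ volterraBound (β 0) L s ‖ξ ω - ξ' ω‖ₑ (fun r => δ r ω) t := by
    intro t ht
    filter_upwards [hdiff t ht, hY.integrable t ht, hY'.integrable t ht] with ω h1 h2 h3
    simp only [hδ]
    rw [h1, volterraBound]
    exact (enorm_add_le _ _).trans (add_le_add (enorm_expB_le_enorm hβ_pos hβ_mono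
      (sub_nonneg.2 ht.1) _) (enorm_integral_expB_sub_le hβ_pos hβ_mono hF_lip hL ht.1 h2 h3))
  -- A crude bound, uniform in `t`; it supplies the integrability of `δ` that the Volterra estimate
  -- requires.
  have hbd : ∀ t ∈ Ioc s T, ∀ᵐ ω ∂P, δ t ω ≤ ‖ξ ω - ξ' ω‖ₑ +
      ((∫⁻ r in Ioc s T, ‖F r (Y r ω)‖ₑ) + ∫⁻ r in Ioc s T, ‖F r (Y' r ω)‖ₑ) := by
    intro t ht
    have hle : ∀ g : ℝ → H, ‖∫ r in s..t, expB e β (t - r) (g r)‖ₑ ≤ ∫⁻ r in Ioc s T, ‖g r‖ₑ := by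
      intro g
      refine (enorm_integral_expB_le hβ_pos hβ_mono ht.1.le g).trans ?_
      refine (setLIntegral_mono' measurableSet_Ioc fun r hr => ?_).trans
        (lintegral_mono_set (Ioc_subset_Ioc_right ht.2))
      refine mul_le_of_le_one_left (by positivity) (ENNReal.ofReal_le_one.2 ?_)
      exact Real.exp_le_one_iff.2 (by nlinarith [hr.2])
    filter_upwards [hdiff t (Ioc_subset_Icc_self ht)] with ω h1
    simp only [hδ]
    rw [h1]
    refine (enorm_add_le _ _).trans (add_le_add ?_ ?_)
    · refine (enorm_expB_le_enorm hβ_pos hβ_mono (sub_nonneg.2 ht.1.le) _).trans ?_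
      refine mul_le_of_le_one_left (by positivity) (ENNReal.ofReal_le_one.2 ?_)
      exact Real.exp_le_one_iff.2 (by nlinarith [ht.1])
    · rw [sub_eq_add_neg]
      refine (enorm_add_le _ _).trans ?_
      rw [enorm_neg]
      exact add_le_add (hle _) (hle _)
  have hFm : ∀ V : ℝ → Ω → H, Measurable (Function.uncurry V) →
      Measurable fun ω => ∫⁻ r in Ioc s T, ‖F r (V r ω)‖ₑ := by
    intro V hV
    have h1 : Measurable fun q : Ω × ℝ => ‖F q.2 (V q.2 q.1)‖ₑ :=
      (hF.comp (measurable_snd.prodMk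
        (hV.comp (by fun_prop : Measurable fun q : Ω × ℝ => (q.2, q.1))))).enorm
    exact h1.lintegral_prod_right'
  -- The mild equation holds almost surely for each fixed time, whereas the Volterra estimate is
  -- pathwise; Fubini exchanges the quantifiers at the price of an exceptional null set of times.
  have hvol' : ∀ᵐ ω ∂P, ∀ᵐ t ∂volume.restrict (Ioc s T),
      δ t ω ≤ volterraBound (β 0) L s ‖ξ ω - ξ' ω‖ₑ (fun r => δ r ω) t := by
    rw [← Measure.ae_ae_comm]
    · filter_upwards [ae_restrict_mem measurableSet_Ioc] with t ht
      exact hvol t (Ioc_subset_Icc_self ht)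
    · refine measurableSet_le hδm ?_
      unfold volterraBound
      have h1 := measurable_lintegral_Ioc_kernel (Ω := Ω)
        (k := fun t r => ENNReal.ofReal (L * Real.exp (-β 0 * (t - r))))
        (by unfold Function.uncurry; fun_prop) hδm s
      exact Measurable.add (by fun_prop) h1
  have hbd' : ∀ᵐ ω ∂P, ∀ᵐ t ∂volume.restrict (Ioc s T), δ t ω ≤ ‖ξ ω - ξ' ω‖ₑ +
      ((∫⁻ r in Ioc s T, ‖F r (Y r ω)‖ₑ) + ∫⁻ r in Ioc s T, ‖F r (Y' r ω)‖ₑ) := by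
    rw [← Measure.ae_ae_comm]
    · filter_upwards [ae_restrict_mem measurableSet_Ioc] with t ht
      exact hbd t ht
    · refine measurableSet_le hδm ?_
      have h1 := hFm Y hY.measurable
      have h2 := hFm Y' hY'.measurable
      exact Measurable.add (by fun_prop)
        ((h1.comp measurable_snd).add (h2.comp measurable_snd))
  filter_upwards [hvol', hbd', hvol T ⟨hT, le_rfl⟩, hY.integrable T ⟨hT, le_rfl⟩,
    hY'.integrable T ⟨hT, le_rfl⟩]
    with ω h1 h2 h3 h4 h5
  refine h3.trans (volterraBound_le hL hLb enorm_ne_top ?_ h1 ⟨hT, le_rfl⟩)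
  rw [intervalIntegrable_iff_integrableOn_Ioc_of_le hT] at h4 h5
  refine ne_top_of_le_ne_top ?_ (lintegral_mono_ae h2)
  rw [lintegral_const]
  refine ENNReal.mul_ne_top (ENNReal.add_ne_top.2 ⟨enorm_ne_top, ENNReal.add_ne_top.2
    ⟨h4.2.ne, h5.2.ne⟩⟩) ?_
  simp

end Mild

/-! ### The sharp Gronwall inequality and Jensen's inequality for exponential kernels -/

section Moments

theorem integral_exp_kernel_mul {b κ v t : ℝ} :
    ∫ r in v..t, (b - κ) * Real.exp (-b * (t - r)) * Real.exp (-κ * (r - v)) =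
      Real.exp (-κ * (t - v)) - Real.exp (-b * (t - v)) := by
  have h : ∀ r ∈ uIcc v t, HasDerivAt (fun r => Real.exp (-b * (t - r)) * Real.exp (-κ * (r - v)))
      ((b - κ) * Real.exp (-b * (t - r)) * Real.exp (-κ * (r - v))) r := by
    intro r _
    have h1 : HasDerivAt (fun r => Real.exp (-b * (t - r))) (Real.exp (-b * (t - r)) * b) r := by
      convert! (((hasDerivAt_id r).const_sub t).const_mul (-b)).exp using 1
      simp
    have h2 : HasDerivAt (fun r => Real.exp (-κ * (r - v))) (Real.exp (-κ * (r - v)) * (-κ)) r := by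
      convert! (((hasDerivAt_id r).sub_const v).const_mul (-κ)).exp using 1
      simp
    convert! h1.mul h2 using 1
    ring
  rw [intervalIntegral.integral_eq_sub_of_hasDerivAt h
    (Continuous.intervalIntegrable (by fun_prop) _ _)]
  simp

theorem lintegral_exp_kernel_mul {b κ v t : ℝ} (hκ : κ ≤ b) (hvt : v ≤ t) :
    ∫⁻ r in Icc v t, ENNReal.ofReal ((b - κ) * Real.exp (-b * (t - r))) *
      ENNReal.ofReal (Real.exp (-κ * (r - v))) =
      ENNReal.ofReal (Real.exp (-κ * (t - v)) - Real.exp (-b * (t - v))) := by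
  have h0 : 0 ≤ b - κ := sub_nonneg.2 hκ
  rw [← integral_exp_kernel_mul, intervalIntegral.integral_of_le hvt, ← integral_Icc_eq_integral_Ioc,
    ofReal_integral_eq_lintegral_ofReal]
  · refine lintegral_congr fun r => ?_
    rw [← ENNReal.ofReal_mul (by positivity)]
  · exact Continuous.integrableOn_Icc (by fun_prop)
  · exact ae_of_all _ fun r => by positivity

/-- The resolvent identity for the kernel `b - κ` times `exp (-b ·)`. -/
theorem lintegral_kernel_resolvent {b κ s t : ℝ} (hκ : κ ≤ b) {f : ℝ → ℝ≥0∞}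
    (hf : Measurable f) :
    (∫⁻ r in Ioc s t, ENNReal.ofReal (Real.exp (-b * (t - r))) * f r) +
      ∫⁻ r in Ioc s t, ENNReal.ofReal ((b - κ) * Real.exp (-b * (t - r))) *
        ∫⁻ v in Ioc s r, ENNReal.ofReal (Real.exp (-κ * (r - v))) * f v =
    ∫⁻ r in Ioc s t, ENNReal.ofReal (Real.exp (-κ * (t - r))) * f r := by
  -- Writing the triangle `s < v ≤ r ≤ t` with an indicator prepares the exchange of integrals; the
  -- inner integral over `r` is then explicit.
  have h1 : ∀ r, r ∈ Ioc s t → ENNReal.ofReal ((b - κ) * Real.exp (-b * (t - r))) *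
      ∫⁻ v in Ioc s r, ENNReal.ofReal (Real.exp (-κ * (r - v))) * f v =
      ∫⁻ v in Ioc s t, (Icc v t).indicator (fun r =>
        ENNReal.ofReal ((b - κ) * Real.exp (-b * (t - r))) *
        ENNReal.ofReal (Real.exp (-κ * (r - v)))) r * f v := by
    intro r hr
    rw [← lintegral_const_mul _ (by fun_prop), ← lintegral_indicator measurableSet_Ioc,
      ← lintegral_indicator measurableSet_Ioc]
    refine lintegral_congr fun v => ?_
    by_cases hv : s < v
    · by_cases hvr : v ≤ r
      · rw [indicator_of_mem (show v ∈ Ioc s r from ⟨hv, hvr⟩),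
          indicator_of_mem (show v ∈ Ioc s t from ⟨hv, hvr.trans hr.2⟩),
          indicator_of_mem (show r ∈ Icc v t from ⟨hvr, hr.2⟩), mul_assoc]
      · rw [indicator_of_notMem (fun h : v ∈ Ioc s r => hvr h.2)]
        by_cases hvt : v ∈ Ioc s t
        · rw [indicator_of_mem hvt, indicator_of_notMem (fun h : r ∈ Icc v t => hvr h.1), zero_mul]
        · rw [indicator_of_notMem hvt]
    · rw [indicator_of_notMem (fun h : v ∈ Ioc s r => hv h.1),
        indicator_of_notMem (fun h : v ∈ Ioc s t => hv h.1)]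
  have hm : Measurable fun q : ℝ × ℝ => (Icc q.2 t).indicator (fun r =>
        ENNReal.ofReal ((b - κ) * Real.exp (-b * (t - r))) *
        ENNReal.ofReal (Real.exp (-κ * (r - q.2)))) q.1 * f q.2 := by
    refine Measurable.mul ?_ (by fun_prop)
    have hs : MeasurableSet {q : ℝ × ℝ | q.1 ∈ Icc q.2 t} :=
      MeasurableSet.inter (s₁ := {q : ℝ × ℝ | q.2 ≤ q.1}) (s₂ := {q : ℝ × ℝ | q.1 ≤ t})
        (measurableSet_le (by fun_prop) (by fun_prop))
        (measurableSet_le (by fun_prop) (by fun_prop))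
    have h2 : Measurable fun q : ℝ × ℝ => ENNReal.ofReal ((b - κ) * Real.exp (-b * (t - q.1))) *
        ENNReal.ofReal (Real.exp (-κ * (q.1 - q.2))) := by fun_prop
    exact h2.indicator hs
  rw [setLIntegral_congr_fun measurableSet_Ioc h1, lintegral_lintegral_swap hm.aemeasurable,
    ← lintegral_add_left (by fun_prop)]
  refine setLIntegral_congr_fun measurableSet_Ioc fun v hv => ?_
  have hexp : Real.exp (-b * (t - v)) ≤ Real.exp (-κ * (t - v)) := by
    rw [Real.exp_le_exp]
    nlinarith [hv.2]
  have h3 : ∫⁻ r in Ioc s t, (Icc v t).indicator (fun r =>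
        ENNReal.ofReal ((b - κ) * Real.exp (-b * (t - r))) *
        ENNReal.ofReal (Real.exp (-κ * (r - v)))) r =
      ENNReal.ofReal (Real.exp (-κ * (t - v)) - Real.exp (-b * (t - v))) := by
    rw [← lintegral_exp_kernel_mul hκ hv.2, lintegral_indicator measurableSet_Icc,
      Measure.restrict_restrict measurableSet_Icc, inter_eq_left.2]
    exact fun r hr => ⟨hv.1.trans_le hr.1, hr.2⟩
  rw [lintegral_mul_const _ (by
      refine Measurable.indicator ?_ measurableSet_Icc
      fun_prop), h3, ← add_mul, ← ENNReal.ofReal_add (Real.exp_pos _).le (sub_nonneg.2 hexp),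
    add_sub_cancel]

/-- The Gronwall inequality for the kernel `exp (-b (t - r))`. -/
theorem le_lintegral_of_volterra_le {b L s T : ℝ} (hL : 0 ≤ L) (hLb : L < b) {f u : ℝ → ℝ≥0∞}
    (hf : Measurable f) (hfin : ∫⁻ r in Ioc s T, u r ≠ ∞)
    (h : ∀ᵐ t ∂volume.restrict (Ioc s T), u t ≤
      (∫⁻ r in Ioc s t, ENNReal.ofReal (Real.exp (-b * (t - r))) * f r) +
        ∫⁻ r in Ioc s t, ENNReal.ofReal (L * Real.exp (-b * (t - r))) * u r)
    (hsT : s ≤ T) (hT : u T ≤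
      (∫⁻ r in Ioc s T, ENNReal.ofReal (Real.exp (-b * (T - r))) * f r) +
        ∫⁻ r in Ioc s T, ENNReal.ofReal (L * Real.exp (-b * (T - r))) * u r) :
    u T ≤ ∫⁻ r in Ioc s T, ENNReal.ofReal (Real.exp (-(b - L) * (T - r))) * f r := by
  -- By the resolvent identity, `g` solves the Volterra equation with equality.
  set g : ℝ → ℝ≥0∞ := fun t =>
    ∫⁻ r in Ioc s t, ENNReal.ofReal (Real.exp (-(b - L) * (t - r))) * f r with hg
  have hgm : Measurable g := by
    have h1 := measurable_lintegral_Ioc_kernel (Ω := Unit)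
      (k := fun t r => ENNReal.ofReal (Real.exp (-(b - L) * (t - r))))
      (by unfold Function.uncurry; fun_prop) (δ := fun r _ => f r)
      (hf.comp measurable_fst) s
    exact h1.comp (by fun_prop : Measurable fun t : ℝ => (t, ()))
  have hres : ∀ t, (∫⁻ r in Ioc s t, ENNReal.ofReal (Real.exp (-b * (t - r))) * f r) +
      ∫⁻ r in Ioc s t, ENNReal.ofReal (L * Real.exp (-b * (t - r))) * g r = g t := by
    intro t
    have h1 := lintegral_kernel_resolvent (b := b) (κ := b - L) (s := s) (t := t) (by linarith) hf
    rw [sub_sub_cancel] at h1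
    exact h1
  -- The truncated excess `u - g` satisfies the homogeneous inequality, so the Volterra estimate
  -- with `d = 0` forces it to vanish.
  have key : ∀ t, u t ≤
      (∫⁻ r in Ioc s t, ENNReal.ofReal (Real.exp (-b * (t - r))) * f r) +
        ∫⁻ r in Ioc s t, ENNReal.ofReal (L * Real.exp (-b * (t - r))) * u r →
      u t - g t ≤ volterraBound b L s 0 (fun r => u r - g r) t := by
    intro t ht
    rw [volterraBound, mul_zero, zero_add, tsub_le_iff_left]
    refine ht.trans ?_
    rw [← hres t, add_assoc]
    refine add_le_add le_rfl ?_
    rw [← lintegral_add_left (by fun_prop)]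
    refine lintegral_mono fun r => ?_
    rw [← mul_add]
    exact mul_le_mul_right le_add_tsub _
  have h0 := volterraBound_le hL hLb (d := 0) (δ := fun r => u r - g r) ENNReal.zero_ne_top
    (ne_top_of_le_ne_top hfin (lintegral_mono fun r => tsub_le_self))
    (h.mono fun t ht => key t ht) (t := T) ⟨hsT, le_rfl⟩
  rw [mul_zero] at h0
  exact tsub_eq_zero_iff_le.1 (le_antisymm ((key T hT).trans h0) zero_le)

/-- Jensen's inequality for the kernel `exp (-κ (t - r))`. -/
theorem lintegral_kernel_rpow_le {Ω : Type*} [MeasurableSpace Ω] {P : Measure Ω} [SFinite P]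
    {κ s t p : ℝ} (hκ : 0 < κ) (hp : 1 ≤ p) {w : ℝ → Ω → ℝ≥0∞}
    (hw : Measurable (Function.uncurry w)) {B : ℝ≥0∞}
    (hB : ∀ r ∈ Ioc s t, ∫⁻ ω, w r ω ^ p ∂P ≤ B) :
    ∫⁻ ω, (∫⁻ r in Ioc s t, ENNReal.ofReal (Real.exp (-κ * (t - r))) * w r ω) ^ p ∂P ≤
      ENNReal.ofReal (1 / κ) ^ p * B := by
  have hp0 : 0 < p := one_pos.trans_le hp
  set k : ℝ → ℝ≥0∞ := fun r => ENNReal.ofReal (Real.exp (-κ * (t - r))) with hk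
  have hkm : Measurable k := by fun_prop
  set μ : Measure ℝ := (volume.restrict (Ioc s t)).withDensity k with hμ
  have hμu : μ univ ≤ ENNReal.ofReal (1 / κ) := by
    rw [hμ, withDensity_apply _ MeasurableSet.univ, Measure.restrict_univ]
    exact lintegral_exp_kernel_le hκ s t
  have hjen : ∀ f : ℝ → ℝ≥0∞, Measurable f →
      (∫⁻ r, f r ∂μ) ^ p ≤ ENNReal.ofReal (1 / κ) ^ (p - 1) * ∫⁻ r, f r ^ p ∂μ := by
    intro f hf
    -- Hölder's inequality for the kernel measure, whose mass is at most `1 / κ`, in place of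
    -- normalising it.
    have h1 := eLpNorm'_le_eLpNorm'_mul_rpow_measure_univ (μ := μ) (f := f) one_pos hp
      hf.aestronglyMeasurable
    simp only [eLpNorm', enorm_eq_self, ENNReal.rpow_one, div_one] at h1
    calc (∫⁻ r, f r ∂μ) ^ p
        ≤ ((∫⁻ r, f r ^ p ∂μ) ^ (1 / p) * μ univ ^ (1 - 1 / p)) ^ p :=
          ENNReal.rpow_le_rpow h1 hp0.le
      _ = (∫⁻ r, f r ^ p ∂μ) * μ univ ^ (p - 1) := by
          rw [ENNReal.mul_rpow_of_nonneg _ _ hp0.le, ← ENNReal.rpow_mul, ← ENNReal.rpow_mul,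
            one_div_mul_cancel hp0.ne', ENNReal.rpow_one]
          congr 2
          field_simp
      _ ≤ _ := by
          rw [mul_comm]
          exact mul_le_mul_left (ENNReal.rpow_le_rpow hμu (by linarith)) _
  have hden : ∀ f : ℝ → ℝ≥0∞, Measurable f → ∫⁻ r, f r ∂μ = ∫⁻ r in Ioc s t, k r * f r :=
    fun f hf => lintegral_withDensity_eq_lintegral_mul _ hkm hf
  have hwr : ∀ ω, Measurable fun r => w r ω := fun ω =>
    hw.comp (by fun_prop : Measurable fun r : ℝ => (r, ω))
  have hwm : Measurable fun q : Ω × ℝ => w q.2 q.1 ^ p :=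
    (hw.comp measurable_swap).pow_const p
  calc ∫⁻ ω, (∫⁻ r in Ioc s t, k r * w r ω) ^ p ∂P
      ≤ ∫⁻ ω, ENNReal.ofReal (1 / κ) ^ (p - 1) * ∫⁻ r, w r ω ^ p ∂μ ∂P := by
        refine lintegral_mono fun ω => ?_
        rw [← hden _ (hwr ω)]
        exact hjen _ (hwr ω)
    _ = ENNReal.ofReal (1 / κ) ^ (p - 1) * ∫⁻ r, ∫⁻ ω, w r ω ^ p ∂P ∂μ := by
        rw [lintegral_const_mul _ hwm.lintegral_prod_right', lintegral_lintegral_swap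
          hwm.aemeasurable]
    _ ≤ ENNReal.ofReal (1 / κ) ^ (p - 1) * (ENNReal.ofReal (1 / κ) * B) := by
        refine mul_le_mul_right ?_ _
        rw [hden (fun r => ∫⁻ ω, w r ω ^ p ∂P) (hw.pow_const p).lintegral_prod_right']
        calc ∫⁻ r in Ioc s t, k r * ∫⁻ ω, w r ω ^ p ∂P ≤ ∫⁻ r in Ioc s t, k r * B :=
              setLIntegral_mono' measurableSet_Ioc fun r hr => mul_le_mul_right (hB r hr) _
          _ = (∫⁻ r in Ioc s t, k r) * B := lintegral_mul_const _ hkm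
          _ ≤ _ := mul_le_mul_left (lintegral_exp_kernel_le hκ s t) _
    _ = _ := by
        rw [← mul_assoc]
        congr 1
        nth_rewrite 2 [← ENNReal.rpow_one (ENNReal.ofReal (1 / κ))]
        rw [← ENNReal.rpow_add_of_nonneg _ _ (by linarith) zero_le_one, sub_add_cancel]

end Moments

/-! ### Time-uniform moments of mild solutions -/

section Solutions

/-- The assumptions on the spectrum of `B` and on the noise. -/
structure IsStableNoise {Ω : Type*} [MeasurableSpace Ω] (P : Measure Ω) (α : ℝ) (β γ : ℕ → ℝ)
    (Z Ztilde : ℕ → ℝ≥0 → Ω → ℝ) : Prop where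
  pos : ∀ k, 0 < β k
  mono : Monotone β
  one_lt : 1 < α
  coeff_pos : ∀ k, 0 < γ k
  summable : Summable (fun k => γ k ^ α / β k)
  right : ∀ k, IsSymmStableProcess P α (Z k)
  left : ∀ k, IsSymmStableProcess P α (Ztilde k)
  indep : iIndepFun (fun (i : ℕ ⊕ ℕ) (ω : Ω) (t : ℝ≥0) => Sum.elim Z Ztilde i t ω) P

/-- A measurable drift with linear growth and Lipschitz constant smaller than the spectral
gap `b`. -/
structure IsDissipativeDrift {H : Type*} [NormedAddCommGroup H] [MeasurableSpace H] (b : ℝ)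
    (F : ℝ → H → H) (A L : ℝ) : Prop where
  measurable : Measurable (Function.uncurry F)
  lip : ∀ t y₁ y₂, ‖F t y₁ - F t y₂‖ ≤ L * ‖y₁ - y₂‖
  growth : ∀ t y, ‖F t y‖ ≤ A + L * ‖y‖
  nonneg : 0 ≤ L
  lt : L < b

variable {H : Type*} [NormedAddCommGroup H] [InnerProductSpace ℝ H] [CompleteSpace H]
  [MeasurableSpace H] [BorelSpace H] {e : HilbertBasis ℕ ℝ H} {α : ℝ} {β γ : ℕ → ℝ}
  {Ω : Type*} [mΩ : MeasurableSpace Ω] {P : Measure Ω} [IsProbabilityMeasure P]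
  {Z Ztilde : ℕ → ℝ≥0 → Ω → ℝ} (hN : IsStableNoise P α β γ Z Ztilde)
  {F : ℝ → H → H} {A L : ℝ}

omit [InnerProductSpace ℝ H] [CompleteSpace H] [BorelSpace H] in
theorem IsDissipativeDrift.growth_const_nonneg {b : ℝ} (hF : IsDissipativeDrift b F A L) :
    0 ≤ A := by
  have h := hF.growth 0 0
  rw [norm_zero, mul_zero, add_zero] at h
  exact (norm_nonneg _).trans h

include hN in
omit [IsProbabilityMeasure P] in
theorem IsStableNoise.ae_regular :
    ∀ᵐ ω ∂P, ∀ k, TwoSidedRegular fun r => twoSided Z Ztilde k r ω :=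
  ae_twoSidedRegular hN.right hN.left

include hN in
/-- The difference of a mild solution and its noise term `W`, in terms of the noise term only. -/
theorem IsMildFrom.enorm_sub_noise_le (hF : IsDissipativeDrift (β 0) F A L) {s T : ℝ}
    (hsT : s ≤ T) {y : H} {Y W : ℝ → Ω → H}
    (hY : IsMildFrom P e β γ F (twoSided Z Ztilde) s T (fun _ => y) Y)
    (hW : Measurable (Function.uncurry W))
    (hW2 : ∀ t ∈ Icc s T, ∀ᵐ ω ∂P, IsStochConv e β γ (twoSided Z Ztilde) s t ω (W t ω)) :
    ∀ᵐ ω ∂P, ‖Y T ω - (W T ω + expB e β (T - s) y)‖ₑ ≤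
      ∫⁻ r in Ioc s T, ENNReal.ofReal (Real.exp (-(β 0 - L) * (T - r))) *
        (ENNReal.ofReal A + ENNReal.ofReal L * ‖W r ω + expB e β (r - s) y‖ₑ) := by
  have hsc := e.secondCountableTopology
  have hA := hF.growth_const_nonneg
  have hβ := hN.pos 0
  -- This is the solution without drift, so `Y - W'` is the drift integral alone.
  set W' : ℝ → Ω → H := fun r ω => W r ω + expB e β (r - s) y with hW'
  have hW'm : Measurable (Function.uncurry W') :=
    hW.add ((measurable_expB e β).comp (by fun_prop : Measurable fun p : ℝ × Ω => (p.1 - s, y)))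
  set u : ℝ → Ω → ℝ≥0∞ := fun r ω => ‖Y r ω - W' r ω‖ₑ with hu
  have hum : Measurable (Function.uncurry u) := (hY.measurable.sub hW'm).enorm
  set f : ℝ → Ω → ℝ≥0∞ := fun r ω => ENNReal.ofReal A + ENNReal.ofReal L * ‖W' r ω‖ₑ with hf
  have hfm : Measurable (Function.uncurry f) := (hW'm.enorm.const_mul _).const_add _
  have hdiff : ∀ t ∈ Icc s T, ∀ᵐ ω ∂P,
      Y t ω - W' t ω = ∫ r in s..t, expB e β (t - r) (F r (Y r ω)) := by
    intro t ht
    filter_upwards [hY.mild t ht, hW2 t ht] with ω h1 h2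
    obtain ⟨z, hz, h1⟩ := h1
    simp only [hW']
    rw [h1, hz.unique h2]
    abel
  have hFY : ∀ r ω, ‖F r (Y r ω)‖ₑ ≤ f r ω + ENNReal.ofReal L * u r ω := by
    intro r ω
    have h1 : ‖F r (Y r ω)‖ ≤ A + L * ‖W' r ω‖ + L * ‖Y r ω - W' r ω‖ := by
      refine (hF.growth r _).trans ?_
      have h2 : ‖Y r ω‖ ≤ ‖W' r ω‖ + ‖Y r ω - W' r ω‖ := by
        simpa using norm_add_le (W' r ω) (Y r ω - W' r ω)
      nlinarith [mul_le_mul_of_nonneg_left h2 hF.nonneg]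
    have hL := hF.nonneg
    simp only [hf, hu]
    rw [← ofReal_norm, ← ofReal_norm, ← ofReal_norm, ← ENNReal.ofReal_mul hL,
      ← ENNReal.ofReal_mul hL, ← ENNReal.ofReal_add hA (by positivity),
      ← ENNReal.ofReal_add (by positivity) (by positivity)]
    exact ENNReal.ofReal_le_ofReal h1
  have hvol : ∀ t ∈ Icc s T, ∀ᵐ ω ∂P, u t ω ≤
      (∫⁻ r in Ioc s t, ENNReal.ofReal (Real.exp (-β 0 * (t - r))) * f r ω) +
        ∫⁻ r in Ioc s t, ENNReal.ofReal (L * Real.exp (-β 0 * (t - r))) * u r ω := by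
    intro t ht
    filter_upwards [hdiff t ht] with ω h1
    have hfω : Measurable fun r => f r ω :=
      hfm.of_uncurry_right
    have hm : Measurable fun r => ENNReal.ofReal (Real.exp (-β 0 * (t - r))) * f r ω :=
      (by fun_prop : Measurable fun r => ENNReal.ofReal (Real.exp (-β 0 * (t - r)))).mul hfω
    rw [← lintegral_add_left hm, show u t ω = ‖Y t ω - W' t ω‖ₑ from rfl, h1]
    refine (enorm_integral_expB_le hN.pos hN.mono ht.1 _).trans (lintegral_mono fun r => ?_)
    rw [mul_comm L, ENNReal.ofReal_mul (Real.exp_pos _).le, mul_assoc, ← mul_add]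
    exact mul_le_mul_right (hFY r ω) _
  have hfin : ∀ t ∈ Icc s T, ∀ᵐ ω ∂P, u t ω ≤ ∫⁻ r in Ioc s T, ‖F r (Y r ω)‖ₑ := by
    intro t ht
    filter_upwards [hdiff t ht] with ω h1
    rw [show u t ω = ‖Y t ω - W' t ω‖ₑ from rfl, h1]
    refine (enorm_integral_expB_le hN.pos hN.mono ht.1 _).trans
      ((setLIntegral_mono' measurableSet_Ioc fun r hr => ?_).trans
        (lintegral_mono_set (Ioc_subset_Ioc_right ht.2)))
    refine mul_le_of_le_one_left (by positivity) (ENNReal.ofReal_le_one.2 ?_)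
    exact Real.exp_le_one_iff.2 (by nlinarith [hr.2])
  have hvol' : ∀ᵐ ω ∂P, ∀ᵐ t ∂volume.restrict (Ioc s T), u t ω ≤
      (∫⁻ r in Ioc s t, ENNReal.ofReal (Real.exp (-β 0 * (t - r))) * f r ω) +
        ∫⁻ r in Ioc s t, ENNReal.ofReal (L * Real.exp (-β 0 * (t - r))) * u r ω := by
    rw [← Measure.ae_ae_comm]
    · filter_upwards [ae_restrict_mem measurableSet_Ioc] with t ht
      exact hvol t (Ioc_subset_Icc_self ht)
    · refine measurableSet_le hum (Measurable.add ?_ ?_)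
      · exact measurable_lintegral_Ioc_kernel (Ω := Ω)
          (k := fun t r => ENNReal.ofReal (Real.exp (-β 0 * (t - r))))
          (by unfold Function.uncurry; fun_prop) hfm s
      · exact measurable_lintegral_Ioc_kernel (Ω := Ω)
          (k := fun t r => ENNReal.ofReal (L * Real.exp (-β 0 * (t - r))))
          (by unfold Function.uncurry; fun_prop) hum s
  have hfin' : ∀ᵐ ω ∂P, ∀ᵐ t ∂volume.restrict (Ioc s T),
      u t ω ≤ ∫⁻ r in Ioc s T, ‖F r (Y r ω)‖ₑ := by
    rw [← Measure.ae_ae_comm]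
    · filter_upwards [ae_restrict_mem measurableSet_Ioc] with t ht
      exact hfin t (Ioc_subset_Icc_self ht)
    · refine measurableSet_le hum ?_
      have h1 : Measurable fun q : (ℝ × Ω) × ℝ => ‖F q.2 (Y q.2 q.1.2)‖ₑ :=
        (hF.measurable.comp (measurable_snd.prodMk (hY.measurable.comp
          (by fun_prop : Measurable fun q : (ℝ × Ω) × ℝ => (q.2, q.1.2))))).enorm
      exact h1.lintegral_prod_right'
  filter_upwards [hvol', hfin', hvol T ⟨hsT, le_rfl⟩, hY.integrable T ⟨hsT, le_rfl⟩]
    with ω h1 h2 h3 h4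
  have hfω : Measurable fun r => f r ω :=
      hfm.of_uncurry_right
  refine le_lintegral_of_volterra_le (u := fun r => u r ω) hF.nonneg hF.lt hfω ?_ h1 hsT h3
  rw [intervalIntegrable_iff_integrableOn_Ioc_of_le hsT] at h4
  refine ne_top_of_le_ne_top ?_ (lintegral_mono_ae h2)
  rw [lintegral_const]
  exact ENNReal.mul_ne_top h4.2.ne (by simp)

include hN in
/-- Moment bounds for mild solutions, uniform in time. -/
theorem exists_lintegral_mild_le (hL : 0 ≤ L) (hLb : L < β 0) {p : ℝ} (hp : 1 ≤ p) (hpα : p < α) :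
    ∃ C : ℝ≥0∞, C ≠ ∞ ∧ ∀ (A : ℝ) (F : ℝ → H → H), IsDissipativeDrift (β 0) F A L →
      ∀ (s t : ℝ), s ≤ t → ∀ (y : H) (Y : ℝ → Ω → H),
        IsMildFrom P e β γ F (twoSided Z Ztilde) s t (fun _ => y) Y →
        ∫⁻ ω, ‖Y t ω‖ₑ ^ p ∂P ≤ C * ENNReal.ofReal (1 + A + ‖y‖) ^ p := by
  have hsc := e.secondCountableTopology
  have hp0 : 0 < p := one_pos.trans_le hp
  have hκ : 0 < β 0 - L := sub_pos.2 hLb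
  obtain ⟨B, hB, hmom⟩ := exists_lintegral_stochConv_le e hN.pos hN.one_lt hN.coeff_pos hN.summable
    hN.right hN.left hp0 hpα
  set B' : ℝ≥0∞ := 2 ^ (p - 1) * (1 + B) with hB'
  have h2top : (2 : ℝ≥0∞) ^ (p - 1) ≠ ∞ :=
    ENNReal.rpow_ne_top_of_nonneg (by linarith) ENNReal.ofNat_ne_top
  have hB't : B' ≠ ∞ := ENNReal.mul_ne_top h2top (ENNReal.add_ne_top.2 ⟨ENNReal.one_ne_top, hB⟩)
  refine ⟨2 ^ (p - 1) * (B' + (1 + ENNReal.ofReal L) ^ p *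
    (ENNReal.ofReal (1 / (β 0 - L)) ^ p * B')), ?_, ?_⟩
  · refine ENNReal.mul_ne_top h2top (ENNReal.add_ne_top.2 ⟨hB't, ENNReal.mul_ne_top ?_
      (ENNReal.mul_ne_top ?_ hB't)⟩)
    · exact ENNReal.rpow_ne_top_of_nonneg hp0.le (by simp)
    · exact ENNReal.rpow_ne_top_of_nonneg hp0.le ENNReal.ofReal_ne_top
  intro A F hF s t hst y Y hY
  have hA := hF.growth_const_nonneg
  obtain ⟨W, hW, hW2⟩ := exists_measurable_stochConv e hN.pos hN.one_lt hN.coeff_pos hN.summable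
    hN.right hN.left mΩ (ae_of_all P fun ω k r => rfl) hst
    (fun k r _ => (measurable_twoSided hN.right hN.left k r).sub
      (measurable_twoSided hN.right hN.left k s))
  set w : ℝ → Ω → ℝ≥0∞ := fun r ω => 1 + ‖W r ω‖ₑ with hw
  have hwm : Measurable (Function.uncurry w) := hW.enorm.const_add _
  have hwr : ∀ r, Measurable (w r) := fun r =>
    hwm.comp (by fun_prop : Measurable fun ω : Ω => (r, ω))
  have hwB : ∀ r ∈ Icc s t, ∫⁻ ω, w r ω ^ p ∂P ≤ B' := by
    intro r hr
    have hWr : Measurable (W r) := hW.comp (by fun_prop : Measurable fun ω : Ω => (r, ω))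
    calc ∫⁻ ω, w r ω ^ p ∂P ≤ ∫⁻ ω, 2 ^ (p - 1) * (1 + ‖W r ω‖ₑ ^ p) ∂P :=
          lintegral_mono fun ω => by
            simpa using ENNReal.rpow_add_le_mul_rpow_add_rpow 1 ‖W r ω‖ₑ hp
      _ = 2 ^ (p - 1) * (1 + ∫⁻ ω, ‖W r ω‖ₑ ^ p ∂P) := by
          rw [lintegral_const_mul _ (by fun_prop), lintegral_add_left measurable_const,
            lintegral_const, measure_univ, one_mul]
      _ ≤ B' := by
          rw [hB']
          exact mul_le_mul_right (add_le_add le_rfl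
            (hmom s r hr.1 _ hWr.aemeasurable (hW2 r hr))) _
  -- All dependence on the drift constant and the initial value is collected in `D`; what remains
  -- involves only the noise, `L` and `β 0`, so the constant is chosen before `A`, `F` and `y`.
  set D : ℝ≥0∞ := ENNReal.ofReal (1 + A + ‖y‖) with hD
  have hW'D : ∀ r ω, s ≤ r → ‖W r ω + expB e β (r - s) y‖ₑ ≤ D * w r ω := by
    intro r ω hr
    have h1 : ‖expB e β (r - s) y‖ₑ ≤ ‖y‖ₑ :=
      (enorm_expB_le_enorm hN.pos hN.mono (sub_nonneg.2 hr) y).trans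
        (mul_le_of_le_one_left (by positivity) (ENNReal.ofReal_le_one.2
          (Real.exp_le_one_iff.2 (by nlinarith [hN.pos 0]))))
    have h2 : (1 : ℝ≥0∞) ≤ D := by
      rw [hD, ENNReal.one_le_ofReal]
      linarith [norm_nonneg y]
    have h3 : ‖y‖ₑ ≤ D := by
      rw [hD, ← ofReal_norm]
      exact ENNReal.ofReal_le_ofReal (by linarith)
    calc _ ≤ ‖W r ω‖ₑ + ‖expB e β (r - s) y‖ₑ := enorm_add_le _ _
      _ ≤ D * ‖W r ω‖ₑ + D := add_le_add (le_mul_of_one_le_left (by positivity) h2) (h1.trans h3)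
      _ = D * w r ω := by rw [hw]; ring
  have hAD : ∀ r ω, ENNReal.ofReal A ≤ D * w r ω := by
    intro r ω
    calc ENNReal.ofReal A ≤ D * 1 := by
          rw [mul_one, hD]
          exact ENNReal.ofReal_le_ofReal (by linarith [norm_nonneg y])
      _ ≤ _ := mul_le_mul_right le_self_add _
  set J : Ω → ℝ≥0∞ := fun ω =>
    ∫⁻ r in Ioc s t, ENNReal.ofReal (Real.exp (-(β 0 - L) * (t - r))) * w r ω with hJ
  have hJm : Measurable J := by
    have h1 := measurable_lintegral_Ioc_kernel (Ω := Ω)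
      (k := fun t r => ENNReal.ofReal (Real.exp (-(β 0 - L) * (t - r))))
      (by unfold Function.uncurry; fun_prop) hwm s
    exact h1.comp (by fun_prop : Measurable fun ω : Ω => (t, ω))
  have hYle : ∀ᵐ ω ∂P, ‖Y t ω‖ₑ ≤ D * (w t ω + (1 + ENNReal.ofReal L) * J ω) := by
    filter_upwards [hY.enorm_sub_noise_le hN hF hst hW hW2] with ω h1
    have hwω : Measurable fun r => w r ω := hwm.of_uncurry_right
    calc ‖Y t ω‖ₑ ≤ ‖W t ω + expB e β (t - s) y‖ₑ +
          ‖Y t ω - (W t ω + expB e β (t - s) y)‖ₑ := by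
          simpa using enorm_add_le (W t ω + expB e β (t - s) y)
            (Y t ω - (W t ω + expB e β (t - s) y))
      _ ≤ D * w t ω + ∫⁻ r in Ioc s t, (D * (1 + ENNReal.ofReal L)) *
          (ENNReal.ofReal (Real.exp (-(β 0 - L) * (t - r))) * w r ω) := by
          refine add_le_add (hW'D t ω hst) (h1.trans
            (setLIntegral_mono' measurableSet_Ioc fun r hr => ?_))
          rw [mul_left_comm]
          refine mul_le_mul_right ?_ _
          calc _ ≤ D * w r ω + ENNReal.ofReal L * (D * w r ω) :=
                add_le_add (hAD r ω) (mul_le_mul_right (hW'D r ω hr.1.le) _)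
            _ = _ := by ring
      _ = _ := by
          rw [lintegral_const_mul _ (by fun_prop), hJ]
          ring
  calc ∫⁻ ω, ‖Y t ω‖ₑ ^ p ∂P
      ≤ ∫⁻ ω, D ^ p * (2 ^ (p - 1) * (w t ω ^ p + (1 + ENNReal.ofReal L) ^ p * J ω ^ p)) ∂P := by
        refine lintegral_mono_ae (hYle.mono fun ω h => ?_)
        refine (ENNReal.rpow_le_rpow h hp0.le).trans ?_
        rw [ENNReal.mul_rpow_of_nonneg _ _ hp0.le, ← ENNReal.mul_rpow_of_nonneg _ (J ω) hp0.le]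
        exact mul_le_mul_right (ENNReal.rpow_add_le_mul_rpow_add_rpow _ _ hp) _
    _ = D ^ p * (2 ^ (p - 1) * ((∫⁻ ω, w t ω ^ p ∂P) +
          (1 + ENNReal.ofReal L) ^ p * ∫⁻ ω, J ω ^ p ∂P)) := by
        have h1 := hwr t
        rw [lintegral_const_mul _ (by fun_prop), lintegral_const_mul _ (by fun_prop),
          lintegral_add_left (by fun_prop), lintegral_const_mul _ (by fun_prop)]
    _ ≤ D ^ p * (2 ^ (p - 1) * (B' + (1 + ENNReal.ofReal L) ^ p *
          (ENNReal.ofReal (1 / (β 0 - L)) ^ p * B'))) := by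
        refine mul_le_mul_right (mul_le_mul_right (add_le_add (hwB t ⟨hst, le_rfl⟩)
          (mul_le_mul_right ?_ _)) _) _
        exact lintegral_kernel_rpow_le hκ hp hwm fun r hr => hwB r (Ioc_subset_Icc_self hr)
    _ = _ := mul_comm _ _

end Solutions

/-! ### Solutions as functions of past or future increments -/

section Adapted

variable {H : Type*} [NormedAddCommGroup H] [InnerProductSpace ℝ H] [CompleteSpace H]
  [MeasurableSpace H] [BorelSpace H] {e : HilbertBasis ℕ ℝ H} {α : ℝ} {β γ : ℕ → ℝ}
  {Ω : Type*} [mΩ : MeasurableSpace Ω] {P : Measure Ω} [IsProbabilityMeasure P]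
  {Z Ztilde : ℕ → ℝ≥0 → Ω → ℝ} (hN : IsStableNoise P α β γ Z Ztilde)
  {F : ℝ → H → H} {A L : ℝ}

-- Fubini and the time-uniform first moment give integrable paths; regularity of the convolution as
-- an `H`-valued path is never needed.
include hN in
omit [CompleteSpace H] in
theorem ae_intervalIntegrable_stochConv {s T : ℝ} (hsT : s ≤ T) {W : ℝ → Ω → H}
    (hW : Measurable (Function.uncurry W))
    (hW2 : ∀ t ∈ Icc s T, ∀ᵐ ω ∂P, IsStochConv e β γ (twoSided Z Ztilde) s t ω (W t ω)) :
    ∀ᵐ ω ∂P, IntervalIntegrable (fun r => W r ω) volume s T := by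
  have hsc := e.secondCountableTopology
  obtain ⟨B, hB, hmom⟩ := exists_lintegral_stochConv_le e hN.pos hN.one_lt hN.coeff_pos hN.summable
    hN.right hN.left one_pos hN.one_lt
  have hm : Measurable fun q : Ω × ℝ => ‖W q.2 q.1‖ₑ := (hW.comp measurable_swap).enorm
  have h1 : ∫⁻ ω, (∫⁻ r in Ioc s T, ‖W r ω‖ₑ) ∂P ≠ ∞ := by
    rw [lintegral_lintegral_swap hm.aemeasurable]
    refine ne_top_of_le_ne_top (b := ∫⁻ r in Ioc s T, B) ?_
      (setLIntegral_mono' measurableSet_Ioc fun r hr => ?_)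
    · rw [lintegral_const]
      exact ENNReal.mul_ne_top hB (by simp)
    · have h2 := hmom s r hr.1.le (W r) (hW.of_uncurry_left).aemeasurable
        (hW2 r (Ioc_subset_Icc_self hr))
      simpa using h2
  filter_upwards [ae_lt_top hm.lintegral_prod_right' h1] with ω hω
  rw [intervalIntegrable_iff_integrableOn_Ioc_of_le hsT]
  exact ⟨hW.of_uncurry_right.aestronglyMeasurable, hω⟩

include hN in
/-- Existence of a mild solution measurable with respect to a σ-algebra which contains the
increments of a version `X` of the noise. -/
theorem exists_measurable_isMildFrom (hF : IsDissipativeDrift (β 0) F A L) (y : H) {s T : ℝ}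
    (hsT : s ≤ T) : ∀ m : MeasurableSpace Ω, m ≤ mΩ → ∀ X : ℕ → ℝ → Ω → ℝ,
      (∀ᵐ ω ∂P, ∀ k r, X k r ω = twoSided Z Ztilde k r ω) →
      (∀ k, ∀ r ∈ Icc s T, Measurable[m] fun ω => X k r ω - X k s ω) →
    ∃ Y : ℝ → Ω → H, (∀ t, Measurable[m] (Y t)) ∧
      IsMildFrom (mΩ := mΩ) P e β γ F (twoSided Z Ztilde) s T (fun _ => y) Y := by
  -- The probabilistic facts are recorded for the ambient σ-algebra before the smaller one enters.
  have hpos := hN.pos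
  have hmono := hN.mono
  have hconv := exists_measurable_stochConv e hpos hN.one_lt hN.coeff_pos hN.summable hN.right
    hN.left
  have hint := fun W : ℝ → Ω → H => ae_intervalIntegrable_stochConv (e := e) hN hsT (W := W)
  have hmk := fun Y : ℝ → Ω → H => IsMildFrom.mk (P := P) (e := e) (β := β) (γ := γ) (F := F)
    (Z := twoSided Z Ztilde) (s := s) (T := T) (ξ := fun _ => y) (Y := Y)
  intro m hm X hXZ hX
  obtain ⟨W, hW, hW2⟩ := hconv m hXZ hsT hX
  have hle : @Prod.instMeasurableSpace ℝ Ω _ m ≤ @Prod.instMeasurableSpace ℝ Ω _ mΩ :=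
    sup_le_sup le_rfl (MeasurableSpace.comap_mono hm)
  have hWint := hint W (hW.mono hle le_rfl) hW2
  obtain ⟨Y, hY, hY2⟩ := exists_pathwise_mild e hpos hmono hF.measurable hF.lip hF.growth
    hF.nonneg hF.lt s y hW
  refine ⟨Y, fun t => hY.of_uncurry_left,
    hmk Y (hY.mono hle le_rfl) (fun t ht => ?_) (fun t ht => ?_)⟩
  · filter_upwards [hWint] with ω hω
    exact (hY2 ω t ht.1 (hω.mono_set (by
      rw [uIcc_of_le ht.1, uIcc_of_le hsT]; exact Icc_subset_Icc_right ht.2))).1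
  · filter_upwards [hWint, hW2 t ht] with ω hω h2
    exact ⟨_, h2, (hY2 ω t ht.1 (hω.mono_set (by
      rw [uIcc_of_le ht.1, uIcc_of_le hsT]; exact Icc_subset_Icc_right ht.2))).2⟩

include hN in
theorem IsMildFrom.ae_eq (hF : IsDissipativeDrift (β 0) F A L) {s T : ℝ} (hsT : s ≤ T)
    {ξ : Ω → H} (hξ : Measurable ξ) {Y Y' : ℝ → Ω → H}
    (hY : IsMildFrom P e β γ F (twoSided Z Ztilde) s T ξ Y)
    (hY' : IsMildFrom P e β γ F (twoSided Z Ztilde) s T ξ Y') : Y T =ᵐ[P] Y' T := by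
  filter_upwards [hY.enorm_sub_le hN.pos hN.mono hF.measurable hF.lip hF.nonneg hF.lt hξ hξ hY' hsT]
    with ω h
  simpa [sub_eq_zero] using h

include hN in
/-- Mild solutions depend on the noise before the final time only. -/
theorem IsMildFrom.exists_measurable_noisePast (hF : IsDissipativeDrift (β 0) F A L) {s T : ℝ}
    (hsT : s ≤ T) {y : H} {Y : ℝ → Ω → H}
    (hY : IsMildFrom P e β γ F (twoSided Z Ztilde) s T (fun _ => y) Y) :
    ∃ V : Ω → H, Measurable[noisePast Z Ztilde T] V ∧ Y T =ᵐ[P] V := by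
  obtain ⟨V, hV, hV2⟩ := exists_measurable_isMildFrom (e := e) hN hF y hsT _
    (noisePast_le hN.right hN.left T) _ (ae_centeredNoise_eq hN.right hN.left) fun k r hr => by
      have h := (measurable_centeredNoise_sub_of_le (Z := Z) (Ztilde := Ztilde) k hr.2).sub
        (measurable_centeredNoise_sub_of_le k hsT)
      simpa only [Pi.sub_def, sub_sub_sub_cancel_right] using h
  exact ⟨V T, hV T, hY.ae_eq hN hF hsT measurable_const hV2⟩

include hN in
/-- Mild solutions depend on the noise after the initial time only. -/
theorem IsMildFrom.exists_measurable_noiseFuture (hF : IsDissipativeDrift (β 0) F A L) {s T : ℝ}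
    (hsT : s ≤ T) {y : H} {Y : ℝ → Ω → H}
    (hY : IsMildFrom P e β γ F (twoSided Z Ztilde) s T (fun _ => y) Y) :
    ∃ V : Ω → H, Measurable[noiseFuture Z Ztilde s] V ∧ Y T =ᵐ[P] V := by
  obtain ⟨V, hV, hV2⟩ := exists_measurable_isMildFrom (e := e) hN hF y hsT _
    (noiseFuture_le hN.right hN.left s) _ (ae_centeredNoise_eq hN.right hN.left) fun k r hr =>
      measurable_centeredNoise_sub_of_ge k hr.1
  exact ⟨V T, hV T, hY.ae_eq hN hF hsT measurable_const hV2⟩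

include hN in
/-- Solutions up to time `s` are independent of solutions started from a point at time `s`. -/
theorem IsMildFrom.indepFun (hF : IsDissipativeDrift (β 0) F A L) {u s T : ℝ} (hus : u ≤ s)
    (hsT : s ≤ T) {y y' : H} {Y Y' : ℝ → Ω → H}
    (hY : IsMildFrom P e β γ F (twoSided Z Ztilde) u s (fun _ => y) Y)
    (hY' : IsMildFrom P e β γ F (twoSided Z Ztilde) s T (fun _ => y') Y') :
    IndepFun (Y s) (Y' T) P := by
  obtain ⟨V, hV, hYV⟩ := hY.exists_measurable_noisePast hN hF hus
  obtain ⟨V', hV', hYV'⟩ := hY'.exists_measurable_noiseFuture hN hF hsT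
  have h := indep_of_indep_of_le_left (indep_of_indep_of_le_right
    (indep_noisePast_noiseFuture hN.right hN.left hN.indep s) hV'.comap_le) hV.comap_le
  exact IndepFun.congr h hYV.symm hYV'.symm

-- Versions on the intervals `[s, s + n]` are patched with `n = ⌈t - s⌉₊`; the defining property is
-- required only at each fixed time, so the versions need not agree.
include hN in
theorem exists_stochConv_Ici (s : ℝ) :
    ∃ W : ℝ → Ω → H, Measurable (Function.uncurry W) ∧
      ∀ t, s ≤ t → ∀ᵐ ω ∂P, IsStochConv e β γ (twoSided Z Ztilde) s t ω (W t ω) := by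
  choose W hW hW2 using fun n : ℕ => exists_measurable_stochConv e hN.pos hN.one_lt hN.coeff_pos
    hN.summable hN.right hN.left mΩ (ae_of_all P fun ω k r => rfl)
    (show s ≤ s + n by linarith [n.cast_nonneg (α := ℝ)])
    (fun k r _ => (measurable_twoSided hN.right hN.left k r).sub
      (measurable_twoSided hN.right hN.left k s))
  refine ⟨fun t => W ⌈t - s⌉₊ t, ?_, fun t ht => hW2 _ t ⟨ht, ?_⟩⟩
  · have h1 : Measurable fun q : ℕ × (ℝ × Ω) => Function.uncurry (W q.1) q.2 :=
      measurable_from_prod_countable_right fun n => hW n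
    have h2 : Measurable fun p : ℝ × Ω => (⌈p.1 - s⌉₊, p) :=
      (Nat.measurable_ceil.comp (by fun_prop)).prodMk measurable_id
    exact h1.comp h2
  · linarith [Nat.le_ceil (t - s)]

include hN in
theorem exists_isMildSolution {G : ℝ → H → H → H} {x : H}
    (hF : IsDissipativeDrift (β 0) (fun t => G t x) A L) (s : ℝ) (y : H) :
    ∃ Y, IsMildSolution P e β γ G (twoSided Z Ztilde) s x y Y := by
  obtain ⟨W, hW, hW2⟩ := exists_stochConv_Ici (e := e) hN s
  have hWint := fun t ht => ae_intervalIntegrable_stochConv (e := e) hN (s := s) (T := t) ht hW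
    fun r hr => hW2 r hr.1
  obtain ⟨Y, hY, hY2⟩ := exists_pathwise_mild e hN.pos hN.mono hF.measurable hF.lip hF.growth
    hF.nonneg hF.lt s y hW
  refine ⟨Y, ?_, fun t ht => ?_, fun t ht => ?_⟩
  · exact hY.comp (by fun_prop : Measurable fun p : Ici s × Ω => ((p.1 : ℝ), p.2))
  · filter_upwards [hWint t ht] with ω hω
    exact (hY2 ω t ht hω).1
  · filter_upwards [hWint t ht, hW2 t ht] with ω hω h2
    exact ⟨_, h2, (hY2 ω t ht hω).2⟩

end Adapted

/-! ### Contractive flows: pullback limit and Markov property -/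

section Flow

variable {H : Type*} [NormedAddCommGroup H] [MeasurableSpace H] [BorelSpace H]
  {Ω : Type*} [MeasurableSpace Ω] {P : Measure Ω}

/-- A stochastic flow with independent increments which contracts exponentially fast and whose
orbit of `0` is bounded in `L¹`. -/
structure IsContractiveFlow (P : Measure Ω) (K l M : ℝ) (Φ : ℝ → H → ℝ → Ω → H) : Prop where
  rate_pos : 0 < l
  const_nonneg : 0 ≤ K
  bound_nonneg : 0 ≤ M
  measurable : ∀ s t y, s ≤ t → Measurable (Φ s y t)
  start : ∀ s y, Φ s y s =ᵐ[P] fun _ => y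
  contract : ∀ u s t, u ≤ s → s ≤ t → ∀ y z, ∀ᵐ ω ∂P,
    ‖Φ u y t ω - Φ s z t ω‖ ≤ K * Real.exp (-l * (t - s)) * ‖Φ u y s ω - z‖
  indep : ∀ u s t, u ≤ s → s ≤ t → ∀ y z, IndepFun (Φ u y s) (Φ s z t) P
  moment : ∀ s t, s ≤ t → eLpNorm (Φ s 0 t) 1 P ≤ ENNReal.ofReal M

variable {K l M : ℝ} {Φ : ℝ → H → ℝ → Ω → H} (hΦ : IsContractiveFlow P K l M Φ)

include hΦ in
omit [BorelSpace H] in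
theorem IsContractiveFlow.norm_sub_le {s t : ℝ} (hst : s ≤ t) (y z : H) : ∀ᵐ ω ∂P,
    ‖Φ s y t ω - Φ s z t ω‖ ≤ K * Real.exp (-l * (t - s)) * ‖y - z‖ := by
  filter_upwards [hΦ.contract s s t le_rfl hst y z, hΦ.start s y] with ω h1 h2
  rwa [h2] at h1

variable [IsProbabilityMeasure P] [SecondCountableTopology H]

-- The orbit of `0` started at `u` is viewed as an orbit restarted at `s` from its random position;
-- only the moments of that position matter, uniformly in `u`.
include hΦ in
theorem IsContractiveFlow.eLpNorm_sub_le {p : ℝ≥0∞} (hp : 1 ≤ p) {u s t : ℝ} (hus : u ≤ s)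
    (hst : s ≤ t) (z : H) :
    eLpNorm (fun ω => Φ u 0 t ω - Φ s z t ω) p P ≤
      ENNReal.ofReal (K * Real.exp (-l * (t - s))) * (eLpNorm (Φ u 0 s) p P + ‖z‖ₑ) := by
  have hp0 : p ≠ 0 := (one_pos.trans_le hp).ne'
  refine (eLpNorm_le_mul_eLpNorm_of_ae_le_mul (g := Φ u 0 s - fun _ => z)
    (hΦ.contract u s t hus hst 0 z) p).trans (mul_le_mul_right ?_ _)
  refine (_root_.MeasureTheory.eLpNorm_sub_le (hΦ.measurable u s 0 hus).aestronglyMeasurable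
    aestronglyMeasurable_const hp).trans (le_of_eq ?_)
  rw [eLpNorm_const z hp0 (IsProbabilityMeasure.ne_zero P), measure_univ, ENNReal.one_rpow, mul_one]

include hΦ in
/-- The pullback limit of a contractive flow and the rate of convergence. -/
theorem IsContractiveFlow.exists_pullback [CompleteSpace H] (t : ℝ) :
    ∃ η : Ω → H, Measurable η ∧ ∀ (p C : ℝ≥0∞), 1 ≤ p →
      (∀ s r, s ≤ r → eLpNorm (Φ s 0 r) p P ≤ C) → ∀ s, s ≤ t → ∀ y,
        eLpNorm (fun ω => Φ s y t ω - η ω) p P ≤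
          ENNReal.ofReal (K * Real.exp (-l * (t - s))) * (C + ‖y‖ₑ) := by
  have hK := hΦ.const_nonneg
  have hM := hΦ.bound_nonneg
  have hnt : ∀ n : ℕ, t - n ≤ t := fun n => by linarith [n.cast_nonneg (α := ℝ)]
  set f : ℕ → Ω → H := fun n => Φ (t - n) 0 t with hf
  have hfm : ∀ n, AEStronglyMeasurable (f n) P := fun n =>
    (hΦ.measurable _ _ _ (hnt n)).aestronglyMeasurable
  have hexp : ∀ n : ℕ, Real.exp (-l * (t - (t - n))) = Real.exp (-l) ^ n := fun n => by
    rw [← Real.exp_nat_mul]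
    ring_nf
  -- The added `1` makes the Cauchy bound strict; summability of the geometric bound upgrades `L¹`
  -- convergence to almost sure convergence.
  set B : ℕ → ℝ≥0∞ := fun n => ENNReal.ofReal ((K * M + K * M + 1) * Real.exp (-l) ^ n) with hB
  have hBsum : ∑' n, B n ≠ ∞ := by
    have h1 : Summable fun n : ℕ => (K * M + K * M + 1) * Real.exp (-l) ^ n :=
      (summable_geometric_of_lt_one (Real.exp_pos _).le
        (Real.exp_lt_one_iff.2 (by linarith [hΦ.rate_pos]))).mul_left _
    exact h1.tsum_ofReal_ne_top
  have hle : ∀ N n : ℕ, N ≤ n → eLpNorm (f n - f N) 1 P ≤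
      ENNReal.ofReal (K * M * Real.exp (-l) ^ N) := by
    intro N n hNn
    have h2 : t - n ≤ t - N := sub_le_sub_left (by exact_mod_cast hNn) t
    refine (hΦ.eLpNorm_sub_le le_rfl h2 (hnt N) 0).trans ?_
    rw [enorm_zero, add_zero, hexp]
    refine (mul_le_mul_right (hΦ.moment _ _ h2) _).trans (le_of_eq ?_)
    rw [← ENNReal.ofReal_mul (by positivity)]
    ring_nf
  have hcau : ∀ N n m : ℕ, N ≤ n → N ≤ m → eLpNorm (f n - f m) 1 P < B N := by
    intro N n m hn hm
    have h1 : f n - f m = (f n - f N) - (f m - f N) := by abel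
    rw [h1]
    refine (_root_.MeasureTheory.eLpNorm_sub_le ((hfm n).sub (hfm N)) ((hfm m).sub (hfm N))
      le_rfl).trans_lt ((add_le_add (hle N n hn) (hle N m hm)).trans_lt ?_)
    have hq := pow_pos (Real.exp_pos (-l)) N
    rw [← ENNReal.ofReal_add (by positivity) (by positivity), hB,
      ENNReal.ofReal_lt_ofReal_iff (by positivity)]
    nlinarith
  obtain ⟨η, hη, hlim⟩ := exists_stronglyMeasurable_limit_of_tendsto_ae hfm
    (Lp.ae_tendsto_of_cauchy_eLpNorm hfm le_rfl hBsum hcau)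
  refine ⟨η, hη.measurable, fun p C hp hC s hst y => ?_⟩
  have hlim2 : ∀ᵐ ω ∂P, Tendsto (fun n => f n ω - Φ s y t ω) atTop (𝓝 (η ω - Φ s y t ω)) :=
    hlim.mono fun ω h => h.sub_const _
  -- Fatou's lemma: the one almost sure limit inherits the bound for every exponent with bounded
  -- moments.
  have h1 := Lp.eLpNorm_lim_le_liminf_eLpNorm (p := p) (f := fun n ω => f n ω - Φ s y t ω)
    (fun n => (hfm n).sub (hΦ.measurable _ _ _ hst).aestronglyMeasurable) _ hlim2
  have h2 : eLpNorm (fun ω => Φ s y t ω - η ω) p P = eLpNorm (fun ω => η ω - Φ s y t ω) p P :=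
    eLpNorm_sub_comm (fun ω => Φ s y t ω) η p P
  rw [h2]
  refine h1.trans (liminf_le_of_frequently_le' (Eventually.frequently ?_))
  filter_upwards [eventually_ge_atTop ⌈t - s⌉₊] with n hn
  have hns : t - n ≤ s := by linarith [Nat.ceil_le.1 hn]
  exact (hΦ.eLpNorm_sub_le hp hns hst y).trans
    (mul_le_mul_right (add_le_add (hC _ _ hns) le_rfl) _)

-- The Feller property, from the contraction estimate and dominated convergence.
include hΦ in
omit [SecondCountableTopology H] in
theorem IsContractiveFlow.continuous_integral (φ : H →ᵇ ℝ) {s t : ℝ} (hst : s ≤ t) :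
    Continuous fun y => ∫ ω, φ (Φ s y t ω) ∂P := by
  rw [continuous_iff_seqContinuous]
  intro y z hyz
  have h1 : ∀ᵐ ω ∂P, ∀ n, ‖Φ s (y n) t ω - Φ s z t ω‖ ≤ K * Real.exp (-l * (t - s)) * ‖y n - z‖ :=
    ae_all_iff.2 fun n => hΦ.norm_sub_le hst _ _
  refine tendsto_integral_of_dominated_convergence (fun _ => ‖φ‖)
    (fun n => (φ.continuous.measurable.comp (hΦ.measurable s t (y n) hst)).aestronglyMeasurable)
    (integrable_const _) (fun n => ae_of_all _ fun ω => φ.norm_coe_le_norm _) ?_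
  filter_upwards [h1] with ω hω
  refine (φ.continuous.tendsto _).comp (tendsto_iff_norm_sub_tendsto_zero.2 ?_)
  refine squeeze_zero (fun _ => norm_nonneg _) hω ?_
  simpa using (tendsto_iff_norm_sub_tendsto_zero.1 hyz).const_mul (K * Real.exp (-l * (t - s)))

-- For a discretised initial value the Markov property is a finite sum over its values, and
-- independence is applied to each summand.
include hΦ in
omit [SecondCountableTopology H] in
theorem IsContractiveFlow.integral_simpleFunc (φ : H →ᵇ ℝ) {u s t : ℝ} (hus : u ≤ s) (hst : s ≤ t)
    (y : H) (a : SimpleFunc H H) :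
    ∫ ω, φ (Φ s (a (Φ u y s ω)) t ω) ∂P =
      ∫ ω, (∫ ω', φ (Φ s (a (Φ u y s ω)) t ω') ∂P) ∂P := by
  classical
  set g : H → H → ℝ := fun c => (a ⁻¹' {c}).indicator fun _ => 1 with hg
  have hgm : ∀ c, Measurable (g c) := fun c => measurable_const.indicator (a.measurableSet_fiber c)
  have hsum : ∀ (h : H → ℝ) (z : H), h (a z) = ∑ c ∈ a.range, g c z * h c := by
    intro h z
    rw [Finset.sum_eq_single (a z)]
    · simp [hg]
    · intro c _ hc
      simp [hg, hc.symm]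
    · intro hz
      exact absurd (a.mem_range_self z) hz
  have hξ := hΦ.measurable u s y hus
  have hgint : ∀ c, Integrable (fun ω => g c (Φ u y s ω)) P := fun c =>
    Integrable.of_bound ((hgm c).comp hξ).aestronglyMeasurable 1 (ae_of_all _ fun ω => by
      simp only [hg, indicator]
      split_ifs <;> simp)
  have hφm : ∀ c, Measurable fun ω => φ (Φ s c t ω) := fun c =>
    φ.continuous.measurable.comp (hΦ.measurable s t c hst)
  have hφint : ∀ c, Integrable (fun ω => g c (Φ u y s ω) * φ (Φ s c t ω)) P := fun c =>
    (hgint c).mul_bdd (c := ‖φ‖) (hφm c).aestronglyMeasurable (ae_of_all _ fun ω => φ.norm_coe_le_norm _)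
  have h1 : ∀ ω, φ (Φ s (a (Φ u y s ω)) t ω) =
      ∑ c ∈ a.range, g c (Φ u y s ω) * φ (Φ s c t ω) := fun ω =>
    hsum (fun c => φ (Φ s c t ω)) _
  have h2 : ∀ ω, ∫ ω', φ (Φ s (a (Φ u y s ω)) t ω') ∂P =
      ∑ c ∈ a.range, g c (Φ u y s ω) * ∫ ω', φ (Φ s c t ω') ∂P := fun ω =>
    hsum (fun c => ∫ ω', φ (Φ s c t ω') ∂P) _
  simp_rw [h1, h2]
  rw [integral_finsetSum _ fun c _ => hφint c,
    integral_finsetSum _ fun c _ => (hgint c).mul_const _]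
  refine Finset.sum_congr rfl fun c _ => ?_
  rw [integral_mul_const]
  exact (hΦ.indep u s t hus hst y c).integral_fun_comp_mul_comp hξ.aemeasurable
    (hΦ.measurable s t c hst).aemeasurable (hgm c).aestronglyMeasurable
    φ.continuous.aestronglyMeasurable

include hΦ in
/-- The Markov property of a contractive flow. -/
theorem IsContractiveFlow.integral_integral (φ : H →ᵇ ℝ) {u s t : ℝ} (hus : u ≤ s) (hst : s ≤ t)
    (y : H) :
    ∫ ω, (∫ ω', φ (Φ s (Φ u y s ω) t ω') ∂P) ∂P = ∫ ω, φ (Φ u y t ω) ∂P := by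
  have hid : StronglyMeasurable (id : H → H) := stronglyMeasurable_id
  -- The initial value is discretised because no joint measurability of the flow in `(z, ω)` is
  -- assumed.
  set a : ℕ → SimpleFunc H H := hid.approx with ha
  have halim : ∀ z, Tendsto (fun n => a n z) atTop (𝓝 z) := hid.tendsto_approx
  have hξ := hΦ.measurable u s y hus
  have hcont := hΦ.continuous_integral φ hst
  have hbd : ∀ z, ‖∫ ω, φ (Φ s z t ω) ∂P‖ ≤ ‖φ‖ := fun z => by
    simpa using norm_integral_le_of_norm_le_const (μ := P)
      (ae_of_all _ fun ω => φ.norm_coe_le_norm (Φ s z t ω))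
  -- The null set in the contraction estimate depends on the starting point; only countably many
  -- starting points occur here.
  have hctr : ∀ᵐ ω ∂P, ∀ n, ∀ c ∈ (a n).range,
      ‖Φ u y t ω - Φ s c t ω‖ ≤ K * Real.exp (-l * (t - s)) * ‖Φ u y s ω - c‖ :=
    ae_all_iff.2 fun n => (Finset.eventually_all _).2 fun c _ => hΦ.contract u s t hus hst y c
  have hL : Tendsto (fun n => ∫ ω, φ (Φ s (a n (Φ u y s ω)) t ω) ∂P) atTop
      (𝓝 (∫ ω, φ (Φ u y t ω) ∂P)) := by
    refine tendsto_integral_of_dominated_convergence (fun _ => ‖φ‖) (fun n => ?_)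
      (integrable_const _) (fun n => ae_of_all _ fun ω => φ.norm_coe_le_norm _) ?_
    · exact (φ.continuous.measurable.comp (((a n).comp _ hξ).measurable_bind (fun c => Φ s c t)
        fun c => hΦ.measurable s t c hst)).aestronglyMeasurable
    · filter_upwards [hctr] with ω hω
      refine (φ.continuous.tendsto _).comp (tendsto_iff_norm_sub_tendsto_zero.2 ?_)
      simp_rw [norm_sub_rev _ (Φ u y t ω)]
      refine squeeze_zero (fun _ => norm_nonneg _) (fun n => hω n _ ((a n).mem_range_self _)) ?_
      have h1 := (tendsto_iff_norm_sub_tendsto_zero.1 (halim (Φ u y s ω))).const_mul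
        (K * Real.exp (-l * (t - s)))
      simp_rw [norm_sub_rev _ (Φ u y s ω)] at h1
      simpa using h1
  have hR : Tendsto (fun n => ∫ ω, (∫ ω', φ (Φ s (a n (Φ u y s ω)) t ω') ∂P) ∂P) atTop
      (𝓝 (∫ ω, (∫ ω', φ (Φ s (Φ u y s ω) t ω') ∂P) ∂P)) := by
    refine tendsto_integral_of_dominated_convergence (fun _ => ‖φ‖) (fun n => ?_)
      (integrable_const _) (fun n => ae_of_all _ fun ω => hbd _) ?_
    · exact (hcont.measurable.comp ((a n).measurable.comp hξ)).aestronglyMeasurable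
    · exact ae_of_all _ fun ω => (hcont.tendsto _).comp (halim _)
  refine tendsto_nhds_unique hR (hL.congr fun n => ?_)
  exact hΦ.integral_simpleFunc φ hus hst y (a n)

include hΦ in
theorem IsContractiveFlow.tendsto_integral_pullback {t : ℝ} {η : Ω → H} (hη : AEMeasurable η P)
    (hlim : Tendsto (fun s => eLpNorm (fun ω => Φ s 0 t ω - η ω) 1 P) atBot (𝓝 0)) (φ : H →ᵇ ℝ)
    {τ : ℕ → ℝ} (hτ : Tendsto τ atTop atBot) (hτt : ∀ n, τ n ≤ t) :
    Tendsto (fun n => ∫ ω, φ (Φ (τ n) 0 t ω) ∂P) atTop (𝓝 (∫ ω, φ (η ω) ∂P)) := by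
  have hm : ∀ n, Measurable (Φ (τ n) 0 t) := fun n => hΦ.measurable _ _ _ (hτt n)
  have h1 : TendstoInMeasure P (fun n => Φ (τ n) 0 t) atTop η :=
    tendstoInMeasure_of_tendsto_eLpNorm one_ne_zero (fun n => (hm n).aestronglyMeasurable)
      hη.aestronglyMeasurable (hlim.comp hτ)
  have h2 := (h1.tendstoInDistribution_of_aemeasurable (fun n => (hm n).aemeasurable) hη).tendsto
  have h3 := ProbabilityMeasure.tendsto_iff_forall_integral_tendsto.1 h2 φ
  simp only [ProbabilityMeasure.coe_mk] at h3
  rw [integral_map hη φ.continuous.aestronglyMeasurable] at h3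
  refine h3.congr fun n => ?_
  rw [integral_map (hm n).aemeasurable φ.continuous.aestronglyMeasurable]

-- The Markov property for orbits of `0` started at `s - n`, passed to the limit. On the left the
-- test function is the transition operator applied to `φ`, bounded and continuous by the Feller
-- property.
include hΦ in
theorem IsContractiveFlow.isEvolutionSystem {η : ℝ → Ω → H} (hη : ∀ t, AEMeasurable (η t) P)
    (hlim : ∀ t, Tendsto (fun s => eLpNorm (fun ω => Φ s 0 t ω - η t ω) 1 P) atBot (𝓝 0)) :
    IsEvolutionSystem (fun s t φ y => ∫ ω, φ (Φ s y t ω) ∂P) fun t => P.map (η t) := by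
  refine ⟨fun t => Measure.isProbabilityMeasure_map (hη t), fun s t hst φ => ?_⟩
  have hcont := hΦ.continuous_integral φ hst
  have hbd : ∀ z, ‖∫ ω, φ (Φ s z t ω) ∂P‖ ≤ ‖φ‖ := fun z => by
    simpa using norm_integral_le_of_norm_le_const (μ := P)
      (ae_of_all _ fun ω => φ.norm_coe_le_norm (Φ s z t ω))
  set ψ : H →ᵇ ℝ := BoundedContinuousFunction.ofNormedAddCommGroup _ hcont ‖φ‖ hbd with hψ
  rw [integral_map (hη s) hcont.aestronglyMeasurable,
    integral_map (hη t) φ.continuous.aestronglyMeasurable]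
  have hτ : Tendsto (fun n : ℕ => s - n) atTop atBot :=
    tendsto_const_nhds.add_atBot (tendsto_neg_atTop_atBot.comp tendsto_natCast_atTop_atTop)
  have hτs : ∀ n : ℕ, s - n ≤ s := fun n => by linarith [n.cast_nonneg (α := ℝ)]
  refine tendsto_nhds_unique (hΦ.tendsto_integral_pullback (hη s) (hlim s) ψ hτ hτs)
    ((hΦ.tendsto_integral_pullback (hη t) (hlim t) φ hτ fun n => (hτs n).trans hst).congr
      fun n => ?_)
  exact (hΦ.integral_integral φ (hτs n) hst 0).symm

end Flow

/-! ### Exponential convergence and uniqueness of the evolution system -/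

section Ergodic

variable {H : Type*} [NormedAddCommGroup H]

theorem bddAbove_lipConst_set {φ : H → ℝ} {κ : ℝ≥0} (hφ : LipschitzWith κ φ) :
    BddAbove {q : ℝ | ∃ x y : H, x ≠ y ∧ q = |φ x - φ y| / ‖x - y‖} := by
  refine ⟨κ, ?_⟩
  rintro q ⟨x, y, hxy, rfl⟩
  rw [div_le_iff₀ (norm_pos_iff.2 (sub_ne_zero.2 hxy))]
  simpa [dist_eq_norm] using hφ.dist_le_mul x y

theorem lipConst_nonneg (φ : H → ℝ) : 0 ≤ lipConst φ := by
  refine Real.sSup_nonneg ?_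
  rintro q ⟨x, y, -, rfl⟩
  positivity

theorem abs_sub_le_lipConst_mul {φ : H → ℝ} {κ : ℝ≥0} (hφ : LipschitzWith κ φ) (x y : H) :
    |φ x - φ y| ≤ lipConst φ * ‖x - y‖ := by
  rcases eq_or_ne x y with rfl | hxy
  · simp
  · rw [← div_le_iff₀ (norm_pos_iff.2 (sub_ne_zero.2 hxy))]
    exact le_csSup (bddAbove_lipConst_set hφ) ⟨x, y, hxy, rfl⟩

theorem LipschitzWith.integrable_comp {φ : H → ℝ} {κ : ℝ≥0} (hφ : LipschitzWith κ φ)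
    {Ω : Type*} [MeasurableSpace Ω] {P : Measure Ω} [IsFiniteMeasure P] {f : Ω → H}
    (hf : Integrable f P) : Integrable (fun ω => φ (f ω)) P := by
  refine ((hf.norm.const_mul κ).add (integrable_const |φ 0|)).mono'
    (hφ.continuous.comp_aestronglyMeasurable hf.1) (ae_of_all _ fun ω => ?_)
  have h := hφ.dist_le_mul (f ω) 0
  rw [Real.dist_eq, dist_zero_right] at h
  have h2 := abs_add_le (φ (f ω) - φ 0) (φ 0)
  rw [sub_add_cancel] at h2
  simp only [Real.norm_eq_abs, Pi.add_apply]
  linarith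

variable [MeasurableSpace H] [BorelSpace H] [SecondCountableTopology H]
  {Ω : Type*} [MeasurableSpace Ω] {P : Measure Ω} [IsProbabilityMeasure P]
  {K l M : ℝ} {Φ : ℝ → H → ℝ → Ω → H} (hΦ : IsContractiveFlow P K l M Φ)

-- The triangle inequality through the orbit of `0` started at `u`, with `u → -∞`. The bound refers
-- to any pullback limit, however it was constructed.
include hΦ in
theorem IsContractiveFlow.eLpNorm_sub_pullback_le {t : ℝ} {η : Ω → H}
    (hη : AEStronglyMeasurable η P)
    (hlim : Tendsto (fun s => eLpNorm (fun ω => Φ s 0 t ω - η ω) 1 P) atBot (𝓝 0)) {s : ℝ}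
    (hst : s ≤ t) (y : H) :
    eLpNorm (fun ω => Φ s y t ω - η ω) 1 P ≤
      ENNReal.ofReal (K * Real.exp (-l * (t - s)) * (M + ‖y‖)) := by
  have hK := hΦ.const_nonneg
  have hM := hΦ.bound_nonneg
  have h1 : Tendsto (fun u => ENNReal.ofReal (K * Real.exp (-l * (t - s)) * (M + ‖y‖)) +
      eLpNorm (fun ω => Φ u 0 t ω - η ω) 1 P) atBot
      (𝓝 (ENNReal.ofReal (K * Real.exp (-l * (t - s)) * (M + ‖y‖)) + 0)) :=
    hlim.const_add _
  rw [add_zero] at h1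
  refine ge_of_tendsto h1 ?_
  filter_upwards [eventually_le_atBot s] with u hus
  have hu := (hΦ.measurable u t 0 (hus.trans hst)).aestronglyMeasurable (μ := P)
  have hs := (hΦ.measurable s t y hst).aestronglyMeasurable (μ := P)
  have h2 : (fun ω => Φ s y t ω - η ω) = (Φ u 0 t - η) - (Φ u 0 t - Φ s y t) := by
    funext ω
    simp only [Pi.sub_apply]
    abel
  rw [h2]
  refine (MeasureTheory.eLpNorm_sub_le (hu.sub hη) (hu.sub hs) le_rfl).trans ?_
  rw [add_comm]
  refine add_le_add ((hΦ.eLpNorm_sub_le le_rfl hus hst y).trans ?_) le_rfl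
  rw [ENNReal.ofReal_mul (q := M + ‖y‖) (by positivity), ENNReal.ofReal_add hM (norm_nonneg y),
    ofReal_norm]
  exact mul_le_mul_right (add_le_add (hΦ.moment u s hus) le_rfl) _

include hΦ in
/-- Exponential convergence to the law of the pullback limit. -/
theorem IsContractiveFlow.abs_integral_sub_le {t : ℝ} {η : Ω → H} (hη : MemLp η 1 P)
    (hlim : Tendsto (fun s => eLpNorm (fun ω => Φ s 0 t ω - η ω) 1 P) atBot (𝓝 0)) {s : ℝ}
    (hst : s ≤ t) (y : H) {φ : H → ℝ} {κ : ℝ≥0} (hφ : LipschitzWith κ φ) :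
    Integrable (fun ω => φ (Φ s y t ω)) P ∧ Integrable φ (P.map η) ∧
      |∫ ω, φ (Φ s y t ω) ∂P - ∫ z, φ z ∂(P.map η)| ≤
        lipConst φ * (K * Real.exp (-l * (t - s)) * (M + ‖y‖)) := by
  have hK := hΦ.const_nonneg
  have hM := hΦ.bound_nonneg
  have hηm := hη.1.aemeasurable
  have hrate := hΦ.eLpNorm_sub_pullback_le hη.1 hlim hst y
  have hdiff : Integrable (fun ω => Φ s y t ω - η ω) P := by
    rw [← memLp_one_iff_integrable]
    exact ⟨(hΦ.measurable s t y hst).aestronglyMeasurable.sub hη.1,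
      hrate.trans_lt ENNReal.ofReal_lt_top⟩
  have hηi : Integrable η P := memLp_one_iff_integrable.1 hη
  have hΦi : Integrable (Φ s y t) P := by
    have h1 := hdiff.add hηi
    simpa [Pi.add_def] using h1
  have h1 := hφ.integrable_comp hΦi
  have h2 := hφ.integrable_comp hηi
  refine ⟨h1, (integrable_map_measure hφ.continuous.aestronglyMeasurable hηm).2 h2, ?_⟩
  rw [integral_map hηm hφ.continuous.aestronglyMeasurable, ← integral_sub h1 h2]
  calc |∫ ω, (φ (Φ s y t ω) - φ (η ω)) ∂P| ≤ ∫ ω, |φ (Φ s y t ω) - φ (η ω)| ∂P :=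
        abs_integral_le_integral_abs
    _ ≤ ∫ ω, lipConst φ * ‖Φ s y t ω - η ω‖ ∂P :=
        integral_mono (h1.sub h2).abs (hdiff.norm.const_mul _)
          fun ω => abs_sub_le_lipConst_mul hφ _ _
    _ = lipConst φ * ∫ ω, ‖Φ s y t ω - η ω‖ ∂P := integral_const_mul _ _
    _ ≤ _ := by
        refine mul_le_mul_of_nonneg_left ?_ (lipConst_nonneg φ)
        rw [integral_norm_eq_lintegral_enorm hdiff.1, ← eLpNorm_one_eq_lintegral_enorm]
        exact ENNReal.toReal_le_of_le_ofReal (by positivity) hrate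

-- The rate at `s = t` and `y = 0`, where the flow still sits at `0`, bounds the first moment by `K
-- * M` for every `t`.
include hΦ in
theorem IsContractiveFlow.hasBoundedFirstMoments {η : ℝ → Ω → H}
    (hη : ∀ t, AEStronglyMeasurable (η t) P)
    (hlim : ∀ t, Tendsto (fun s => eLpNorm (fun ω => Φ s 0 t ω - η t ω) 1 P) atBot (𝓝 0)) :
    HasBoundedFirstMoments fun t => P.map (η t) := by
  refine lt_of_le_of_lt (iSup_le fun t => ?_) (ENNReal.ofReal_lt_top (r := K * M))
  rw [lintegral_map' (by fun_prop) (hη t).aemeasurable]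
  have h1 := hΦ.eLpNorm_sub_pullback_le (hη t) (hlim t) le_rfl 0
  rw [sub_self, mul_zero, Real.exp_zero, mul_one, norm_zero, add_zero,
    eLpNorm_one_eq_lintegral_enorm] at h1
  refine le_trans (le_of_eq (lintegral_congr_ae ?_)) h1
  filter_upwards [hΦ.start t 0] with ω h
  rw [h, zero_sub, enorm_neg]

-- Bounded Lipschitz functions test weak convergence; apply this to a constant sequence and use
-- uniqueness of limits.
omit [SecondCountableTopology H] in
theorem Measure.eq_of_forall_lipschitz_integral_eq {μ ν : Measure H} [IsProbabilityMeasure μ]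
    [IsProbabilityMeasure ν]
    (h : ∀ φ : H →ᵇ ℝ, (∃ κ, LipschitzWith κ φ) → ∫ z, φ z ∂μ = ∫ z, φ z ∂ν) : μ = ν := by
  set μ' : ProbabilityMeasure H := ⟨μ, inferInstance⟩
  set ν' : ProbabilityMeasure H := ⟨ν, inferInstance⟩
  have h1 : Tendsto (fun _ : ℕ => μ') atTop (𝓝 ν') := by
    rw [tendsto_iff_forall_lipschitz_integral_tendsto]
    rintro f ⟨C, hC⟩ ⟨κ, hκ⟩
    have h2 := h (BoundedContinuousFunction.mkOfBound ⟨f, hκ.continuous⟩ C hC) ⟨κ, hκ⟩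
    change Tendsto (fun _ : ℕ => ∫ ω, f ω ∂μ) atTop (𝓝 (∫ ω, f ω ∂ν))
    rw [show ∫ ω, f ω ∂μ = ∫ ω, f ω ∂ν from h2]
    exact tendsto_const_nhds
  have h3 : μ' = ν' := tendsto_nhds_unique tendsto_const_nhds h1
  exact congrArg (fun ρ : ProbabilityMeasure H => (ρ : Measure H)) h3

include hΦ in
/-- Uniqueness of the evolution system of measures with bounded first moments. -/
theorem IsContractiveFlow.eq_of_isEvolutionSystem {η : ℝ → Ω → H} (hη : ∀ t, MemLp (η t) 1 P)
    (hlim : ∀ t, Tendsto (fun s => eLpNorm (fun ω => Φ s 0 t ω - η t ω) 1 P) atBot (𝓝 0))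
    {ν : ℝ → Measure H}
    (hν : IsEvolutionSystem (fun s t φ y => ∫ ω, φ (Φ s y t ω) ∂P) ν)
    (hνm : HasBoundedFirstMoments ν) (t : ℝ) : ν t = P.map (η t) := by
  have hK := hΦ.const_nonneg
  have hM := hΦ.bound_nonneg
  have := hν.isProbabilityMeasure
  have := Measure.isProbabilityMeasure_map (hη t).1.aemeasurable
  refine Measure.eq_of_forall_lipschitz_integral_eq fun φ hφ => ?_
  obtain ⟨κ, hφ⟩ := hφ
  set m : ℝ := (⨆ t, ∫⁻ y, ‖y‖ₑ ∂(ν t)).toReal with hm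
  have hνi : ∀ s, Integrable (fun y : H => ‖y‖) (ν s) := fun s => by
    have h1 : Integrable id (ν s) := ⟨measurable_id.aestronglyMeasurable,
      (le_iSup (fun t => ∫⁻ y, ‖y‖ₑ ∂(ν t)) s).trans_lt hνm⟩
    exact h1.norm
  have hνle : ∀ s, ∫ y, ‖y‖ ∂(ν s) ≤ m := fun s => by
    rw [integral_norm_eq_lintegral_enorm (f := fun y : H => y) measurable_id.aestronglyMeasurable]
    exact ENNReal.toReal_mono hνm.ne (le_iSup (fun t => ∫⁻ y, ‖y‖ₑ ∂(ν t)) s)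
  set c := ∫ z, φ z ∂(P.map (η t)) with hc
  -- Invariance moves the test from time `t` back to time `s`, where the exponential estimate is
  -- integrated against `ν s`; bounded first moments leave a factor that vanishes as `s → -∞`.
  have hbound : ∀ s, s ≤ t → |∫ z, φ z ∂(ν t) - c| ≤
      lipConst φ * (K * Real.exp (-l * (t - s)) * (M + m)) := by
    intro s hst
    have hcont := hΦ.continuous_integral φ hst
    have hbd : ∀ z, ‖∫ ω, φ (Φ s z t ω) ∂P‖ ≤ ‖φ‖ := fun z => by
      simpa using norm_integral_le_of_norm_le_const (μ := P)
        (ae_of_all _ fun ω => φ.norm_coe_le_norm (Φ s z t ω))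
    have hint : Integrable (fun y => ∫ ω, φ (Φ s y t ω) ∂P) (ν s) :=
      Integrable.of_bound hcont.aestronglyMeasurable ‖φ‖ (ae_of_all _ hbd)
    have hbint : Integrable (fun y : H =>
        lipConst φ * (K * Real.exp (-l * (t - s)) * (M + ‖y‖))) (ν s) :=
      (((integrable_const M).add (hνi s)).const_mul _).const_mul _
    have h1 : ∫ z, φ z ∂(ν t) - c = ∫ y, (∫ ω, φ (Φ s y t ω) ∂P - c) ∂(ν s) := by
      rw [integral_sub hint (integrable_const _), hν.integral_eq s t hst φ]
      simp
    rw [h1]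
    calc |∫ y, (∫ ω, φ (Φ s y t ω) ∂P - c) ∂(ν s)|
        ≤ ∫ y, lipConst φ * (K * Real.exp (-l * (t - s)) * (M + ‖y‖)) ∂(ν s) := by
          rw [← Real.norm_eq_abs]
          exact norm_integral_le_of_norm_le hbint (ae_of_all _ fun y =>
            (hΦ.abs_integral_sub_le (hη t) (hlim t) hst y hφ).2.2)
      _ = lipConst φ * (K * Real.exp (-l * (t - s)) * (M + ∫ y, ‖y‖ ∂(ν s))) := by
          rw [integral_const_mul, integral_const_mul, integral_add (integrable_const _) (hνi s)]
          simp
      _ ≤ _ := by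
          refine mul_le_mul_of_nonneg_left (mul_le_mul_of_nonneg_left ?_ (by positivity))
            (lipConst_nonneg _)
          linarith [hνle s]
  have hlim0 : Tendsto (fun s => lipConst φ * (K * Real.exp (-l * (t - s)) * (M + m))) atBot
      (𝓝 0) := by
    have h1 : Tendsto (fun s => -l * (t - s)) atBot atBot := by
      have h2 : Tendsto (fun s : ℝ => t - s) atBot atTop :=
        tendsto_atTop_add_const_left _ t tendsto_neg_atBot_atTop
      exact h2.const_mul_atTop_of_neg (by linarith [hΦ.rate_pos])
    have h3 := (((Real.tendsto_exp_atBot.comp h1).const_mul K).mul_const (M + m)).const_mul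
      (lipConst φ)
    simpa using h3
  have h0 : |∫ z, φ z ∂(ν t) - c| ≤ 0 :=
    ge_of_tendsto hlim0 ((eventually_le_atBot t).mono hbound)
  exact sub_eq_zero.1 (abs_nonpos_iff.1 h0)

end Ergodic

/-! ### The frozen equation as a contractive flow -/

section Frozen

variable {H : Type*} [NormedAddCommGroup H] [InnerProductSpace ℝ H] [CompleteSpace H]
  [MeasurableSpace H] [BorelSpace H] {e : HilbertBasis ℕ ℝ H} {α : ℝ} {β γ : ℕ → ℝ}
  {Ω : Type*} [MeasurableSpace Ω] {P : Measure Ω} [IsProbabilityMeasure P]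
  {Z Ztilde : ℕ → ℝ≥0 → Ω → ℝ} (hN : IsStableNoise P α β γ Z Ztilde)
  {G : ℝ → H → H → H} {x : H} {A L : ℝ} (hF : IsDissipativeDrift (β 0) (fun t => G t x) A L)

omit [CompleteSpace H] [BorelSpace H] [IsProbabilityMeasure P] in
theorem FrozenSPDE.IsMildSolution.measurable_apply {s t : ℝ} (hst : s ≤ t) {y : H}
    {Y : ℝ → Ω → H} (hY : IsMildSolution P e β γ G (twoSided Z Ztilde) s x y Y) :
    Measurable (Y t) := by
  simpa only [max_eq_right hst] using (hY.isMildFrom t).measurable_apply t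

include hN hF in
theorem FrozenSPDE.IsMildSolution.ae_eq {s t : ℝ} (hst : s ≤ t) {y : H} {Y Y' : ℝ → Ω → H}
    (hY : IsMildSolution P e β γ G (twoSided Z Ztilde) s x y Y)
    (hY' : IsMildSolution P e β γ G (twoSided Z Ztilde) s x y Y') : Y t =ᵐ[P] Y' t := by
  simpa only [max_eq_right hst] using
    (hY.isMildFrom t).ae_eq hN hF hst measurable_const (hY'.isMildFrom t)

include hN hF in
/-- The solutions of the frozen equation form a contractive flow. -/
theorem isContractiveFlow_of_isMildSolution {Φ : ℝ → H → ℝ → Ω → H}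
    (hΦ : ∀ s y, IsMildSolution P e β γ G (twoSided Z Ztilde) s x y (Φ s y)) {M : ℝ} (hM : 0 ≤ M)
    (hmom : ∀ s t, s ≤ t → eLpNorm (Φ s 0 t) 1 P ≤ ENNReal.ofReal M) :
    IsContractiveFlow P ((β 0 + L) / (β 0 - L)) ((β 0 - L) / 2) M Φ := by
  have hb := hN.pos 0
  have hL := hF.nonneg
  have hLb := sub_pos.2 hF.lt
  refine ⟨by positivity, by positivity, hM, fun s t y hst => (hΦ s y).measurable_apply hst,
    fun s y => ?_, fun u s t hus hst y z => ?_, fun u s t hus hst y z => ?_, hmom⟩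
  · simpa only [max_self] using ((hΦ s y).isMildFrom s).initial_eq le_rfl
  · have h1 := (((hΦ u y).isMildFrom t).restart hN.pos hN.mono hN.ae_regular hus).enorm_sub_le
      hN.pos hN.mono hF.measurable hF.lip hF.nonneg hF.lt
      (((hΦ u y).isMildFrom t).measurable_apply s) measurable_const ((hΦ s z).isMildFrom t) hst
    simp only [max_eq_right hst, max_eq_right hus, max_eq_right (hus.trans hst)] at h1
    filter_upwards [h1] with ω h2
    rw [← ofReal_norm, ← ofReal_norm, ← ENNReal.ofReal_mul (by positivity),
      ENNReal.ofReal_le_ofReal_iff (by positivity), neg_div] at h2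
    exact h2
  · simpa only [max_eq_right hst, max_eq_right hus] using
      ((hΦ u y).isMildFrom s).indepFun hN hF hus hst ((hΦ s z).isMildFrom t)

-- Taking the `p`-th root makes the moment bound linear in `1 + A`. The constant is fixed before the
-- drift and the frozen variable, so the final estimate can be linear in `‖x‖` with a constant
-- independent of `x`.
include hN in
theorem exists_eLpNorm_isMildSolution_le (hL : 0 ≤ L) (hLb : L < β 0) {p : ℝ} (hp : 1 ≤ p)
    (hpα : p < α) :
    ∃ C : ℝ, 0 ≤ C ∧ ∀ (G : ℝ → H → H → H) (x : H) (A : ℝ),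
      IsDissipativeDrift (β 0) (fun t => G t x) A L → ∀ (s t : ℝ), s ≤ t → ∀ Y : ℝ → Ω → H,
        IsMildSolution P e β γ G (twoSided Z Ztilde) s x 0 Y →
        eLpNorm (Y t) (ENNReal.ofReal p) P ≤ ENNReal.ofReal (C * (1 + A)) := by
  have hp0 : 0 < p := one_pos.trans_le hp
  obtain ⟨C, hC, h⟩ := exists_lintegral_mild_le (e := e) hN hL hLb hp hpα
  refine ⟨(C ^ (1 / p)).toReal, ENNReal.toReal_nonneg, fun G x A hF s t hst Y hY => ?_⟩
  have hA := hF.growth_const_nonneg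
  have h1 := h A _ hF s t hst 0 _ (hY.isMildFrom t)
  simp only [max_eq_right hst, norm_zero, add_zero] at h1
  rw [eLpNorm_eq_lintegral_rpow_enorm_toReal (by simpa using hp0) ENNReal.ofReal_ne_top,
    ENNReal.toReal_ofReal hp0.le, ENNReal.ofReal_mul ENNReal.toReal_nonneg,
    ENNReal.ofReal_toReal (ENNReal.rpow_ne_top_of_nonneg (by positivity) hC)]
  refine (ENNReal.rpow_le_rpow h1 (by positivity)).trans (le_of_eq ?_)
  rw [ENNReal.mul_rpow_of_nonneg _ _ (by positivity), ← ENNReal.rpow_mul,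
    mul_one_div_cancel hp0.ne', ENNReal.rpow_one]

end Frozen

/-! ### Assembly -/

theorem proposition4p4
    {H : Type*} [NormedAddCommGroup H] [InnerProductSpace ℝ H] [CompleteSpace H]
    [MeasurableSpace H] [BorelSpace H]
    -- the eigenbasis and eigenvalues of `B` (numbered from `0`, so that `β 0` is the smallest one)
    (e : HilbertBasis ℕ ℝ H) (β : ℕ → ℝ) (hβ_pos : ∀ k, 0 < β k) (hβ_mono : Monotone β)
    (hβ_top : Tendsto β atTop atTop)
    (α : ℝ) (hα_one : 1 < α) (hα_two : α < 2)
    (γ : ℕ → ℝ) (hγ_pos : ∀ k, 0 < γ k) (hγ_sum : Summable (fun k => γ k ^ α / β k))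
    (G : ℝ → H → H → H) (hG_meas : Measurable (fun q : ℝ × H × H => G q.1 q.2.1 q.2.2))
    (CG LG : ℝ) (hCG : 0 < CG) (hLG : LG < β 0)
    (hG_lip : ∀ t x₁ x₂ y₁ y₂, ‖G t x₁ y₁ - G t x₂ y₂‖ ≤ CG * ‖x₁ - x₂‖ + LG * ‖y₁ - y₂‖)
    (hG_growth : ∀ t x y, ‖G t x y‖ ≤ CG * (1 + ‖x‖) + LG * ‖y‖)
    {Ω : Type*} [MeasurableSpace Ω] (P : Measure Ω) [IsProbabilityMeasure P]
    (Z Ztilde : ℕ → ℝ≥0 → Ω → ℝ)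
    (hZ : ∀ k, IsSymmStableProcess P α (Z k))
    (hZtilde : ∀ k, IsSymmStableProcess P α (Ztilde k))
    (hindep : iIndepFun (fun (i : ℕ ⊕ ℕ) (ω : Ω) (t : ℝ≥0) => Sum.elim Z Ztilde i t ω) P) :
    -- the frozen equation has a mild solution, unique up to modification
    (∀ s x y, ∃ Y, IsMildSolution P e β γ G (twoSided Z Ztilde) s x y Y) ∧
    (∀ s x y Y Y', IsMildSolution P e β γ G (twoSided Z Ztilde) s x y Y →
      IsMildSolution P e β γ G (twoSided Z Ztilde) s x y Y' → ∀ t, s ≤ t → Y t =ᵐ[P] Y' t) ∧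
    ∃ C : ℝ, 0 < C ∧
      ∀ Y : ℝ → H → H → ℝ → Ω → H,
        (∀ s x y, IsMildSolution P e β γ G (twoSided Z Ztilde) s x y (Y s x y)) →
        -- the pullback limits exist
        (∀ x t, ∃ η, IsPullbackLimit P α Y x t η) ∧
        ∀ η : H → ℝ → Ω → H, (∀ x t, IsPullbackLimit P α Y x t (η x t)) →
          -- their laws form an evolution system of measures with bounded first moments
          (∀ x, IsEvolutionSystem (transition P Y x) (fun t => P.map (η x t))) ∧
          (∀ x, HasBoundedFirstMoments (fun t => P.map (η x t))) ∧
          -- the exponential estimate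
          (∀ (x y : H) (s t : ℝ), s ≤ t → ∀ φ : H → ℝ, (∃ K, LipschitzWith K φ) →
            Integrable (fun ω => φ (Y s x y t ω)) P ∧
            Integrable φ (P.map (η x t)) ∧
            |transition P Y x s t φ y - ∫ z, φ z ∂(P.map (η x t))| ≤
              C * lipConst φ * (1 + ‖x‖ + ‖y‖) * Real.exp (-(t - s) * (β 0 - LG) / 2)) ∧
          -- uniqueness
          (∀ (x : H) (ν : ℝ → Measure H), IsEvolutionSystem (transition P Y x) ν →
            HasBoundedFirstMoments ν → ∀ t, ν t = P.map (η x t)) := by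
  have hsc := e.secondCountableTopology
  have hN : IsStableNoise P α β γ Z Ztilde :=
    ⟨hβ_pos, hβ_mono, hα_one, hγ_pos, hγ_sum, hZ, hZtilde, hindep⟩
  -- Nothing assumes `LG` nonnegative; testing the Lipschitz bound on two points at distance one
  -- forces it.
  have hLG0 : 0 ≤ LG := by
    have h := hG_lip 0 0 0 (e 0) 0
    rw [sub_self, norm_zero, mul_zero, zero_add, sub_zero, e.orthonormal.1 0, mul_one] at h
    exact (norm_nonneg _).trans h
  have hF : ∀ x, IsDissipativeDrift (β 0) (fun t => G t x) (CG * (1 + ‖x‖)) LG := fun x =>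
    ⟨hG_meas.comp (by fun_prop : Measurable fun q : ℝ × H => (q.1, x, q.2)),
      fun t y₁ y₂ => by simpa using hG_lip t x x y₁ y₂, fun t y => hG_growth t x y, hLG0, hLG⟩
  have hβ := hβ_pos 0
  have hgap : 0 < β 0 - LG := sub_pos.2 hLG
  obtain ⟨C₁, hC₁, hmom⟩ := exists_eLpNorm_isMildSolution_le (e := e) hN hLG0 hLG le_rfl hα_one
  refine ⟨fun s x y => exists_isMildSolution hN (hF x) s y,
    fun s x y Y Y' hY hY' t hst => hY.ae_eq hN (hF x) hst hY',
    -- The contraction prefactor times a bound for the orbit of `0`, which is at most `C₁ (1 + CG (1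
    -- + ‖x‖))` in `L¹`; the extra `1` absorbs `‖y‖` and keeps the constant positive.
    (β 0 + LG) / (β 0 - LG) * (C₁ * (1 + CG) + 1), by positivity, fun Y hY => ?_⟩
  have hflow : ∀ x, IsContractiveFlow P ((β 0 + LG) / (β 0 - LG)) ((β 0 - LG) / 2)
      (C₁ * (1 + CG * (1 + ‖x‖))) fun s y => Y s x y := fun x =>
    isContractiveFlow_of_isMildSolution hN (hF x) (fun s y => hY s x y) (by positivity)
      fun s t hst => by simpa using hmom G x _ (hF x) s t hst _ (hY s x 0)
  refine ⟨fun x t => ?_, fun η hη => ?_⟩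
  · obtain ⟨η, hηm, hη⟩ := (hflow x).exists_pullback t
    refine ⟨η, fun p hp hpα => ?_⟩
    have hp1 : 1 ≤ ENNReal.ofReal p := ENNReal.one_le_ofReal.2 hp
    obtain ⟨Cp, -, hCp⟩ := exists_eLpNorm_isMildSolution_le (e := e) hN hLG0 hLG hp hpα
    have hrate := hη (ENNReal.ofReal p) _ hp1 fun s r hsr => hCp G x _ (hF x) s r hsr _ (hY s x 0)
    refine ⟨?_, fun y => ?_⟩
    · have h1 : MemLp (Y t x 0 t) (ENNReal.ofReal p) P :=
        ⟨((hY t x 0).measurable_apply le_rfl).aestronglyMeasurable,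
          (hCp G x _ (hF x) t t le_rfl _ (hY t x 0)).trans_lt ENNReal.ofReal_lt_top⟩
      have h2 : MemLp (fun ω => Y t x 0 t ω - η ω) (ENNReal.ofReal p) P :=
        ⟨h1.1.sub hηm.aestronglyMeasurable, (hrate t le_rfl 0).trans_lt
          (ENNReal.mul_lt_top ENNReal.ofReal_lt_top
            (ENNReal.add_lt_top.2 ⟨ENNReal.ofReal_lt_top, enorm_lt_top⟩))⟩
      simpa [Pi.sub_def] using h1.sub h2
    · refine tendsto_of_tendsto_of_tendsto_of_le_of_le' tendsto_const_nhds ?_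
        (Eventually.of_forall fun _ => zero_le) ((eventually_le_atBot t).mono fun s hst =>
          hrate s hst y)
      have h1 : Tendsto (fun s => -((β 0 - LG) / 2) * (t - s)) atBot atBot := by
        have h2 : Tendsto (fun s : ℝ => t - s) atBot atTop :=
          tendsto_atTop_add_const_left _ t tendsto_neg_atBot_atTop
        exact h2.const_mul_atTop_of_neg (by linarith)
      have h3 := ENNReal.tendsto_ofReal ((Real.tendsto_exp_atBot.comp h1).const_mul
        ((β 0 + LG) / (β 0 - LG)))
      rw [mul_zero, ENNReal.ofReal_zero] at h3
      have h4 := ENNReal.Tendsto.mul_const h3 (b := ENNReal.ofReal (Cp * (1 + CG * (1 + ‖x‖))) +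
        ‖y‖ₑ) (Or.inr (ENNReal.add_ne_top.2 ⟨ENNReal.ofReal_ne_top, enorm_ne_top⟩))
      rwa [zero_mul] at h4
  have hη1 : ∀ x t, MemLp (η x t) 1 P := fun x t => by
    simpa using (hη x t 1 le_rfl hα_one).1
  have hlim : ∀ x t, Tendsto (fun s => eLpNorm (fun ω => Y s x 0 t ω - η x t ω) 1 P) atBot
      (𝓝 0) := fun x t => by
    simpa using (hη x t 1 le_rfl hα_one).2 0
  refine ⟨fun x => (hflow x).isEvolutionSystem (fun t => (hη1 x t).1.aemeasurable) (hlim x),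
    fun x => (hflow x).hasBoundedFirstMoments (fun t => (hη1 x t).1) (hlim x),
    fun x y s t hst φ hφ => ?_,
    fun x ν hν hνm t => (hflow x).eq_of_isEvolutionSystem (hη1 x) (hlim x) hν hνm t⟩
  obtain ⟨κ, hφ⟩ := hφ
  obtain ⟨h1, h2, h3⟩ := (hflow x).abs_integral_sub_le (hη1 x t) (hlim x t) hst y hφ
  refine ⟨h1, h2, h3.trans ?_⟩
  have hx := norm_nonneg x
  have hy := norm_nonneg y
  have h4 : C₁ * (1 + CG * (1 + ‖x‖)) + ‖y‖ ≤ (C₁ * (1 + CG) + 1) * (1 + ‖x‖ + ‖y‖) := by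
    have h5 : 0 ≤ C₁ * ‖x‖ := by positivity
    have h6 : 0 ≤ C₁ * ‖y‖ := by positivity
    have h7 : 0 ≤ C₁ * CG * ‖y‖ := by positivity
    nlinarith
  have h8 : -((β 0 - LG) / 2) * (t - s) = -(t - s) * (β 0 - LG) / 2 := by ring
  rw [h8]
  calc _ ≤ lipConst φ * ((β 0 + LG) / (β 0 - LG) * Real.exp (-(t - s) * (β 0 - LG) / 2) *
        ((C₁ * (1 + CG) + 1) * (1 + ‖x‖ + ‖y‖))) :=
        mul_le_mul_of_nonneg_left (mul_le_mul_of_nonneg_left h4 (by positivity)) (lipConst_nonneg φ)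
    _ = _ := by ring
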